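/- Let $n\ge 2$. Let $\mathcal N$ denote the set of functions $\Phi:[0,\infty)\to[0,\infty)$ that are increasing and convex with $\Phi(0)=0$, $\lim_{t\to\infty}\Phi(t)=\infty$, $\lim_{t\to0^+}\Phi(t)/t=0$, $\lim_{t\to\infty}\Phi(t)/t=\infty$, that belong to $C^1([0,\infty))\cap C^2((0,\infty))$, and for which there is a number $s(\Phi)\ge 1$ (an index of $\Phi$) with $\frac1{s(\Phi)}\le \frac{\Phi''(t)t}{\Phi'(t)}\le s(\Phi)$ for all $t>0$. Let $\Omega\subset\mathbb R^n$ be a bounded open set, let $G,H_a,H_b\in\mathcal N$ with indices $s(G),s(H_a),s(H_b)$, and let $\omega_a,\omega_b:[0,\infty)\to[0,\infty)$ be concave with $\omega_a(0)=\omega_b(0)=0$. Let $a,b:\Omega\to[0,\infty)$ with $a\in C^{\omega_a}(\Omega)$, $b\in C^{\omega_b}(\Omega)$, that is, $a$ and $b$ are uniformly continuous on $\Omega$ and the norms $\|f\|_{C^{\omega}(\Omega)}=\|f\|_{L^\infty(\Omega)}+\sup_{x,y\in\Omega,\,x\ne y}\frac{|f(x)-f(y)|}{\omega(|x-y|)}$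 are finite for $(f,\omega)=(a,\omega_a)$ and $(b,\omega_b)$ (with $\frac00=0$ and $\frac r0=\infty$ for $r>0$). Put $$\Psi(x,t)=G(t)+a(x)H_a(t)+b(x)H_b(t),\qquad \Psi_B^-(t)=G(t)+\inf_{B}a\,H_a(t)+\inf_B b\,H_b(t),$$ $$\Lambda(s,t)=\frac{\omega_a(s)}{1+\omega_a(s)}\frac{H_a(t)}{G(t)}+\frac{\omega_b(s)}{1+\omega_b(s)}\frac{H_b(t)}{G(t)},$$ and assume $$\lambda_1:=\sup_{t>0}\Lambda\big(t,G^{-1}(t^{-n})\big)<\infty .$$ Let $Q\ge1$ and let $u\in W^{1,\Psi}(\Omega)$ (that is, $u$ and its distributional gradient $Du$ belong to the Musielak–Orlicz space $L^\Psi(\Omega)$) be a local $Q$-minimizer of $\mathcal P(v,S)=\int_S\Psi(x,|Dv|)\,dx$: $u\in W^{1,1}_{\rm loc}(\Omega)$, $\Psi(x,|Du|)\in L^1(\Omega)$, and $\mathcal P(u,\operatorname{supp}(u-v))\le Q\,\mathcal P(v,\operatorname{supp}(u-v))$ for every $v\in W^{1,1}_{\rm loc}(\Omega)$ with $\operatorname{supp}(u-v)\Subset\Omega$.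 Then there is a constant $c\ge1$, depending only on $n$, $s(G)$, $s(H_a)$, $s(H_b)$, $Q$ and on (upper bounds for) $\lambda_1$, $\|a\|_{C^{\omega_a}(\Omega)}$, $\|b\|_{C^{\omega_b}(\Omega)}$, $\|\Psi(\cdot,|Du|)\|_{L^1(\Omega)}$, $\|u\|_{L^1(\Omega)}$, $\omega_a(1)$, $\omega_b(1)$, such that for every ball $B_R=B_R(x_0)\subset\Omega$ with $0<R\le1$, with $(u)_{B_R}$ the average of $u$ over $B_R$ and $B_{R/2}=B_{R/2}(x_0)$, $$\left\|\Psi^-_{B_R}\!\left(\left|\frac{(u-(u)_{B_R})_\pm}{R}\right|\right)\right\|_{L^\infty(B_{R/2})}\le c\,\frac1{|B_R|}\int_{B_R}\Psi\!\left(x,\left|\frac{(u-(u)_{B_R})_\pm}{R}\right|\right)dx$$ for each of the two signs, and $$\Psi^-_{B_R}\!\left(\left|\frac{u(x_1)-u(x_2)}{R}\right|\right)\le c\,\frac1{|B_R|}\int_{B_R}\Psi(x,|Du|)\,dx\qquad\text{for a.e. }x_1,x_2\in B_{R/2}.$$ In particular, $u\in L^\infty_{\rm loc}(\Omega)$. 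-/

import Mathlib

open Set Filter Topology MeasureTheory
open scoped ENNReal NNReal

namespace MultiPhase

/-- A Young function `Φ : [0,∞) → [0,∞)` not depending on the space variable. It is encoded as
`ℝ → ℝ`; only its values on `[0,∞)` matter. -/
structure IsYoung (Φ : ℝ → ℝ) : Prop where
  nonneg : ∀ t, 0 ≤ t → 0 ≤ Φ t
  mono : MonotoneOn Φ (Ici 0)
  convex : ConvexOn ℝ (Ici 0) Φ
  zero : Φ 0 = 0
  tendsto_atTop : Tendsto Φ atTop atTop
  div_zero : Tendsto (fun t => Φ t / t) (𝓝[>] 0) (𝓝 0)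
  div_atTop : Tendsto (fun t => Φ t / t) atTop atTop

/-- `Φ` belongs to the class `𝒩`, with index `s`: `Φ` is a Young function in
`C¹([0,∞)) ∩ C²((0,∞))` with `1/s ≤ Φ''(t) t / Φ'(t) ≤ s` for all `t > 0`. -/
structure IsN (Φ : ℝ → ℝ) (s : ℝ) : Prop where
  young : IsYoung Φ
  contDiffOn_one : ContDiffOn ℝ 1 Φ (Ici 0)
  contDiffOn_two : ContDiffOn ℝ 2 Φ (Ioi 0)
  one_le : 1 ≤ s
  le_index : ∀ t, 0 < t → 1 / s ≤ deriv (deriv Φ) t * t / deriv Φ t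
  index_le : ∀ t, 0 < t → deriv (deriv Φ) t * t / deriv Φ t ≤ s

/-- A concave function `ω : [0,∞) → [0,∞)` with `ω 0 = 0`. -/
structure IsModulus (ω : ℝ → ℝ) : Prop where
  nonneg : ∀ t, 0 ≤ t → 0 ≤ ω t
  concave : ConcaveOn ℝ (Ici 0) ω
  zero : ω 0 = 0

variable {n : ℕ}

/-- The seminorm `[f]_{ω;Ω} = sup_{x ≠ y} |f x - f y| / ω(|x - y|)`, with values in `[0,∞]`
(a quotient `r / 0` is `∞` for `r > 0`, and `0 / 0 = 0`). -/
noncomputable def modSeminorm (Ω : Set (EuclideanSpace ℝ (Fin n))) (ω : ℝ → ℝ)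
    (f : EuclideanSpace ℝ (Fin n) → ℝ) : ℝ≥0∞ :=
  ⨆ (x ∈ Ω) (y ∈ Ω) (_ : x ≠ y), ENNReal.ofReal |f x - f y| / ENNReal.ofReal (ω (dist x y))

/-- The norm `‖f‖_{C^ω(Ω)} = ‖f‖_{L^∞(Ω)} + [f]_{ω;Ω}`, with values in `[0,∞]`. -/
noncomputable def modNorm (Ω : Set (EuclideanSpace ℝ (Fin n))) (ω : ℝ → ℝ)
    (f : EuclideanSpace ℝ (Fin n) → ℝ) : ℝ≥0∞ :=
  eLpNorm f ∞ (volume.restrict Ω) + modSeminorm Ω ω f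

/-- `f ∈ C^ω(Ω)`. -/
def MemModSpace (Ω : Set (EuclideanSpace ℝ (Fin n))) (ω : ℝ → ℝ)
    (f : EuclideanSpace ℝ (Fin n) → ℝ) : Prop :=
  UniformContinuousOn f Ω ∧ modNorm Ω ω f < ∞

/-- `Ψ(x,t) = G(t) + a(x) H_a(t) + b(x) H_b(t)`. -/
def Psi (G Ha Hb : ℝ → ℝ) (a b : EuclideanSpace ℝ (Fin n) → ℝ)
    (x : EuclideanSpace ℝ (Fin n)) (t : ℝ) : ℝ :=
  G t + a x * Ha t + b x * Hb t

/-- `Ψ_B^-(t) = G(t) + inf_B a · H_a(t) + inf_B b · H_b(t)`. -/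
noncomputable def PsiMinus (G Ha Hb : ℝ → ℝ) (a b : EuclideanSpace ℝ (Fin n) → ℝ)
    (B : Set (EuclideanSpace ℝ (Fin n))) (t : ℝ) : ℝ :=
  G t + sInf (a '' B) * Ha t + sInf (b '' B) * Hb t

/-- The function `Λ(s,t)`. -/
noncomputable def Lam (ωa ωb G Ha Hb : ℝ → ℝ) (s t : ℝ) : ℝ :=
  ωa s / (1 + ωa s) * (Ha t / G t) + ωb s / (1 + ωb s) * (Hb t / G t)

/-- The inverse `G⁻¹ : [0,∞) → [0,∞)` of `G : [0,∞) → [0,∞)`. -/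
noncomputable def invOn (G : ℝ → ℝ) : ℝ → ℝ := Function.invFunOn G (Ici 0)

/-- `λ₁ = sup_{t > 0} Λ(t, G⁻¹(t^{-n}))`, with values in `[0,∞]`. -/
noncomputable def lambdaOne (n : ℕ) (ωa ωb G Ha Hb : ℝ → ℝ) : ℝ≥0∞ :=
  ⨆ (t : ℝ) (_ : 0 < t), ENNReal.ofReal (Lam ωa ωb G Ha Hb t (invOn G ((t ^ n)⁻¹)))

/-- `u ∈ W^{1,1}_loc(Ω)` with distributional gradient `Du`. -/
structure HasWeakGradient (Ω : Set (EuclideanSpace ℝ (Fin n)))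
    (u : EuclideanSpace ℝ (Fin n) → ℝ)
    (Du : EuclideanSpace ℝ (Fin n) → EuclideanSpace ℝ (Fin n)) : Prop where
  locInt : LocallyIntegrableOn u Ω
  locInt_grad : LocallyIntegrableOn Du Ω
  integral_eq : ∀ φ : EuclideanSpace ℝ (Fin n) → ℝ, ContDiff ℝ ((⊤ : ℕ∞) : WithTop ℕ∞) φ → HasCompactSupport φ →
    tsupport φ ⊆ Ω → ∀ e : EuclideanSpace ℝ (Fin n),
      ∫ x in Ω, u x * fderiv ℝ φ x e = - ∫ x in Ω, φ x * inner ℝ (Du x) e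

/-- `v ∈ L^Ψ(Ω)`, the Musielak-Orlicz space: the linear hull of all measurable functions with
`∫_Ω Ψ(x,|v|) dx < ∞`. -/
def MemMusielakOrlicz {F : Type*} [NormedAddCommGroup F]
    (Ω : Set (EuclideanSpace ℝ (Fin n))) (Ψ : EuclideanSpace ℝ (Fin n) → ℝ → ℝ)
    (v : EuclideanSpace ℝ (Fin n) → F) : Prop :=
  AEStronglyMeasurable v (volume.restrict Ω) ∧
    ∃ σ : ℝ, 0 < σ ∧ ∫⁻ x in Ω, ENNReal.ofReal (Ψ x (‖v x‖ / σ)) < ∞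

/-- `u ∈ W^{1,Ψ}(Ω)` with distributional gradient `Du`. -/
structure MemMOSobolev (Ω : Set (EuclideanSpace ℝ (Fin n)))
    (Ψ : EuclideanSpace ℝ (Fin n) → ℝ → ℝ) (u : EuclideanSpace ℝ (Fin n) → ℝ)
    (Du : EuclideanSpace ℝ (Fin n) → EuclideanSpace ℝ (Fin n)) : Prop where
  hasWeakGradient : HasWeakGradient Ω u Du
  mem : MemMusielakOrlicz Ω Ψ u
  mem_grad : MemMusielakOrlicz Ω Ψ Du

/-- The energy `𝒫(v, S) = ∫_S Ψ(x,|Dv|) dx`, with values in `[0,∞]`. -/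
noncomputable def energy (Ψ : EuclideanSpace ℝ (Fin n) → ℝ → ℝ)
    (Dv : EuclideanSpace ℝ (Fin n) → EuclideanSpace ℝ (Fin n))
    (S : Set (EuclideanSpace ℝ (Fin n))) : ℝ≥0∞ :=
  ∫⁻ x in S, ENNReal.ofReal (Ψ x ‖Dv x‖)

/-- The support in `Ω` of (the almost everywhere class of) a function `w`: the points of `Ω` none
of whose neighbourhoods `U` satisfies `w = 0` almost everywhere in `U`. -/
def essSupport (Ω : Set (EuclideanSpace ℝ (Fin n))) (w : EuclideanSpace ℝ (Fin n) → ℝ) :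
    Set (EuclideanSpace ℝ (Fin n)) :=
  {x ∈ Ω | ∀ U ∈ 𝓝 x, ¬ ∀ᵐ y ∂(volume.restrict U), w y = 0}

/-- `u`, with distributional gradient `Du`, is a local `Q`-minimizer of `𝒫`. The support in `Ω`
is relatively closed, so it is compactly contained in `Ω` exactly when it is compact. -/
structure IsLocalQMinimizer (Ω : Set (EuclideanSpace ℝ (Fin n)))
    (Ψ : EuclideanSpace ℝ (Fin n) → ℝ → ℝ) (Q : ℝ) (u : EuclideanSpace ℝ (Fin n) → ℝ)
    (Du : EuclideanSpace ℝ (Fin n) → EuclideanSpace ℝ (Fin n)) : Prop where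
  hasWeakGradient : HasWeakGradient Ω u Du
  energy_lt_top : energy Ψ Du Ω < ∞
  minimal : ∀ (v : EuclideanSpace ℝ (Fin n) → ℝ)
    (Dv : EuclideanSpace ℝ (Fin n) → EuclideanSpace ℝ (Fin n)), HasWeakGradient Ω v Dv →
    IsCompact (essSupport Ω (u - v)) →
      energy Ψ Du (essSupport Ω (u - v)) ≤
        ENNReal.ofReal Q * energy Ψ Dv (essSupport Ω (u - v))

end MultiPhase

open MultiPhase

/-! On a ball `B` of radius `R ≤ 1` inside `Ω` the density is nearly autonomous: writing `φ` for
`Ψ_B^-`, one has `φ t ≤ Ψ x t ≤ K (1 + R φ(t)^(1/n)) φ t` for `x ∈ B` (`isMultiPhase`). The upper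
bound is the finiteness of `λ₁` read at the radius `r = G(t)^(-1/n)`: there `ω_a(r) H_a(t) ≤ (1 +
ω_a(r)) λ₁ G(t)`, and passing from `r` to `R` costs at most a factor of order `1 + R / r`, by
monotonicity and concavity of the modulus. Apart from measurability, this two-sided bound and the
doubling property are all that the regularity theory needs to know about `Ψ`.

The exponent `1/n` is exactly what Sobolev's inequality can absorb. By Hölder, `∫ φ^(1/n) φ ≤ (∫
φ)^(1/n) (∫ φ^(n/(n-1)))^((n-1)/n)`, and the embedding of `W^{1,1}` applied to `φ(|w|/R)` bounds `R`
times the last factor by `∫ φ(|w|/R) + ∫ φ(|Dw|)` (`exists_sobolev_const`). The remaining factor `(∫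
φ)^(1/n)` is controlled by the energy, which is how the energy enters the constant. With a Poincaré
inequality this yields the Sobolev–Poincaré inequality `exists_sobolev_poincare_const`, which bounds
the excess of `u` over its mean.

Testing quasi-minimality with `η (u - k)_+` gives the Caccioppoli inequality
(`exists_caccioppoli_const`), once energies are compared on the set where the perturbation is
nonzero. The definition compares them on its support, which may exceed that set by positive measure,
and there a factor `Q > 1` cannot be cancelled. `IsLocalQMinimizer.energy_pos_le` bridges this gap:
the perturbation `w` is replaced by its minimum with `2 (f - ε)_+`, where `f` is a mollification of
`w`. The support then lies in the closed set `{f ≥ ε}`, which differs little from `{w > 0}`. The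
error is small because the energy densities of the mollified gradients are controlled by mollified
energy densities (`IsMultiPhase.exists_moll_bound`), which again uses the two-sided bound.

The Caccioppoli and Sobolev inequalities on shrinking balls and rising levels give a superlinear
recursion with exponent `1 + 1/n²`. Hence `u ≤ m + k` on the half ball as soon as the excess over
`m` is below `δ R^n Ψ^-(k/R)` (`exists_degiorgi_const`). Choosing `k` so that this holds with near
equality is the local maximum principle (`exists_sup_const`). Applying it to `u` and `-u` with `m`
the mean gives both one-sided estimates, and with the Sobolev–Poincaré inequality also the
oscillation estimate and local boundedness (`exists_local_bound_const`). -/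

namespace MultiPhase

/-! ### Growth functions: convexity, doubling, even extension. -/

/-- A convex growth function with the doubling property `φ (c t) ≤ c ^ q φ t` for `c ≥ 1`, whose
even extension to the real line is continuously differentiable. -/
structure IsGrowth (q : ℕ) (φ : ℝ → ℝ) : Prop where
  zero : φ 0 = 0
  pos : ∀ t, 0 < t → 0 < φ t
  mono : MonotoneOn φ (Ici 0)
  convex : ConvexOn ℝ (Ici 0) φ
  cont : ContinuousOn φ (Ici 0)
  doubling : ∀ c t, 1 ≤ c → 0 ≤ t → φ (c * t) ≤ c ^ q * φ t
  contDiff_abs : ContDiff ℝ 1 (fun t => φ |t|)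

namespace IsGrowth

variable {q : ℕ} {φ : ℝ → ℝ}

lemma nonneg (h : IsGrowth q φ) {t : ℝ} (ht : 0 ≤ t) : 0 ≤ φ t := by
  rw [← h.zero]; exact h.mono (mem_Ici.2 le_rfl) ht ht

lemma le_of_le (h : IsGrowth q φ) {s t : ℝ} (hs : 0 ≤ s) (hst : s ≤ t) : φ s ≤ φ t :=
  h.mono hs (hs.trans hst) hst

lemma map_add_le (h : IsGrowth q φ) {s t : ℝ} (hs : 0 ≤ s) (ht : 0 ≤ t) :
    φ (s + t) ≤ 2 ^ q * (φ s + φ t) := by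
  have key : ∀ {a b : ℝ}, 0 ≤ a → 0 ≤ b → a ≤ b → φ (a + b) ≤ 2 ^ q * (φ a + φ b) := by
    intro a b ha hb hab
    calc φ (a + b) ≤ φ (2 * b) := h.le_of_le (by positivity) (by linarith)
      _ ≤ 2 ^ q * φ b := h.doubling 2 b one_le_two hb
      _ ≤ 2 ^ q * (φ a + φ b) := by have := h.nonneg ha; gcongr; linarith
  rcases le_total s t with hst | hst
  · exact key hs ht hst
  · rw [add_comm s t, add_comm (φ s)]; exact key ht hs hst

lemma le_map_mul (h : IsGrowth q φ) {c t : ℝ} (hc : 1 ≤ c) (ht : 0 ≤ t) : c * φ t ≤ φ (c * t) := by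
  have hc0 : 0 < c := by linarith
  have := h.convex.2 (mem_Ici.2 (le_refl (0 : ℝ))) (mem_Ici.2 (by positivity : 0 ≤ c * t))
    (by rw [sub_nonneg, div_le_one hc0]; exact hc : 0 ≤ 1 - 1 / c)
    (by positivity : 0 ≤ 1 / c) (by ring)
  simp only [smul_eq_mul, mul_zero, zero_add, h.zero] at this
  rw [← mul_assoc, one_div, inv_mul_cancel₀ hc0.ne', one_mul] at this
  rw [← div_eq_inv_mul, le_div_iff₀ hc0] at this
  linarith

/-- The tangent line at `s` to the even convex extension lies below its graph at `s + t` and `s -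
t`. This is Young's inequality `φ'(s) t ≤ C (φ(s) + φ(t))` without the conjugate function; it splits
the gradient of `φ(|w|/R)` in Sobolev's inequality. -/
lemma abs_deriv_mul_le (h : IsGrowth q φ) (s : ℝ) {t : ℝ} (ht : 0 ≤ t) :
    |deriv (fun t => φ |t|) s| * t ≤ 2 ^ q * (φ |s| + φ t) := by
  set f : ℝ → ℝ := fun t => φ |t| with hf
  have hfc : ConvexOn ℝ univ f := by
    refine ⟨convex_univ, fun x _ y _ a b ha hb hab => ?_⟩
    calc φ |a • x + b • y| ≤ φ (a • |x| + b • |y|) := by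
          apply h.le_of_le (abs_nonneg _)
          refine (abs_add_le _ _).trans ?_
          simp [abs_mul, abs_of_nonneg ha, abs_of_nonneg hb]
      _ ≤ _ := h.convex.2 (mem_Ici.2 (abs_nonneg x)) (mem_Ici.2 (abs_nonneg y)) ha hb hab
  have hd : DifferentiableAt ℝ f s := h.contDiff_abs.differentiable one_ne_zero s
  have key : ∀ y, deriv f s * (y - s) ≤ f y - f s := by
    intro y
    rcases lt_trichotomy s y with hy | hy | hy
    · have := hfc.deriv_le_slope (mem_univ s) (mem_univ y) hy hd
      rw [slope_def_field, le_div_iff₀ (by linarith)] at this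
      exact this
    · simp [hy]
    · have := hfc.slope_le_deriv (mem_univ y) (mem_univ s) hy hd
      rw [slope_def_field, div_le_iff₀ (by linarith)] at this
      linarith
  have fs : 0 ≤ f s := h.nonneg (abs_nonneg s)
  have b1 : f (s + t) ≤ 2 ^ q * (φ |s| + φ t) := by
    refine (h.le_of_le (abs_nonneg _) ((abs_add_le s t).trans ?_)).trans
      (h.map_add_le (abs_nonneg s) ht)
    rw [abs_of_nonneg ht]
  have b2 : f (s - t) ≤ 2 ^ q * (φ |s| + φ t) := by
    refine (h.le_of_le (abs_nonneg _) ((abs_sub s t).trans ?_)).trans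
      (h.map_add_le (abs_nonneg s) ht)
    rw [abs_of_nonneg ht]
  rcases abs_cases (deriv f s) with ⟨h1, -⟩ | ⟨h1, -⟩ <;> rw [h1]
  · have := key (s + t); rw [add_sub_cancel_left] at this; linarith
  · have := key (s - t)
    have e : s - t - s = -t := by ring
    rw [e] at this; linarith

lemma exists_eq (h : IsGrowth q φ) {T : ℝ} (hT : 0 < T) : ∃ t, 0 < t ∧ φ t = T := by
  have h1 := h.pos 1 one_pos
  set c := max 1 (T / φ 1)
  have hc : T ≤ φ (c * 1) := by
    refine le_trans ?_ (h.le_map_mul (le_max_left _ _) zero_le_one)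
    rw [← div_le_iff₀ h1]; exact le_max_right _ _
  have hc0 : (0 : ℝ) ≤ c * 1 := by positivity
  obtain ⟨t, ht, e⟩ := intermediate_value_Icc hc0 (h.cont.mono Icc_subset_Ici_self)
    ⟨by rw [h.zero]; exact hT.le, hc⟩
  refine ⟨t, lt_of_le_of_ne ht.1 ?_, e⟩
  rintro rfl
  rw [h.zero] at e; linarith

/-- Doubling with a common exponent `q` survives nonnegative combinations, so every `Ψ x` and every
`Ψ_B^-` lies in one class, with constants independent of the coefficients. -/
lemma lincomb {ψ χ : ℝ → ℝ} (h : IsGrowth q φ) (hψ : IsGrowth q ψ) (hχ : IsGrowth q χ)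
    {α β : ℝ} (hα : 0 ≤ α) (hβ : 0 ≤ β) : IsGrowth q (fun t => φ t + α * ψ t + β * χ t) where
  zero := by simp [h.zero, hψ.zero, hχ.zero]
  pos t ht := by
    have := h.pos t ht
    have := (hψ.pos t ht).le
    have := (hχ.pos t ht).le
    positivity
  mono := fun x hx y hy hxy => by
    have := h.mono hx hy hxy
    have := mul_le_mul_of_nonneg_left (hψ.mono hx hy hxy) hα
    have := mul_le_mul_of_nonneg_left (hχ.mono hx hy hxy) hβ
    show φ x + α * ψ x + β * χ x ≤ φ y + α * ψ y + β * χ y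
    linarith
  convex := by
    exact (h.convex.add (hψ.convex.smul hα)).add (hχ.convex.smul hβ)
  cont := (h.cont.add (hψ.cont.const_mul α)).add (hχ.cont.const_mul β)
  doubling c t hc ht := by
    have h1 := h.doubling c t hc ht
    have h2 := mul_le_mul_of_nonneg_left (hψ.doubling c t hc ht) hα
    have h3 := mul_le_mul_of_nonneg_left (hχ.doubling c t hc ht) hβ
    linarith
  contDiff_abs := (h.contDiff_abs.add (contDiff_const.mul hψ.contDiff_abs)).add
    (contDiff_const.mul hχ.contDiff_abs)

end IsGrowth

/-- The even extension of a `C¹` function on `[0,∞)` with vanishing derivative at `0`. -/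
lemma contDiff_comp_abs {Φ : ℝ → ℝ} (h : ContDiffOn ℝ 1 Φ (Ici 0))
    (h0 : derivWithin Φ (Ici 0) 0 = 0) : ContDiff ℝ 1 (fun t => Φ |t|) := by
  have hcont : ContinuousOn (derivWithin Φ (Ici 0)) (Ici 0) :=
    h.continuousOn_derivWithin (uniqueDiffOn_Ici 0) le_rfl
  -- At each `t` at most one of the two terms differs from the vanishing derivative at `0`, so their
  -- difference is the odd extension of the derivative, visibly continuous.
  have hd : ∀ t, HasDerivAt (fun t => Φ |t|)
      (derivWithin Φ (Ici 0) (max t 0) - derivWithin Φ (Ici 0) (max (-t) 0)) t := by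
    intro t
    have hdw : ∀ t : ℝ, 0 ≤ t → HasDerivWithinAt Φ (derivWithin Φ (Ici 0) t) (Ici 0) t :=
      fun t ht => ((h.differentiableOn one_ne_zero) t ht).hasDerivWithinAt
    rcases lt_trichotomy t 0 with ht | rfl | ht
    · have h1 := (hdw (-t) (by linarith)).hasDerivAt (Ici_mem_nhds (by linarith))
      have h2 := h1.scomp t (hasDerivAt_neg t)
      rw [max_eq_right ht.le, max_eq_left (by linarith), h0]
      simp only [smul_eq_mul, neg_mul, one_mul] at h2
      rw [zero_sub]
      refine h2.congr_of_eventuallyEq ?_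
      filter_upwards [Iio_mem_nhds ht] with x hx
      simp [abs_of_neg (mem_Iio.1 hx)]
    · simp only [neg_zero, max_self, sub_self]
      have h1 := hdw 0 le_rfl
      rw [h0] at h1
      rw [hasDerivAt_iff_isLittleO] at *
      rw [hasDerivWithinAt_iff_isLittleO] at h1
      have h3 : Tendsto (fun t : ℝ => |t|) (𝓝 0) (𝓝[Ici 0] 0) := by
        refine tendsto_nhdsWithin_iff.2 ⟨?_, Eventually.of_forall fun x => abs_nonneg x⟩
        simpa using (continuous_abs (G := ℝ)).tendsto 0
      have h4 := h1.comp_tendsto h3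
      simp only [Function.comp_def, smul_zero, sub_zero, abs_zero] at h4 ⊢
      refine h4.trans_isBigO ?_
      exact (Asymptotics.isBigO_refl _ _).norm_left
    · have h1 := (hdw t ht.le).hasDerivAt (Ici_mem_nhds ht)
      rw [max_eq_left ht.le, max_eq_right (by linarith), h0, sub_zero]
      refine h1.congr_of_eventuallyEq ?_
      filter_upwards [Ioi_mem_nhds ht] with x hx
      simp [abs_of_pos (mem_Ioi.1 hx)]
  rw [contDiff_one_iff_deriv]
  refine ⟨fun t => (hd t).differentiableAt, ?_⟩
  rw [funext fun t => (hd t).deriv]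
  refine Continuous.sub ?_ ?_
  · exact hcont.comp_continuous (by fun_prop) fun x => mem_Ici.2 (le_max_right _ _)
  · exact hcont.comp_continuous (by fun_prop) fun x => mem_Ici.2 (le_max_right _ _)

/-- The upper index bound says `(t Φ')' ≤ (s + 1) Φ'`; integrated from `0` it gives `t Φ' ≤ (s + 1)
Φ`, so `Φ / t^q` is nonincreasing once `q ≥ s + 1`, which is doubling. The lower bound serves only
to make `Φ'` positive, and `Φ(t)/t → 0` gives the vanishing derivative at `0` needed for a `C¹` even
extension. -/
lemma IsN.isGrowth {Φ : ℝ → ℝ} {s : ℝ} (h : IsN Φ s) {q : ℕ} (hq : s + 1 ≤ q) :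
    IsGrowth q Φ := by
  have hs : 0 < s := by linarith [h.one_le]
  have hcont : ContinuousOn Φ (Ici 0) := h.contDiffOn_one.continuousOn
  have hd : ∀ t, 0 < t → HasDerivAt Φ (deriv Φ t) t := fun t ht =>
    ((h.contDiffOn_two.differentiableOn two_ne_zero t ht).differentiableAt
      (Ioi_mem_nhds ht)).hasDerivAt
  have hd2 : ∀ t, 0 < t → HasDerivAt (deriv Φ) (deriv (deriv Φ) t) t := by
    intro t ht
    have h1 : ContDiffOn ℝ 1 (deriv Φ) (Ioi 0) :=
      h.contDiffOn_two.deriv_of_isOpen isOpen_Ioi (by norm_num)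
    exact ((h1.differentiableOn one_ne_zero t ht).differentiableAt (Ioi_mem_nhds ht)).hasDerivAt
  have hpos : ∀ t, 0 < t → 0 < deriv Φ t := by
    intro t ht
    have h1 : 0 ≤ deriv Φ t := by
      have := h.young.mono.derivWithin_nonneg (x := t)
      rwa [derivWithin_of_mem_nhds (Ici_mem_nhds ht)] at this
    -- If `Φ'` vanished at `t`, the index quotient would be `0` by the convention for division by
    -- zero, contradicting the lower bound `1 / s`.
    refine lt_of_le_of_ne h1 fun e => ?_
    have h2 := h.le_index t ht
    rw [← e, div_zero] at h2
    have : 0 < 1 / s := by positivity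
    linarith
  have hnn : ∀ t, 0 ≤ t → 0 ≤ Φ t := h.young.nonneg
  have hidx : ∀ t, 0 < t → deriv Φ t * t ≤ (s + 1) * Φ t := by
    intro t ht
    set g : ℝ → ℝ := fun t => (s + 1) * Φ t - deriv Φ t * t with hg
    have hgd : ∀ t, 0 < t → HasDerivAt g ((s + 1) * deriv Φ t -
        (deriv (deriv Φ) t * t + deriv Φ t * 1)) t := fun t ht =>
      ((hd t ht).const_mul _).sub ((hd2 t ht).mul (hasDerivAt_id t))
    have hgm : MonotoneOn g (Ioi 0) := by
      refine monotoneOn_of_deriv_nonneg (convex_Ioi 0)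
        (fun t ht => (hgd t ht).continuousAt.continuousWithinAt)
        (fun t ht => (hgd t (interior_subset ht)).differentiableAt.differentiableWithinAt) ?_
      intro t ht
      have ht : 0 < t := interior_subset ht
      rw [(hgd t ht).deriv]
      have := h.index_le t ht
      rw [div_le_iff₀ (hpos t ht)] at this
      linarith
    -- Convexity gives `ε Φ'(ε) ≤ Φ(2ε) - Φ(ε)`. This supplies the boundary value of `g` at `0`
    -- without any statement about the limit of `Φ'`.
    have hlow : ∀ ε, 0 < ε → -Φ (2 * ε) ≤ g ε := by
      intro ε hε
      have h1 := h.young.convex.deriv_le_slope (mem_Ici.2 hε.le)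
        (mem_Ici.2 (by linarith : (0 : ℝ) ≤ 2 * ε)) (by linarith) (hd ε hε).differentiableAt
      rw [slope_def_field, le_div_iff₀ (by linarith)] at h1
      have h2 := hnn ε hε.le
      simp only [hg]
      nlinarith
    have hlim : Tendsto (fun ε => -Φ (2 * ε)) (𝓝[>] 0) (𝓝 0) := by
      have h1 : Tendsto Φ (𝓝[Ici 0] 0) (𝓝 0) := by
        have h2 := (hcont 0 (mem_Ici.2 le_rfl)).tendsto
        rwa [h.young.zero] at h2
      have h2 : Tendsto (fun ε : ℝ => 2 * ε) (𝓝[>] 0) (𝓝[Ici 0] 0) := by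
        refine tendsto_nhdsWithin_iff.2 ⟨?_, ?_⟩
        · have : Tendsto (fun ε : ℝ => 2 * ε) (𝓝 0) (𝓝 (2 * 0)) :=
            (continuous_const.mul continuous_id).tendsto 0
          rw [mul_zero] at this
          exact this.mono_left nhdsWithin_le_nhds
        · filter_upwards [self_mem_nhdsWithin] with x hx
          have : (0 : ℝ) < x := hx
          exact mem_Ici.2 (by positivity)
      simpa using (h1.comp h2).neg
    have : 0 ≤ g t := by
      refine le_of_tendsto hlim ?_
      filter_upwards [Ioo_mem_nhdsGT ht] with ε hε
      exact (hlow ε hε.1).trans (hgm hε.1 ht hε.2.le)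
    simp only [hg] at this
    linarith
  have hP : ∀ t, 0 < t → 0 < Φ t := by
    intro t ht
    have h1 := hidx t ht
    have h2 := hpos t ht
    have h3 : 0 < (s + 1) * Φ t := lt_of_lt_of_le (by positivity) h1
    exact pos_of_mul_pos_right h3 (by positivity)
  have hanti : AntitoneOn (fun t => Φ t / t ^ q) (Ioi 0) := by
    have hqd : ∀ t, 0 < t → HasDerivAt (fun t => Φ t / t ^ q)
        ((deriv Φ t * t ^ q - Φ t * (q * t ^ (q - 1))) / (t ^ q) ^ 2) t := fun t ht =>
      (hd t ht).div (hasDerivAt_pow q t) (by positivity)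
    refine antitoneOn_of_deriv_nonpos (convex_Ioi 0)
        (fun t ht => (hqd t ht).continuousAt.continuousWithinAt)
        (fun t ht => (hqd t (interior_subset ht)).differentiableAt.differentiableWithinAt) ?_
    intro t ht
    have ht : 0 < t := interior_subset ht
    rw [(hqd t ht).deriv]
    refine div_nonpos_of_nonpos_of_nonneg ?_ (by positivity)
    have hq0 : q ≠ 0 := by
      rintro rfl
      simp at hq
      linarith
    have e : t ^ q = t ^ (q - 1) * t := by rw [← pow_succ, Nat.sub_add_cancel (by omega)]
    have h1 := hidx t ht
    have h2 : (s + 1) * Φ t ≤ q * Φ t := mul_le_mul_of_nonneg_right hq (hnn t ht.le)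
    have h3 : t ^ (q - 1) * (deriv Φ t * t) ≤ t ^ (q - 1) * (q * Φ t) :=
      mul_le_mul_of_nonneg_left (h1.trans h2) (by positivity)
    rw [e]
    linarith
  have hd0 : derivWithin Φ (Ici 0) 0 = 0 := by
    have h1 : HasDerivWithinAt Φ 0 (Ici 0) 0 := by
      rw [hasDerivWithinAt_iff_tendsto_slope]
      have : Ici (0 : ℝ) \ {0} = Ioi 0 := Ici_sdiff_left
      rw [this]
      refine h.young.div_zero.congr' ?_
      filter_upwards with t
      simp [slope_def_field, h.young.zero]
    exact h1.derivWithin (uniqueDiffOn_Ici 0 0 (mem_Ici.2 le_rfl))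
  refine ⟨h.young.zero, hP, h.young.mono, h.young.convex, hcont, ?_,
    contDiff_comp_abs h.contDiffOn_one hd0⟩
  intro c t hc ht
  rcases ht.eq_or_lt with rfl | ht
  · simp [h.young.zero]
  have hc0 : 0 < c := by linarith
  have := hanti (mem_Ioi.2 ht) (mem_Ioi.2 (by positivity : 0 < c * t)) (by nlinarith)
  simp only at this
  rw [div_le_div_iff₀ (by positivity) (by positivity), mul_pow] at this
  have h3 : 0 < t ^ q := by positivity
  nlinarith

end MultiPhase

/-! ### The almost autonomous structure of the energy density. -/

namespace MultiPhase

variable {n : ℕ}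

/-- The structural properties of the energy density: growth functions `Ψ x` which, on a ball of
radius `R ≤ 1`, are comparable from below with `Ψm x₀ R`, and from above up to a factor
`1 + R (Ψm x₀ R) ^ (1 / n)`. -/
structure IsMultiPhase (Ω : Set (EuclideanSpace ℝ (Fin n))) (q : ℕ) (K : ℝ)
    (Ψ : EuclideanSpace ℝ (Fin n) → ℝ → ℝ) (Ψm : EuclideanSpace ℝ (Fin n) → ℝ → ℝ → ℝ) :
    Prop where
  const_nonneg : 0 ≤ K
  growth : ∀ x ∈ Ω, IsGrowth q (Ψ x)
  aemeasurable : ∀ f : EuclideanSpace ℝ (Fin n) → ℝ, AEMeasurable f (volume.restrict Ω) →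
    (∀ x, 0 ≤ f x) → AEMeasurable (fun x => Ψ x (f x)) (volume.restrict Ω)
  growth_minus : ∀ x₀ R, 0 < R → Metric.ball x₀ R ⊆ Ω → IsGrowth q (Ψm x₀ R)
  minus_le : ∀ x₀ R, Metric.ball x₀ R ⊆ Ω → ∀ x ∈ Metric.ball x₀ R, ∀ t, 0 ≤ t →
    Ψm x₀ R t ≤ Ψ x t
  le_minus : ∀ x₀ R, 0 < R → R ≤ 1 → Metric.ball x₀ R ⊆ Ω → ∀ x ∈ Metric.ball x₀ R, ∀ t, 0 ≤ t →
    Ψ x t ≤ K * (1 + R * (Ψm x₀ R t) ^ (1 / (n : ℝ))) * Ψm x₀ R t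

lemma IsModulus.monotoneOn {ω : ℝ → ℝ} (h : IsModulus ω) : MonotoneOn ω (Ici 0) := by
  intro x hx y hy hxy
  by_contra! hlt
  have hxy' : x < y := lt_of_le_of_ne hxy (by rintro rfl; exact lt_irrefl _ hlt)
  set d := ω x - ω y with hd
  have hd0 : 0 < d := sub_pos.2 hlt
  -- The point where the line through the graph at `x` and `y`, which descends, reaches the value
  -- `-1`; concavity would make `ω z` negative.
  set z := y + (y - x) * (ω y + 1) / d with hz
  have hωy := h.nonneg y hy
  have hyz : y < z := by
    have : 0 < (y - x) * (ω y + 1) / d := by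
      have : 0 < y - x := by linarith
      positivity
    linarith
  have hz0 : (0 : ℝ) ≤ z := le_trans hy hyz.le
  have h1 := h.concave.slope_anti_adjacent hx (mem_Ici.2 hz0) hxy' hyz
  rw [div_le_div_iff₀ (by linarith) (by linarith)] at h1
  have h2 := h.nonneg z hz0
  have e : z - y = (y - x) * (ω y + 1) / d := by rw [hz]; ring
  have e2 : (ω y - ω x) * (z - y) = -((y - x) * (ω y + 1)) := by
    rw [e, show ω y - ω x = -d by rw [hd]; ring]; field_simp
  rw [e2] at h1
  nlinarith

lemma IsModulus.le_mul {ω : ℝ → ℝ} (h : IsModulus ω) {c t : ℝ} (hc : 1 ≤ c) (ht : 0 ≤ t) :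
    ω (c * t) ≤ c * ω t := by
  have hc0 : 0 < c := by linarith
  have := h.concave.2 (mem_Ici.2 (le_refl (0 : ℝ))) (mem_Ici.2 (by positivity : 0 ≤ c * t))
    (by rw [sub_nonneg, div_le_one hc0]; exact hc : 0 ≤ 1 - 1 / c)
    (by positivity : 0 ≤ 1 / c) (by ring)
  simp only [smul_eq_mul, mul_zero, zero_add, h.zero] at this
  rw [← mul_assoc, one_div, inv_mul_cancel₀ hc0.ne', one_mul] at this
  rw [← div_eq_inv_mul, div_le_iff₀ hc0] at this
  linarith

/-- The growth of the modulus term, in terms of `r = G(t) ^ (-1/n)`. -/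
lemma IsModulus.mul_le {ω : ℝ → ℝ} (h : IsModulus ω) {w l r R A g : ℝ} (hw : ω 1 ≤ w)
    (hl : 0 ≤ l) (hr : 0 < r) (hR : 0 < R) (hR1 : R ≤ 1) (hA : 0 ≤ A) (hg : 0 < g)
    (hL : ω r / (1 + ω r) * (A / g) ≤ l) :
    ω R * A ≤ (1 + w) * l * (1 + R / r) * g := by
  have hωr := h.nonneg r hr.le
  have hωR := h.nonneg R hR.le
  have hw0 : 0 ≤ w := (h.nonneg 1 zero_le_one).trans hw
  have hRr : 0 ≤ R / r := by positivity
  rw [← mul_div_assoc, div_mul_eq_mul_div, div_div, div_le_iff₀ (by positivity)] at hL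
  have hRw : ω R ≤ w := (h.monotoneOn hR.le (mem_Ici.2 zero_le_one) hR1).trans hw
  -- For `R ≤ r` monotonicity of `ω` and of `s / (1 + s)` suffices. For `r ≤ R` concavity gives `ω R
  -- ≤ (R / r) ω r`, which produces the factor `R / r`.
  rcases le_total R r with hRr' | hRr'
  · have hm : ω R ≤ ω r := h.monotoneOn hR.le hr.le hRr'
    have h1 : ω R * (1 + ω r) ≤ ω r * (1 + ω R) := by nlinarith
    have h2 : (ω R * A) * (1 + ω r) ≤ ((1 + w) * l * g) * (1 + ω r) := by
      calc (ω R * A) * (1 + ω r) = (ω R * (1 + ω r)) * A := by ring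
        _ ≤ (ω r * (1 + ω R)) * A := by gcongr
        _ = (ω r * A) * (1 + ω R) := by ring
        _ ≤ (l * ((1 + ω r) * g)) * (1 + w) := by gcongr
        _ = _ := by ring
    have h3 := le_of_mul_le_mul_right h2 (by positivity)
    refine h3.trans ?_
    have : 0 ≤ (1 + w) * l * g := by positivity
    nlinarith
  · have hr1 : ω r ≤ w := (h.monotoneOn hr.le (mem_Ici.2 zero_le_one) (hRr'.trans hR1)).trans hw
    have h1 : ω R ≤ R / r * ω r := by
      have := h.le_mul (c := R / r) (t := r) (by rw [le_div_iff₀ hr]; linarith) hr.le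
      rwa [div_mul_cancel₀ _ hr.ne'] at this
    calc ω R * A ≤ (R / r * ω r) * A := by gcongr
      _ = R / r * (ω r * A) := by ring
      _ ≤ R / r * (l * ((1 + w) * g)) := 
        mul_le_mul_of_nonneg_left (hL.trans (by gcongr)) hRr
      _ = (1 + w) * l * (R / r) * g := by ring
      _ ≤ _ := by gcongr; linarith

lemma MemModSpace.abs_sub_le {Ω : Set (EuclideanSpace ℝ (Fin n))} {ω : ℝ → ℝ}
    {f : EuclideanSpace ℝ (Fin n) → ℝ} {N : ℝ≥0} (hω : IsModulus ω) (h : modNorm Ω ω f ≤ N)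
    {x y : EuclideanSpace ℝ (Fin n)} (hx : x ∈ Ω) (hy : y ∈ Ω) :
    |f x - f y| ≤ N * ω (dist x y) := by
  rcases eq_or_ne x y with rfl | hxy
  · simp [hω.zero]
  have h0 := hω.nonneg _ (dist_nonneg (x := x) (y := y))
  have h1 : ENNReal.ofReal |f x - f y| / ENNReal.ofReal (ω (dist x y)) ≤ N := by
    refine le_trans ?_ (le_add_self.trans h)
    rw [modSeminorm]
    exact le_iSup_of_le x (le_iSup_of_le hx (le_iSup_of_le y (le_iSup_of_le hy
      (le_iSup_of_le hxy le_rfl))))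
  rw [ENNReal.div_le_iff_le_mul (Or.inr ENNReal.coe_ne_top) (Or.inl ENNReal.ofReal_ne_top)] at h1
  rw [← ENNReal.ofReal_coe_nnreal, ← ENNReal.ofReal_mul N.coe_nonneg] at h1
  exact (ENNReal.ofReal_le_ofReal_iff (by positivity)).1 h1

lemma MemModSpace.le_sInf_add {Ω : Set (EuclideanSpace ℝ (Fin n))} {ω : ℝ → ℝ}
    {f : EuclideanSpace ℝ (Fin n) → ℝ} {N : ℝ≥0} (hω : IsModulus ω) (h : modNorm Ω ω f ≤ N)
    {x₀ : EuclideanSpace ℝ (Fin n)} {R : ℝ} (hR : 0 < R) (hB : Metric.ball x₀ R ⊆ Ω)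
    {x : EuclideanSpace ℝ (Fin n)} (hx : x ∈ Metric.ball x₀ R) :
    f x ≤ sInf (f '' Metric.ball x₀ R) + 2 * N * ω R := by
  rw [← sub_le_iff_le_add]
  refine le_csInf ⟨f x, x, hx, rfl⟩ ?_
  rintro _ ⟨y, hy, rfl⟩
  have h1 := MemModSpace.abs_sub_le hω h (hB hx) (hB hy)
  have h2 : dist x y ≤ 2 * R := by
    have := dist_triangle_right x y x₀
    rw [Metric.mem_ball] at hx hy
    linarith
  have h3 : ω (dist x y) ≤ 2 * ω R := (hω.monotoneOn dist_nonneg (mem_Ici.2 (by positivity)) h2).trans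
    (hω.le_mul one_le_two hR.le)
  have h4 : (N : ℝ) * ω (dist x y) ≤ N * (2 * ω R) := by gcongr
  have := le_abs_self (f x - f y)
  linarith

lemma lam_le_of_lambdaOne_le {ωa ωb G Ha Hb : ℝ → ℝ} {l : ℝ≥0}
    (h : lambdaOne n ωa ωb G Ha Hb ≤ l) {t : ℝ} (ht : 0 < t) :
    Lam ωa ωb G Ha Hb t (invOn G ((t ^ n)⁻¹)) ≤ l := by
  have h1 : ENNReal.ofReal (Lam ωa ωb G Ha Hb t (invOn G ((t ^ n)⁻¹))) ≤ l :=
    le_trans (le_iSup₂ (f := fun (t : ℝ) (_ : 0 < t) =>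
      ENNReal.ofReal (Lam ωa ωb G Ha Hb t (invOn G ((t ^ n)⁻¹)))) t ht) h
  rw [← ENNReal.ofReal_coe_nnreal] at h1
  exact (ENNReal.ofReal_le_ofReal_iff l.coe_nonneg).1 h1

lemma IsGrowth.strictMonoOn {q : ℕ} {φ : ℝ → ℝ} (h : IsGrowth q φ) : StrictMonoOn φ (Ici 0) := by
  intro x hx y hy hxy
  rcases (mem_Ici.1 hx).eq_or_lt with rfl | hx0
  · rw [h.zero]; exact h.pos y hxy
  · have h1 := h.le_map_mul (c := y / x) (t := x) (by rw [le_div_iff₀ hx0]; linarith) hx0.le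
    rw [div_mul_cancel₀ _ hx0.ne'] at h1
    have h2 : 1 < y / x := by rw [lt_div_iff₀ hx0]; linarith
    have := h.pos x hx0
    nlinarith

lemma IsGrowth.invOn_apply {q : ℕ} {φ : ℝ → ℝ} (h : IsGrowth q φ) {t : ℝ} (ht : 0 ≤ t) :
    invOn φ (φ t) = t :=
  (h.strictMonoOn.injOn).leftInvOn_invFunOn ht

/-- On the ball, `a x` exceeds its infimum by at most `2 ‖a‖ ω_a(R)`, and likewise for `b`. It
remains to absorb `ω_a(R) H_a(t)` into `(1 + R G(t)^(1/n)) G(t)`, which is `IsModulus.mul_le`, and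
to use `G ≤ Ψ_B^-`. -/
lemma isMultiPhase {Ω : Set (EuclideanSpace ℝ (Fin n))} {q : ℕ} (hn : n ≠ 0)
    {G Ha Hb ωa ωb : ℝ → ℝ} {a b : EuclideanSpace ℝ (Fin n) → ℝ}
    {lam normA normB wa1 wb1 : ℝ≥0} (hΩ : IsOpen Ω) (hG : IsGrowth q G) (hHa : IsGrowth q Ha)
    (hHb : IsGrowth q Hb) (hωa : IsModulus ωa) (hωb : IsModulus ωb)
    (hwa : ωa 1 ≤ wa1) (hwb : ωb 1 ≤ wb1)
    (ha0 : ∀ x ∈ Ω, 0 ≤ a x) (hb0 : ∀ x ∈ Ω, 0 ≤ b x)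
    (ha : MemModSpace Ω ωa a) (hna : modNorm Ω ωa a ≤ normA)
    (hb : MemModSpace Ω ωb b) (hnb : modNorm Ω ωb b ≤ normB)
    (hlam : lambdaOne n ωa ωb G Ha Hb ≤ lam) :
    IsMultiPhase Ω q (1 + 2 * normA * ((1 + wa1) * lam) + 2 * normB * ((1 + wb1) * lam))
      (Psi G Ha Hb a b) (fun x₀ R => PsiMinus G Ha Hb a b (Metric.ball x₀ R)) := by
  have hinf0 : ∀ {f : EuclideanSpace ℝ (Fin n) → ℝ} {S : Set (EuclideanSpace ℝ (Fin n))},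
      (∀ x ∈ Ω, 0 ≤ f x) → S ⊆ Ω → 0 ≤ sInf (f '' S) := by
    intro f S hf hS
    refine Real.sInf_nonneg ?_
    rintro _ ⟨x, hx, rfl⟩
    exact hf x (hS hx)
  have hinf_le : ∀ {f : EuclideanSpace ℝ (Fin n) → ℝ} {S : Set (EuclideanSpace ℝ (Fin n))},
      (∀ x ∈ Ω, 0 ≤ f x) → S ⊆ Ω → ∀ x ∈ S, sInf (f '' S) ≤ f x := by
    intro f S hf hS x hx
    refine csInf_le ⟨0, ?_⟩ ⟨x, hx, rfl⟩
    rintro _ ⟨x, hx, rfl⟩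
    exact hf x (hS hx)
  have hmeas : ∀ {φ : ℝ → ℝ}, IsGrowth q φ → ∀ f : EuclideanSpace ℝ (Fin n) → ℝ,
      AEMeasurable f (volume.restrict Ω) → (∀ x, 0 ≤ f x) →
      AEMeasurable (fun x => φ (f x)) (volume.restrict Ω) := by
    intro φ hφ f hf hf0
    -- Nothing is known about `φ` on the negative axis; the even extension is continuous on the
    -- whole line and hence measurable.
    have e : (fun x => φ (f x)) = fun x => (fun t => φ |t|) (f x) := by
      funext x; simp only [abs_of_nonneg (hf0 x)]
    rw [e]
    exact hφ.contDiff_abs.continuous.measurable.comp_aemeasurable hf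
  refine ⟨by positivity, fun x hx => hG.lincomb hHa hHb (ha0 x hx) (hb0 x hx), ?_, fun x₀ R hR hB =>
    hG.lincomb hHa hHb (hinf0 ha0 hB) (hinf0 hb0 hB), ?_, ?_⟩
  · intro f hf hf0
    have ha' := ha.1.continuousOn.aemeasurable (μ := volume) hΩ.measurableSet
    have hb' := hb.1.continuousOn.aemeasurable (μ := volume) hΩ.measurableSet
    exact ((hmeas hG f hf hf0).add (ha'.mul (hmeas hHa f hf hf0))).add
      (hb'.mul (hmeas hHb f hf hf0))
  · intro x₀ R hB x hx t ht
    have h1 := mul_le_mul_of_nonneg_right (hinf_le ha0 hB x hx) (hHa.nonneg ht)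
    have h2 := mul_le_mul_of_nonneg_right (hinf_le hb0 hB x hx) (hHb.nonneg ht)
    simp only [Psi, PsiMinus]
    linarith
  · intro x₀ R hR hR1 hB x hx t ht
    rcases ht.eq_or_lt with rfl | ht
    · simp [Psi, PsiMinus, hG.zero, hHa.zero, hHb.zero]
    have hGt := hG.pos t ht
    have hAt := hHa.nonneg ht.le
    have hBt := hHb.nonneg ht.le
    have ia := hinf0 ha0 hB
    have ib := hinf0 hb0 hB
    -- The radius for which `G⁻¹(r^(-n)) = t`, so that the bound by `λ₁` concerns exactly `H_a(t) /
    -- G(t)` and `H_b(t) / G(t)`.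
    set r : ℝ := ((G t) ^ (1 / (n : ℝ)))⁻¹ with hr
    have hr0 : 0 < r := by positivity
    have hrn : (r ^ n)⁻¹ = G t := by
      rw [hr, inv_pow, inv_inv, one_div, Real.rpow_inv_natCast_pow hGt.le hn]
    have hL := lam_le_of_lambdaOne_le hlam hr0
    rw [hrn, hG.invOn_apply ht.le, Lam] at hL
    have hωar := hωa.nonneg r hr0.le
    have hωbr := hωb.nonneg r hr0.le
    have pa : 0 ≤ ωa r / (1 + ωa r) * (Ha t / G t) := by positivity
    have pb : 0 ≤ ωb r / (1 + ωb r) * (Hb t / G t) := by positivity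
    have ka := hωa.mul_le hwa lam.coe_nonneg hr0 hR hR1 hAt hGt (by linarith)
    have kb := hωb.mul_le hwb lam.coe_nonneg hr0 hR hR1 hBt hGt (by linarith)
    have eRr : R / r = R * (G t) ^ (1 / (n : ℝ)) := by rw [hr, div_inv_eq_mul]
    rw [eRr] at ka kb
    have la := MemModSpace.le_sInf_add hωa hna hR hB hx
    have lb := MemModSpace.le_sInf_add hωb hnb hR hB hx
    set P := PsiMinus G Ha Hb a b (Metric.ball x₀ R) t with hP
    have hGP : G t ≤ P := by
      simp only [hP, PsiMinus]
      have := mul_nonneg ia hAt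
      have := mul_nonneg ib hBt
      linarith
    have hfac : 1 + R * (G t) ^ (1 / (n : ℝ)) ≤ 1 + R * P ^ (1 / (n : ℝ)) := by gcongr
    have hfac1 : 1 ≤ 1 + R * P ^ (1 / (n : ℝ)) := by
      have : 0 ≤ R * P ^ (1 / (n : ℝ)) := by have := hGt.le.trans hGP; positivity
      linarith
    set S := 1 + R * P ^ (1 / (n : ℝ)) with hS
    have hP0 : 0 ≤ P := hGt.le.trans hGP
    have ka' : ωa R * Ha t ≤ (1 + wa1) * lam * S * P := ka.trans (by gcongr)
    have kb' : ωb R * Hb t ≤ (1 + wb1) * lam * S * P := kb.trans (by gcongr)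
    have h1 : Psi G Ha Hb a b x t ≤ P + 2 * normA * (ωa R * Ha t) + 2 * normB * (ωb R * Hb t) := by
      have h2 := mul_le_mul_of_nonneg_right la hAt
      have h3 := mul_le_mul_of_nonneg_right lb hBt
      simp only [Psi, hP, PsiMinus]
      linarith
    calc Psi G Ha Hb a b x t ≤ P + 2 * normA * (ωa R * Ha t) + 2 * normB * (ωb R * Hb t) := h1
      _ ≤ S * P + 2 * normA * ((1 + wa1) * lam * S * P) + 2 * normB * ((1 + wb1) * lam * S * P) := by
        have : P ≤ S * P := by nlinarith
        gcongr
      _ = _ := by ring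

end MultiPhase

/-! ### Mollification as averaging over a probability measure. -/

namespace MultiPhase

variable {n : ℕ}

/-- Mollification by the normalized bump function `b`. -/
noncomputable def moll {F : Type*} [NormedAddCommGroup F] [NormedSpace ℝ F]
    (b : ContDiffBump (0 : EuclideanSpace ℝ (Fin n))) (w : EuclideanSpace ℝ (Fin n) → F) :
    EuclideanSpace ℝ (Fin n) → F :=
  convolution (b.normed volume) w (ContinuousLinearMap.lsmul ℝ ℝ) volume

/-- The probability measure whose density is the normalized bump function `b`. -/
noncomputable def mollMeasure (b : ContDiffBump (0 : EuclideanSpace ℝ (Fin n))) :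
    Measure (EuclideanSpace ℝ (Fin n)) :=
  volume.withDensity fun y => ENNReal.ofReal (b.normed volume y)

instance (b : ContDiffBump (0 : EuclideanSpace ℝ (Fin n))) :
    IsProbabilityMeasure (mollMeasure b) := by
  refine ⟨?_⟩
  rw [mollMeasure, withDensity_apply _ MeasurableSet.univ, Measure.restrict_univ,
    ← ofReal_integral_eq_lintegral_ofReal b.integrable_normed
      (Eventually.of_forall b.nonneg_normed), b.integral_normed, ENNReal.ofReal_one]

lemma mollMeasure_absolutelyContinuous (b : ContDiffBump (0 : EuclideanSpace ℝ (Fin n))) :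
    mollMeasure b ≪ volume := withDensity_absolutelyContinuous _ _

lemma mollMeasure_compl_ball (b : ContDiffBump (0 : EuclideanSpace ℝ (Fin n))) :
    mollMeasure b (Metric.ball 0 b.rOut)ᶜ = 0 := by
  rw [mollMeasure, withDensity_apply _ Metric.isOpen_ball.measurableSet.compl]
  refine (setLIntegral_congr_fun Metric.isOpen_ball.measurableSet.compl fun y hy => ?_).trans
    lintegral_zero
  have : y ∉ Function.support (b.normed volume) := by rwa [b.support_normed_eq]
  simp [Function.notMem_support.1 this]

section

variable {F : Type*} [NormedAddCommGroup F] [NormedSpace ℝ F]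

/-- Seen as an average of translates against a probability measure, a mollification is open to
Jensen's inequality and to Tonelli's theorem. -/
lemma moll_eq (b : ContDiffBump (0 : EuclideanSpace ℝ (Fin n)))
    (w : EuclideanSpace ℝ (Fin n) → F) (x : EuclideanSpace ℝ (Fin n)) :
    moll b w x = ∫ y, w (x - y) ∂(mollMeasure b) := by
  rw [mollMeasure, integral_withDensity_eq_integral_toReal_smul (by
    exact (b.continuous_normed.measurable).ennreal_ofReal)
    (Eventually.of_forall fun _ => ENNReal.ofReal_lt_top)]
  simp only [moll, convolution, ContinuousLinearMap.lsmul_apply]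
  congr 1
  funext y
  rw [ENNReal.toReal_ofReal (b.nonneg_normed y)]

/-- **Jensen's inequality** for growth functions. -/
lemma IsGrowth.ofReal_norm_integral_le {q : ℕ} {φ : ℝ → ℝ} (h : IsGrowth q φ) {α : Type*}
    [MeasurableSpace α] (ν : Measure α) [IsProbabilityMeasure ν] (f : α → F) :
    ENNReal.ofReal (φ ‖∫ y, f y ∂ν‖) ≤ ∫⁻ y, ENNReal.ofReal (φ ‖f y‖) ∂ν := by
  -- No integrability is assumed: if `f` is not integrable its integral is `0` by convention and `φ
  -- 0 = 0`; if `φ ‖f‖` is not integrable the right-hand side is infinite.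
  by_cases hf : Integrable f ν
  swap
  · simp [integral_undef hf, h.zero]
  by_cases hφ : Integrable (fun y => φ ‖f y‖) ν
  · rw [← ofReal_integral_eq_lintegral_ofReal hφ
      (Eventually.of_forall fun y => h.nonneg (norm_nonneg _))]
    refine ENNReal.ofReal_le_ofReal ((h.le_of_le (norm_nonneg _)
      (norm_integral_le_integral_norm f)).trans ?_)
    exact h.convex.map_integral_le (f := fun y => ‖f y‖) h.cont isClosed_Ici
      (Eventually.of_forall fun y => mem_Ici.2 (norm_nonneg _)) hf.norm hφ
  · have hm : AEStronglyMeasurable (fun y => φ ‖f y‖) ν := by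
      have := h.contDiff_abs.continuous.comp_aestronglyMeasurable hf.1.norm
      simpa only [abs_norm] using this
    have : ∫⁻ y, ENNReal.ofReal (φ ‖f y‖) ∂ν = ∞ := by
      by_contra hne
      refine hφ ⟨hm, ?_⟩
      rw [hasFiniteIntegral_iff_ofReal (Eventually.of_forall fun y => h.nonneg (norm_nonneg _))]
      exact lt_top_iff_ne_top.2 hne
    rw [this]; exact le_top

lemma IsGrowth.ofReal_norm_moll_le {q : ℕ} {φ : ℝ → ℝ} (h : IsGrowth q φ)
    (b : ContDiffBump (0 : EuclideanSpace ℝ (Fin n))) (w : EuclideanSpace ℝ (Fin n) → F)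
    (x : EuclideanSpace ℝ (Fin n)) :
    ENNReal.ofReal (φ ‖moll b w x‖) ≤ ∫⁻ y, ENNReal.ofReal (φ ‖w (x - y)‖) ∂(mollMeasure b) := by
  rw [moll_eq]; exact h.ofReal_norm_integral_le _ _

lemma enorm_moll_le (b : ContDiffBump (0 : EuclideanSpace ℝ (Fin n)))
    (w : EuclideanSpace ℝ (Fin n) → F) (x : EuclideanSpace ℝ (Fin n)) :
    ‖moll b w x‖ₑ ≤ ∫⁻ y, ‖w (x - y)‖ₑ ∂(mollMeasure b) := by
  rw [moll_eq]; exact enorm_integral_le_lintegral_enorm _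

end

/-- Tonelli's theorem for the mollification of a nonnegative function. -/
lemma lintegral_lintegral_mollMeasure (b : ContDiffBump (0 : EuclideanSpace ℝ (Fin n)))
    {g : EuclideanSpace ℝ (Fin n) → ℝ≥0∞} (hg : AEMeasurable g) {S : Set (EuclideanSpace ℝ (Fin n))}
    (hS : MeasurableSet S) :
    ∫⁻ x in S, ∫⁻ y, g (x - y) ∂(mollMeasure b) =
      ∫⁻ y, (∫⁻ x in (fun x => x + y) ⁻¹' S, g x) ∂(mollMeasure b) := by
  have e1 : ∀ x, ∫⁻ y, g (x - y) ∂(mollMeasure b) = ∫⁻ y, hg.mk g (x - y) ∂(mollMeasure b) := by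
    intro x
    refine lintegral_congr_ae ((mollMeasure_absolutelyContinuous b).ae_le ?_)
    exact (quasiMeasurePreserving_sub_left volume x).ae hg.ae_eq_mk
  have e2 : ∀ T : Set (EuclideanSpace ℝ (Fin n)), ∫⁻ x in T, g x = ∫⁻ x in T, hg.mk g x :=
    fun T => lintegral_congr_ae (ae_restrict_of_ae hg.ae_eq_mk)
  simp_rw [e1, e2]
  rw [lintegral_lintegral_swap]
  · refine lintegral_congr fun y => ?_
    have hm : MeasurableSet ((fun x => x + y) ⁻¹' S) := measurable_add_const y hS
    rw [← lintegral_indicator hS, ← lintegral_indicator hm,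
      ← lintegral_add_right_eq_self (S.indicator fun x => hg.mk g (x - y)) y]
    refine lintegral_congr fun x => ?_
    simp only [indicator, mem_preimage, add_sub_cancel_right]
    rfl
  · refine Measurable.aemeasurable ?_
    exact hg.measurable_mk.comp (measurable_fst.sub measurable_snd)

lemma lintegral_mollMeasure_le (b : ContDiffBump (0 : EuclideanSpace ℝ (Fin n)))
    {g : EuclideanSpace ℝ (Fin n) → ℝ≥0∞} (hg : AEMeasurable g) :
    ∫⁻ x, ∫⁻ y, g (x - y) ∂(mollMeasure b) = ∫⁻ x, g x := by
  have := lintegral_lintegral_mollMeasure b hg MeasurableSet.univ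
  simpa using this

/-- Absolute continuity of the integral, uniform over all mollifiers: the mollified integral over
`S` averages integrals of `g` over translates of `S`, all of the same measure. -/
lemma setLIntegral_mollMeasure_lt {g : EuclideanSpace ℝ (Fin n) → ℝ≥0∞} (hg : AEMeasurable g)
    (hfin : ∫⁻ x, g x ≠ ∞) {ε : ℝ≥0∞} (hε : ε ≠ 0) : ∃ δ > 0,
    ∀ (b : ContDiffBump (0 : EuclideanSpace ℝ (Fin n))) (S : Set (EuclideanSpace ℝ (Fin n))),
      MeasurableSet S → volume S < δ → ∫⁻ x in S, ∫⁻ y, g (x - y) ∂(mollMeasure b) ≤ ε := by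
  obtain ⟨δ, hδ, h⟩ := exists_pos_setLIntegral_lt_of_measure_lt hfin hε
  refine ⟨δ, hδ, fun b S hS hSδ => ?_⟩
  rw [lintegral_lintegral_mollMeasure b hg hS]
  calc _ ≤ ∫⁻ _, ε ∂(mollMeasure b) := by
        refine lintegral_mono fun y => (h _ ?_).le
        rwa [measure_preimage_add_right]
    _ = ε := by simp

/-- A sequence of bump functions shrinking to the origin. -/
noncomputable def bumpSeq (j : ℕ) : ContDiffBump (0 : EuclideanSpace ℝ (Fin n)) where
  rIn := 1 / (2 * (j + 1))
  rOut := 1 / (j + 1)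
  rIn_pos := by positivity
  rIn_lt_rOut := by
    apply one_div_lt_one_div_of_lt <;> linarith [(Nat.cast_nonneg j : (0 : ℝ) ≤ j)]

lemma bumpSeq_rOut_tendsto :
    Tendsto (fun j => (bumpSeq j : ContDiffBump (0 : EuclideanSpace ℝ (Fin n))).rOut) atTop (𝓝 0) :=
  tendsto_one_div_add_atTop_nhds_zero_nat

/-- A bounded ratio of outer to inner radius is what both the almost everywhere convergence and the
uniform bound on the mollifier's density require. -/
lemma bumpSeq_rOut_le (j : ℕ) :
    (bumpSeq j : ContDiffBump (0 : EuclideanSpace ℝ (Fin n))).rOut ≤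
      2 * (bumpSeq j : ContDiffBump (0 : EuclideanSpace ℝ (Fin n))).rIn := by
  have : (0 : ℝ) < j + 1 := by positivity
  simp only [bumpSeq]
  apply le_of_eq
  field_simp

section

variable {F : Type*} [NormedAddCommGroup F] [NormedSpace ℝ F]
  {w : EuclideanSpace ℝ (Fin n) → F}

lemma moll_tendsto_ae [CompleteSpace F] (hw : LocallyIntegrable w) :
    ∀ᵐ x, Tendsto (fun j => moll (bumpSeq j) w x) atTop (𝓝 (w x)) :=
  ContDiffBump.ae_convolution_tendsto_right_of_locallyIntegrable bumpSeq_rOut_tendsto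
    (Eventually.of_forall fun j => bumpSeq_rOut_le j) hw

lemma contDiff_moll (b : ContDiffBump (0 : EuclideanSpace ℝ (Fin n))) (hw : LocallyIntegrable w) :
    ContDiff ℝ ((⊤ : ℕ∞) : WithTop ℕ∞) (moll b w) :=
  b.hasCompactSupport_normed.contDiff_convolution_left _ b.contDiff_normed hw

lemma hasCompactSupport_moll (b : ContDiffBump (0 : EuclideanSpace ℝ (Fin n)))
    (hw : HasCompactSupport w) : HasCompactSupport (moll b w) :=
  HasCompactSupport.convolution _ b.hasCompactSupport_normed hw

lemma moll_eq_zero (b : ContDiffBump (0 : EuclideanSpace ℝ (Fin n)))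
    {x : EuclideanSpace ℝ (Fin n)} (h : ∀ y ∈ Metric.ball x b.rOut, w y = 0) : moll b w x = 0 := by
  simp only [moll, convolution, ContinuousLinearMap.lsmul_apply]
  refine integral_eq_zero_of_ae (Eventually.of_forall fun y => ?_)
  by_cases hy : y ∈ Metric.ball 0 b.rOut
  · have := h (x - y) (by simpa [Metric.mem_ball, dist_eq_norm] using hy)
    simp [this]
  · have : y ∉ Function.support (b.normed volume) := by rwa [b.support_normed_eq]
    simp [Function.notMem_support.1 this]

/-- Mollifications converge in `L¹` on sets of finite measure. -/
lemma moll_tendsto_lintegral [CompleteSpace F] (hw : Integrable w) {S : Set (EuclideanSpace ℝ (Fin n))}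
    (hS : MeasurableSet S) (hSf : volume S ≠ ∞) :
    Tendsto (fun j => ∫⁻ x in S, ‖moll (bumpSeq j) w x - w x‖ₑ) atTop (𝓝 0) := by
  have : IsFiniteMeasure (volume.restrict S) := ⟨by simpa using hSf.lt_top⟩
  have hcont : ∀ j, Continuous (moll (bumpSeq j) w) := fun j =>
    (contDiff_moll (bumpSeq j) hw.locallyIntegrable).continuous
  -- Vitali's theorem: almost everywhere convergence on a set of finite measure, together with the
  -- uniform integrability from `setLIntegral_mollMeasure_lt`.
  have h := tendsto_Lp_finite_of_tendsto_ae (μ := volume.restrict S) (p := 1) le_rfl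
    ENNReal.one_ne_top (f := fun j => moll (bumpSeq j) w) (g := w)
    (fun j => (hcont j).aestronglyMeasurable) (memLp_one_iff_integrable.2 hw.integrableOn) ?_
    (ae_restrict_of_ae (moll_tendsto_ae hw.locallyIntegrable))
  · simpa [eLpNorm_one_eq_lintegral_enorm] using h
  · intro ε hε
    obtain ⟨δ, hδ, h⟩ := setLIntegral_mollMeasure_lt hw.1.enorm hw.2.ne
      (ε := ENNReal.ofReal ε) (by simpa using hε)
    obtain ⟨δ', hδ', hδδ⟩ : ∃ δ' : ℝ, 0 < δ' ∧ ENNReal.ofReal δ' < δ := by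
      obtain ⟨d, hd0, hd⟩ := ENNReal.lt_iff_exists_nnreal_btwn.1 hδ
      exact ⟨d, by exact_mod_cast hd0, by rwa [ENNReal.ofReal_coe_nnreal]⟩
    refine ⟨δ', hδ', fun j T hT hTδ => ?_⟩
    rw [eLpNorm_one_eq_lintegral_enorm]
    simp_rw [enorm_indicator_eq_indicator_enorm]
    rw [lintegral_indicator hT, Measure.restrict_restrict hT]
    rw [Measure.restrict_apply hT] at hTδ
    exact (lintegral_mono fun x => enorm_moll_le _ w x).trans
      (h _ _ (hT.inter hS) (hTδ.trans_lt hδδ))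

end

/-- The derivative of the mollification is the mollification of the weak gradient. -/
lemma fderiv_moll {w : EuclideanSpace ℝ (Fin n) → ℝ}
    {g : EuclideanSpace ℝ (Fin n) → EuclideanSpace ℝ (Fin n)} (h : HasWeakGradient univ w g)
    (b : ContDiffBump (0 : EuclideanSpace ℝ (Fin n))) (x e : EuclideanSpace ℝ (Fin n)) :
    fderiv ℝ (moll b w) x e = inner ℝ (moll b g x) e := by
  have hw : LocallyIntegrable w := locallyIntegrableOn_univ.1 h.locInt
  have hg : LocallyIntegrable g := locallyIntegrableOn_univ.1 h.locInt_grad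
  have hc1 : ContDiff ℝ 1 (b.normed volume) := b.contDiff_normed
  have h1 := (b.hasCompactSupport_normed (μ := volume)).hasFDerivAt_convolution_left
    (ContinuousLinearMap.lsmul ℝ ℝ) hc1 hw x
  have h1' := h1.fderiv
  have hex : ConvolutionExistsAt (fderiv ℝ (b.normed volume)) w x
      (ContinuousLinearMap.precompL (EuclideanSpace ℝ (Fin n)) (ContinuousLinearMap.lsmul ℝ ℝ))
      volume :=
    (b.hasCompactSupport_normed.fderiv ℝ).convolutionExists_left _
      (hc1.continuous_fderiv one_ne_zero) hw x
  have hexg : ConvolutionExistsAt (b.normed volume) g x (ContinuousLinearMap.lsmul ℝ ℝ) volume :=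
    b.hasCompactSupport_normed.convolutionExists_left _ b.continuous_normed hg x
  rw [moll, h1', convolution, ContinuousLinearMap.integral_apply hex e, moll, convolution,
    real_inner_comm, ← integral_inner hexg]
  simp only [ContinuousLinearMap.precompL_apply, ContinuousLinearMap.lsmul_apply, smul_eq_mul]
  -- The weak gradient is tested with the reflected, translated mollifier; the sign from the
  -- reflection cancels the sign of integration by parts.
  set ψ : EuclideanSpace ℝ (Fin n) → ℝ := fun y => b.normed volume (x - y) with hψ
  have hψd : ∀ y, HasFDerivAt ψ (-(fderiv ℝ (b.normed volume) (x - y))) y := by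
    intro y
    have h2 := (hc1.differentiable one_ne_zero (x - y)).hasFDerivAt
    have h3 := h2.comp y ((hasFDerivAt_id y).const_sub x)
    rwa [ContinuousLinearMap.comp_neg, ContinuousLinearMap.comp_id] at h3
  have hψc : HasCompactSupport ψ :=
    (b.hasCompactSupport_normed (μ := volume)).comp_homeomorph (Homeomorph.subLeft x)
  have hint := h.integral_eq ψ (b.contDiff_normed.comp (contDiff_const.sub contDiff_id)) hψc
    (subset_univ _) e
  simp only [Measure.restrict_univ] at hint
  have e1 := integral_sub_left_eq_self (fun y => w y * fderiv ℝ ψ y e) volume x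
  have e2 := integral_sub_left_eq_self (fun y => ψ y * inner ℝ (g y) e) volume x
  rw [← e1, ← e2] at hint
  have e3 : ∀ y, w (x - y) * fderiv ℝ ψ (x - y) e =
      -(fderiv ℝ (b.normed volume) y e * w (x - y)) := by
    intro y
    rw [(hψd _).fderiv, sub_sub_cancel, neg_apply]
    ring
  simp only [e3] at hint
  rw [integral_neg, neg_inj] at hint
  simp only [hψ, sub_sub_cancel] at hint
  rw [hint]
  congr 1
  funext y
  rw [inner_smul_right, real_inner_comm]

end MultiPhase

/-! ### Calculus of weak gradients. -/

namespace MultiPhase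

variable {n : ℕ}

lemma exists_smooth_cutoff {K Ω : Set (EuclideanSpace ℝ (Fin n))} (hK : IsCompact K)
    (hΩ : IsOpen Ω) (hKΩ : K ⊆ Ω) : ∃ ζ : EuclideanSpace ℝ (Fin n) → ℝ,
      ContDiff ℝ ((⊤ : ℕ∞) : WithTop ℕ∞) ζ ∧ HasCompactSupport ζ ∧ tsupport ζ ⊆ Ω ∧
      ∀ᶠ x in 𝓝ˢ K, ζ x = 1 := by
  obtain ⟨L, hL, hKL, hLΩ⟩ := exists_compact_between hK hΩ hKΩ
  obtain ⟨f, hf1, hf0, -⟩ := exists_contMDiffMap_one_nhds_of_subset_interior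
    (n := ⊤) (modelWithCornersSelf ℝ (EuclideanSpace ℝ (Fin n))) hK.isClosed hKL
  have hsub : tsupport f ⊆ L := closure_minimal (fun x hx => by
    by_contra hxL; exact hx (hf0 x hxL)) hL.isClosed
  exact ⟨f, f.contMDiff.contDiff, hL.of_isClosed_subset (isClosed_tsupport _) hsub,
    hsub.trans hLΩ, hf1⟩

lemma integrable_smul_of_locallyIntegrableOn {F : Type*} [NormedAddCommGroup F] [NormedSpace ℝ F]
    {Ω : Set (EuclideanSpace ℝ (Fin n))} {u : EuclideanSpace ℝ (Fin n) → F}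
    (hu : LocallyIntegrableOn u Ω) {ψ : EuclideanSpace ℝ (Fin n) → ℝ} (hψ : Continuous ψ)
    (hc : HasCompactSupport ψ) (hs : tsupport ψ ⊆ Ω) : Integrable (fun x => ψ x • u x) := by
  have h1 : IntegrableOn u (tsupport ψ) := hu.integrableOn_compact_subset hs hc
  have h2 : IntegrableOn (fun x => ψ x • u x) (tsupport ψ) :=
    h1.continuousOn_smul hψ.continuousOn hc
  refine (integrableOn_iff_integrable_of_support_subset ?_).1 h2
  intro x hx
  by_contra hx'
  exact hx (by simp [image_eq_zero_of_notMem_tsupport hx'])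

lemma integrable_mul_of_locallyIntegrableOn {Ω : Set (EuclideanSpace ℝ (Fin n))}
    {u : EuclideanSpace ℝ (Fin n) → ℝ}
    (hu : LocallyIntegrableOn u Ω) {ψ : EuclideanSpace ℝ (Fin n) → ℝ} (hψ : Continuous ψ)
    (hc : HasCompactSupport ψ) (hs : tsupport ψ ⊆ Ω) : Integrable (fun x => ψ x * u x) := by
  simpa using integrable_smul_of_locallyIntegrableOn hu hψ hc hs

lemma integrable_mul_inner_of_locallyIntegrableOn {Ω : Set (EuclideanSpace ℝ (Fin n))}
    {g : EuclideanSpace ℝ (Fin n) → EuclideanSpace ℝ (Fin n)}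
    (hu : LocallyIntegrableOn g Ω) {ψ : EuclideanSpace ℝ (Fin n) → ℝ} (hψ : Continuous ψ)
    (hc : HasCompactSupport ψ) (hs : tsupport ψ ⊆ Ω) (e : EuclideanSpace ℝ (Fin n)) :
    Integrable (fun x => ψ x * inner ℝ (g x) e) := by
  have := (integrable_smul_of_locallyIntegrableOn hu hψ hc hs).inner_const (𝕜 := ℝ) e
  simpa [inner_smul_left] using this

lemma setIntegral_mul_eq {Ω : Set (EuclideanSpace ℝ (Fin n))}
    {ψ f : EuclideanSpace ℝ (Fin n) → ℝ} (hs : tsupport ψ ⊆ Ω) :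
    ∫ x in Ω, ψ x * f x = ∫ x, ψ x * f x := by
  refine setIntegral_eq_integral_of_forall_compl_eq_zero fun x hx => ?_
  rw [image_eq_zero_of_notMem_tsupport (fun h => hx (hs h)), zero_mul]

section Smooth

variable {φ : EuclideanSpace ℝ (Fin n) → ℝ}

lemma continuous_fderiv_apply_of_smooth (hφ : ContDiff ℝ ((⊤ : ℕ∞) : WithTop ℕ∞) φ)
    (e : EuclideanSpace ℝ (Fin n)) : Continuous (fun x => fderiv ℝ φ x e) :=
  (hφ.continuous_fderiv (by simp)).clm_apply continuous_const

lemma hasCompactSupport_fderiv_apply (hc : HasCompactSupport φ) (e : EuclideanSpace ℝ (Fin n)) :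
    HasCompactSupport (fun x => fderiv ℝ φ x e) := hc.fderiv_apply (𝕜 := ℝ) e

lemma tsupport_fderiv_apply_subset' (e : EuclideanSpace ℝ (Fin n)) :
    tsupport (fun x => fderiv ℝ φ x e) ⊆ tsupport φ := tsupport_fderiv_apply_subset ℝ e

lemma continuous_gradient_of_smooth (hφ : ContDiff ℝ ((⊤ : ℕ∞) : WithTop ℕ∞) φ) :
    Continuous (gradient φ) :=
  (InnerProductSpace.toDual ℝ (EuclideanSpace ℝ (Fin n))).symm.continuous.comp
    (hφ.continuous_fderiv (by simp))

lemma inner_gradient' (x e : EuclideanSpace ℝ (Fin n)) :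
    inner ℝ (gradient φ x) e = fderiv ℝ φ x e := by
  rw [gradient, InnerProductSpace.toDual_symm_apply]

end Smooth

namespace HasWeakGradient

variable {Ω : Set (EuclideanSpace ℝ (Fin n))} {u : EuclideanSpace ℝ (Fin n) → ℝ}
  {Du : EuclideanSpace ℝ (Fin n) → EuclideanSpace ℝ (Fin n)}

/-- The test function vanishes off `Ω`, so the identity can be read on the whole space, where
integrals may be added and compared regardless of the domain. -/
lemma integral_eq_univ (h : HasWeakGradient Ω u Du) {φ : EuclideanSpace ℝ (Fin n) → ℝ}
    (hφ : ContDiff ℝ ((⊤ : ℕ∞) : WithTop ℕ∞) φ) (hc : HasCompactSupport φ) (hs : tsupport φ ⊆ Ω)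
    (e : EuclideanSpace ℝ (Fin n)) :
    ∫ x, fderiv ℝ φ x e * u x = - ∫ x, φ x * inner ℝ (Du x) e := by
  rw [← setIntegral_mul_eq hs, ← h.integral_eq φ hφ hc hs e,
    ← setIntegral_mul_eq ((tsupport_fderiv_apply_subset' e).trans hs)]
  simp_rw [mul_comm]

lemma of_univ (h1 : LocallyIntegrableOn u Ω) (h2 : LocallyIntegrableOn Du Ω)
    (h : ∀ φ : EuclideanSpace ℝ (Fin n) → ℝ, ContDiff ℝ ((⊤ : ℕ∞) : WithTop ℕ∞) φ →
      HasCompactSupport φ → tsupport φ ⊆ Ω → ∀ e : EuclideanSpace ℝ (Fin n),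
      ∫ x, fderiv ℝ φ x e * u x = - ∫ x, φ x * inner ℝ (Du x) e) : HasWeakGradient Ω u Du := by
  refine ⟨h1, h2, fun φ hφ hc hs e => ?_⟩
  rw [setIntegral_mul_eq hs, ← h φ hφ hc hs e,
    ← setIntegral_mul_eq ((tsupport_fderiv_apply_subset' e).trans hs)]
  simp_rw [mul_comm]

lemma mono (h : HasWeakGradient Ω u Du) {Ω' : Set (EuclideanSpace ℝ (Fin n))} (hs : Ω' ⊆ Ω) :
    HasWeakGradient Ω' u Du :=
  of_univ (h.locInt.mono_set hs) (h.locInt_grad.mono_set hs) fun _ hφ hc hs' e =>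
    h.integral_eq_univ hφ hc (hs'.trans hs) e

lemma sub (h : HasWeakGradient Ω u Du) {v : EuclideanSpace ℝ (Fin n) → ℝ}
    {Dv : EuclideanSpace ℝ (Fin n) → EuclideanSpace ℝ (Fin n)} (h' : HasWeakGradient Ω v Dv) :
    HasWeakGradient Ω (fun x => u x - v x) (fun x => Du x - Dv x) := by
  refine of_univ (h.locInt.sub h'.locInt) (h.locInt_grad.sub h'.locInt_grad)
    fun φ hφ hc hs e => ?_
  simp_rw [inner_sub_left, mul_sub]
  rw [integral_sub, integral_sub, h.integral_eq_univ hφ hc hs e, h'.integral_eq_univ hφ hc hs e]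
  · ring
  · exact integrable_mul_inner_of_locallyIntegrableOn h.locInt_grad hφ.continuous hc hs e
  · exact integrable_mul_inner_of_locallyIntegrableOn h'.locInt_grad hφ.continuous hc hs e
  · exact integrable_mul_of_locallyIntegrableOn h.locInt (continuous_fderiv_apply_of_smooth hφ e)
      (hasCompactSupport_fderiv_apply hc e) ((tsupport_fderiv_apply_subset' e).trans hs)
  · exact integrable_mul_of_locallyIntegrableOn h'.locInt (continuous_fderiv_apply_of_smooth hφ e)
      (hasCompactSupport_fderiv_apply hc e) ((tsupport_fderiv_apply_subset' e).trans hs)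

lemma const_mul (h : HasWeakGradient Ω u Du) (c : ℝ) :
    HasWeakGradient Ω (fun x => c * u x) (fun x => c • Du x) := by
  refine of_univ (h.locInt.smul c) (h.locInt_grad.smul c) fun φ hφ hc hs e => ?_
  have e1 : ∀ x, fderiv ℝ φ x e * (c * u x) = c * (fderiv ℝ φ x e * u x) := fun x => by ring
  have e2 : ∀ x, φ x * inner ℝ (c • Du x) e = c * (φ x * inner ℝ (Du x) e) := fun x => by
    rw [inner_smul_left]; simp; ring
  simp_rw [e1, e2]
  rw [integral_const_mul, integral_const_mul, h.integral_eq_univ hφ hc hs e]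
  ring

lemma const (Ω : Set (EuclideanSpace ℝ (Fin n))) (k : ℝ) : HasWeakGradient Ω (fun _ => k) 0 := by
  refine of_univ ((locallyIntegrable_const k).locallyIntegrableOn _)
    ((locallyIntegrable_const (0 : EuclideanSpace ℝ (Fin n))).locallyIntegrableOn _) fun φ hφ hc hs e => ?_
  have h1 := integral_mul_fderiv_eq_neg_fderiv_mul_of_integrable (μ := volume) (f := fun _ => k)
    (g := φ) (v := e) (by simp)
    ((continuous_const.mul (continuous_fderiv_apply_of_smooth hφ e)).integrable_of_hasCompactSupport
      (hasCompactSupport_fderiv_apply hc e).mul_left)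
    ((continuous_const.mul hφ.continuous).integrable_of_hasCompactSupport hc.mul_left)
    (fun x _ => differentiableAt_const k)
    (fun x _ => (hφ.differentiable (by simp)) x)
  simp_rw [mul_comm _ k]
  simpa using h1

lemma sub_const (h : HasWeakGradient Ω u Du) (k : ℝ) :
    HasWeakGradient Ω (fun x => u x - k) Du := by
  simpa using h.sub (const Ω k)

lemma neg (h : HasWeakGradient Ω u Du) : HasWeakGradient Ω (fun x => - u x) (fun x => - Du x) := by
  simpa using h.const_mul (-1)

lemma of_smooth {f : EuclideanSpace ℝ (Fin n) → ℝ} (hf : ContDiff ℝ ((⊤ : ℕ∞) : WithTop ℕ∞) f) :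
    HasWeakGradient univ f (gradient f) := by
  have hcg := continuous_gradient_of_smooth hf
  refine of_univ (hf.continuous.locallyIntegrable.locallyIntegrableOn _)
    (hcg.locallyIntegrable.locallyIntegrableOn _) fun φ hφ hc _ e => ?_
  have h1 := integral_mul_fderiv_eq_neg_fderiv_mul_of_integrable (μ := volume) (f := f)
    (g := φ) (v := e)
    (((continuous_fderiv_apply_of_smooth hf e).mul hφ.continuous).integrable_of_hasCompactSupport
      hc.mul_left)
    ((hf.continuous.mul (continuous_fderiv_apply_of_smooth hφ e)).integrable_of_hasCompactSupport
      (hasCompactSupport_fderiv_apply hc e).mul_left)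
    ((hf.continuous.mul hφ.continuous).integrable_of_hasCompactSupport hc.mul_left)
    (fun x _ => (hf.differentiable (by simp)) x)
    (fun x _ => (hφ.differentiable (by simp)) x)
  simp_rw [inner_gradient', mul_comm (φ _), mul_comm _ (f _)]
  exact h1

/-- The product rule for multiplication by a smooth cutoff function. -/
lemma cutoff_mul (h : HasWeakGradient Ω u Du) {ζ : EuclideanSpace ℝ (Fin n) → ℝ}
    (hζ : ContDiff ℝ ((⊤ : ℕ∞) : WithTop ℕ∞) ζ) (hζc : HasCompactSupport ζ)
    (hζs : tsupport ζ ⊆ Ω) :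
    HasWeakGradient univ (fun x => ζ x * u x) (fun x => ζ x • Du x + u x • gradient ζ x) ∧
    Integrable (fun x => ζ x * u x) ∧ Integrable (fun x => ζ x • Du x + u x • gradient ζ x) := by
  have i1 := integrable_mul_of_locallyIntegrableOn h.locInt hζ.continuous hζc hζs
  have i2 := integrable_smul_of_locallyIntegrableOn h.locInt_grad hζ.continuous hζc hζs
  have i3 : Integrable (fun x => u x • gradient ζ x) := by
    have h1 : IntegrableOn u (tsupport ζ) := h.locInt.integrableOn_compact_subset hζs hζc
    have h2 : IntegrableOn (fun x => u x • gradient ζ x) (tsupport ζ) :=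
      h1.smul_continuousOn (continuous_gradient_of_smooth hζ).continuousOn hζc
    refine (integrableOn_iff_integrable_of_support_subset ?_).1 h2
    intro x hx
    by_contra hx'
    refine hx ?_
    have h0 : fderiv ℝ ζ x = 0 := image_eq_zero_of_notMem_tsupport
      (fun hh => hx' (tsupport_fderiv_subset ℝ hh))
    simp [gradient, h0]
  refine ⟨?_, i1, i2.add i3⟩
  refine of_univ (i1.locallyIntegrable.locallyIntegrableOn _)
    ((i2.add i3).locallyIntegrable.locallyIntegrableOn _) fun φ hφ hc _ e => ?_
  -- The equation for `u` is tested with `ζ φ`, which is admissible because its support stays in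
  -- that of `ζ`, hence in `Ω`.
  have hprod : ContDiff ℝ ((⊤ : ℕ∞) : WithTop ℕ∞) (fun x => ζ x * φ x) := hζ.mul hφ
  have hpc : HasCompactSupport (fun x => ζ x * φ x) := hζc.mul_right
  have hps : tsupport (fun x => ζ x * φ x) ⊆ Ω := (tsupport_mul_subset_left).trans hζs
  have h1 := h.integral_eq_univ hprod hpc hps e
  have hd : ∀ x, fderiv ℝ (fun x => ζ x * φ x) x e =
      ζ x * fderiv ℝ φ x e + φ x * fderiv ℝ ζ x e := by
    intro x
    rw [fderiv_fun_mul (hζ.differentiable (by simp) x) (hφ.differentiable (by simp) x)]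
    simp
  have j1 : Integrable (fun x => fderiv ℝ φ x e * ζ x * u x) := by
    refine integrable_mul_of_locallyIntegrableOn h.locInt
      ((continuous_fderiv_apply_of_smooth hφ e).mul hζ.continuous) hζc.mul_left ?_
    exact (tsupport_mul_subset_right).trans hζs
  have j2 : Integrable (fun x => φ x * fderiv ℝ ζ x e * u x) := by
    refine integrable_mul_of_locallyIntegrableOn h.locInt
      (hφ.continuous.mul (continuous_fderiv_apply_of_smooth hζ e)) hc.mul_right ?_
    exact (tsupport_mul_subset_right).trans ((tsupport_fderiv_apply_subset' e).trans hζs)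
  have j3 : Integrable (fun x => ζ x * φ x * inner ℝ (Du x) e) :=
    integrable_mul_inner_of_locallyIntegrableOn h.locInt_grad (hζ.continuous.mul hφ.continuous)
      hpc hps e
  have e1 : ∀ x, fderiv ℝ (fun x => ζ x * φ x) x e * u x =
      fderiv ℝ φ x e * ζ x * u x + φ x * fderiv ℝ ζ x e * u x := fun x => by
    rw [hd]; ring
  simp_rw [e1] at h1
  rw [integral_add j1 j2] at h1
  have e2 : ∀ x, φ x * inner ℝ (ζ x • Du x + u x • gradient ζ x) e =
      ζ x * φ x * inner ℝ (Du x) e + φ x * fderiv ℝ ζ x e * u x := fun x => by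
    rw [inner_add_left, inner_smul_left, inner_smul_left, inner_gradient']; simp; ring
  simp_rw [e2, ← mul_assoc]
  rw [integral_add j3 j2]
  linarith

end HasWeakGradient

end MultiPhase

/-! ### The weak gradient of the positive part. -/

namespace MultiPhase

variable {n : ℕ}

/-- A `C¹` approximation of the positive part. -/
noncomputable def posApprox (ε t : ℝ) : ℝ := max t 0 ^ 2 / (max t 0 + ε)

/-- The derivative of `posApprox ε`. -/
noncomputable def posApproxDeriv (ε t : ℝ) : ℝ :=
  (max t 0 ^ 2 + 2 * max t 0 * ε) / (max t 0 + ε) ^ 2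

section PosApprox

variable {ε : ℝ}

lemma hasDerivAt_posApprox (hε : 0 < ε) (t : ℝ) :
    HasDerivAt (posApprox ε) (posApproxDeriv ε t) t := by
  rcases lt_trichotomy t 0 with ht | rfl | ht
  · have e : posApproxDeriv ε t = 0 := by simp [posApproxDeriv, max_eq_right ht.le]
    rw [e]
    refine (hasDerivAt_const t (0 : ℝ)).congr_of_eventuallyEq ?_
    filter_upwards [Iio_mem_nhds ht] with x hx
    simp [posApprox, max_eq_right (mem_Iio.1 hx).le]
  · have e : posApproxDeriv ε 0 = 0 := by simp [posApproxDeriv]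
    rw [e, hasDerivAt_iff_isLittleO]
    have e0 : posApprox ε 0 = 0 := by simp [posApprox]
    simp only [e0, sub_zero, smul_zero]
    have h2 : (fun x : ℝ => x ^ 2) =o[𝓝 0] fun x => x := by
      simpa using (Asymptotics.isLittleO_pow_pow (𝕜 := ℝ) (m := 1) (n := 2) one_lt_two)
    refine Asymptotics.IsBigO.trans_isLittleO ?_ h2
    refine Asymptotics.IsBigO.of_bound (1 / ε) (Eventually.of_forall fun x => ?_)
    have hm : 0 ≤ max x 0 := le_max_right _ _
    have h3 : max x 0 ^ 2 ≤ x ^ 2 := by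
      rcases le_total x 0 with h | h
      · rw [max_eq_right h]; simpa using sq_nonneg x
      · rw [max_eq_left h]
    have h5 : 0 ≤ posApprox ε x := by unfold posApprox; positivity
    rw [Real.norm_of_nonneg h5, Real.norm_of_nonneg (sq_nonneg x), posApprox,
      div_le_iff₀ (by positivity)]
    have h4 : x ^ 2 ≤ 1 / ε * x ^ 2 * (max x 0 + ε) := by
      have : 1 / ε * x ^ 2 * (max x 0 + ε) = 1 / ε * x ^ 2 * max x 0 + x ^ 2 := by
        field_simp
      rw [this]
      have : 0 ≤ 1 / ε * x ^ 2 * max x 0 := by positivity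
      linarith
    linarith
  · have h1 : HasDerivAt (fun x => x ^ 2 / (x + ε))
        (((2 : ℕ) * t ^ (2 - 1) * (t + ε) - t ^ 2 * 1) / (t + ε) ^ 2) t :=
      (hasDerivAt_pow 2 t).div ((hasDerivAt_id t).add_const ε) (by positivity)
    have e : posApproxDeriv ε t = ((2 : ℕ) * t ^ (2 - 1) * (t + ε) - t ^ 2 * 1) / (t + ε) ^ 2 := by
      rw [posApproxDeriv, max_eq_left ht.le]
      congr 1
      push_cast
      ring
    rw [e]
    refine h1.congr_of_eventuallyEq ?_
    filter_upwards [Ioi_mem_nhds ht] with x hx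
    simp [posApprox, max_eq_left (mem_Ioi.1 hx).le]

lemma continuous_posApproxDeriv (hε : 0 < ε) : Continuous (posApproxDeriv ε) := by
  unfold posApproxDeriv
  refine Continuous.div (by fun_prop) (by fun_prop) fun t => ?_
  have : 0 ≤ max t 0 := le_max_right _ _
  positivity

lemma posApproxDeriv_nonneg (hε : 0 < ε) (t : ℝ) : 0 ≤ posApproxDeriv ε t := by
  have : 0 ≤ max t 0 := le_max_right _ _
  unfold posApproxDeriv; positivity

lemma posApproxDeriv_le_one (hε : 0 < ε) (t : ℝ) : posApproxDeriv ε t ≤ 1 := by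
  have : 0 ≤ max t 0 := le_max_right _ _
  unfold posApproxDeriv
  rw [div_le_one (by positivity)]
  nlinarith

lemma abs_posApproxDeriv_le (hε : 0 < ε) (t : ℝ) : |posApproxDeriv ε t| ≤ 1 := by
  rw [abs_of_nonneg (posApproxDeriv_nonneg hε t)]; exact posApproxDeriv_le_one hε t

lemma abs_posApprox_sub_le (hε : 0 < ε) (s t : ℝ) : |posApprox ε s - posApprox ε t| ≤ |s - t| := by
  have h := lipschitzWith_of_nnnorm_deriv_le (f := posApprox ε) (C := 1)
    (fun t => (hasDerivAt_posApprox hε t).differentiableAt) (fun t => by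
      rw [(hasDerivAt_posApprox hε t).deriv, ← NNReal.coe_le_coe, coe_nnnorm]
      exact abs_posApproxDeriv_le hε t)
  simpa [Real.dist_eq] using h.dist_le_mul s t

lemma abs_posApprox_le (hε : 0 < ε) (t : ℝ) : |posApprox ε t| ≤ |t| := by
  simpa [posApprox] using abs_posApprox_sub_le hε t 0

lemma continuous_posApprox (hε : 0 < ε) : Continuous (posApprox ε) :=
  continuous_iff_continuousAt.2 fun t => (hasDerivAt_posApprox hε t).continuousAt

end PosApprox

lemma tendsto_posApprox {ε : ℕ → ℝ} (hlim : Tendsto ε atTop (𝓝 0)) (t : ℝ) :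
    Tendsto (fun m => posApprox (ε m) t) atTop (𝓝 (max t 0)) := by
  rcases le_or_gt t 0 with ht | ht
  · simp [posApprox, max_eq_right ht]
  · simp only [posApprox, max_eq_left ht.le]
    have : Tendsto (fun m => t ^ 2 / (t + ε m)) atTop (𝓝 (t ^ 2 / (t + 0))) :=
      tendsto_const_nhds.div (tendsto_const_nhds.add hlim) (by simpa using ht.ne')
    convert! this using 2
    rw [add_zero]; field_simp

lemma tendsto_posApproxDeriv {ε : ℕ → ℝ} (hlim : Tendsto ε atTop (𝓝 0)) (t : ℝ) :
    Tendsto (fun m => posApproxDeriv (ε m) t) atTop (𝓝 (if 0 < t then 1 else 0)) := by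
  rcases le_or_gt t 0 with ht | ht
  · simp [posApproxDeriv, max_eq_right ht, not_lt.2 ht]
  · simp only [posApproxDeriv, max_eq_left ht.le, ht, if_true]
    have : Tendsto (fun m => (t ^ 2 + 2 * t * ε m) / (t + ε m) ^ 2) atTop
        (𝓝 ((t ^ 2 + 2 * t * 0) / (t + 0) ^ 2)) :=
      (tendsto_const_nhds.add (tendsto_const_nhds.mul hlim)).div
        ((tendsto_const_nhds.add hlim).pow 2) (by simpa using ht.ne')
    convert! this using 2
    simp; field_simp

lemma locallyIntegrableOn_of_norm_le {F F' : Type*} [NormedAddCommGroup F] [NormedAddCommGroup F']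
    {Ω : Set (EuclideanSpace ℝ (Fin n))} {f : EuclideanSpace ℝ (Fin n) → F}
    {g : EuclideanSpace ℝ (Fin n) → F'} (hf : LocallyIntegrableOn f Ω)
    (hg : AEStronglyMeasurable g (volume.restrict Ω)) (h : ∀ x, ‖g x‖ ≤ ‖f x‖) :
    LocallyIntegrableOn g Ω := by
  intro x hx
  obtain ⟨s, hs, hfs⟩ := hf x hx
  refine ⟨s ∩ Ω, inter_mem hs self_mem_nhdsWithin, ?_⟩
  exact Integrable.mono (hfs.mono_set inter_subset_left) (hg.mono_set inter_subset_right)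
    (Eventually.of_forall h)

namespace HasWeakGradient

/-- The chain rule for `posApprox ε`. -/
lemma integral_posApprox {w : EuclideanSpace ℝ (Fin n) → ℝ}
    {g : EuclideanSpace ℝ (Fin n) → EuclideanSpace ℝ (Fin n)} (h : HasWeakGradient univ w g)
    (hw : Integrable w) (hg : Integrable g) {ε : ℝ} (hε : 0 < ε)
    {φ : EuclideanSpace ℝ (Fin n) → ℝ} (hφ : ContDiff ℝ ((⊤ : ℕ∞) : WithTop ℕ∞) φ)
    (hc : HasCompactSupport φ) (e : EuclideanSpace ℝ (Fin n)) :
    ∫ x, fderiv ℝ φ x e * posApprox ε (w x) =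
      - ∫ x, φ x * (posApproxDeriv ε (w x) * inner ℝ (g x) e) := by
  set S := tsupport φ with hS
  have hSm : MeasurableSet S := (isClosed_tsupport φ).measurableSet
  have hSf : volume S ≠ ∞ := hc.isCompact.measure_lt_top.ne
  have hwl : LocallyIntegrable w := hw.locallyIntegrable
  set W : ℕ → EuclideanSpace ℝ (Fin n) → ℝ := fun j => moll (bumpSeq j) w with hW
  set V : ℕ → EuclideanSpace ℝ (Fin n) → EuclideanSpace ℝ (Fin n) :=
    fun j => moll (bumpSeq j) g with hV
  have hWs : ∀ j, ContDiff ℝ ((⊤ : ℕ∞) : WithTop ℕ∞) (W j) := fun j => contDiff_moll _ hwl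
  have hVc : ∀ j, Continuous (V j) := fun j => (contDiff_moll _ hg.locallyIntegrable).continuous
  have cφe := continuous_fderiv_apply_of_smooth hφ e
  have cce := hasCompactSupport_fderiv_apply hc e
  obtain ⟨C, hC⟩ := cφe.bounded_above_of_compact_support cce
  obtain ⟨D, hD⟩ := hφ.continuous.bounded_above_of_compact_support hc
  have hD0 : 0 ≤ D := (norm_nonneg _).trans (hD 0)
  have hC0 : 0 ≤ C := (norm_nonneg _).trans (hC 0)
  have hout : ∀ x ∉ S, φ x = 0 := fun x hx => image_eq_zero_of_notMem_tsupport hx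
  have hout' : ∀ x ∉ S, fderiv ℝ φ x e = 0 := fun x hx =>
    image_eq_zero_of_notMem_tsupport (f := fun x => fderiv ℝ φ x e)
      (fun hh => hx (tsupport_fderiv_apply_subset' e hh))
  -- For mollifications the classical chain rule and integration by parts apply; the identity then
  -- passes to the limit in `j` on both sides.
  have step : ∀ j, ∫ x, fderiv ℝ φ x e * posApprox ε (W j x) =
      - ∫ x, φ x * (posApproxDeriv ε (W j x) * inner ℝ (V j x) e) := by
    intro j
    have hd : ∀ x, HasFDerivAt (fun x => posApprox ε (W j x))
        (posApproxDeriv ε (W j x) • fderiv ℝ (W j) x) x := fun x =>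
      (hasDerivAt_posApprox hε (W j x)).comp_hasFDerivAt x
        (((hWs j).differentiable (by simp)) x).hasFDerivAt
    have hc1 : Continuous fun x => posApprox ε (W j x) :=
      (continuous_posApprox hε).comp (hWs j).continuous
    have hc2 : Continuous fun x => fderiv ℝ (fun x => posApprox ε (W j x)) x e := by
      simp_rw [fun x => (hd x).fderiv]
      exact ((continuous_posApproxDeriv hε).comp (hWs j).continuous).mul
        (continuous_fderiv_apply_of_smooth (hWs j) e)
    have h1 := integral_mul_fderiv_eq_neg_fderiv_mul_of_integrable (μ := volume)
      (f := fun x => posApprox ε (W j x)) (g := φ) (v := e)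
      ((hc2.mul hφ.continuous).integrable_of_hasCompactSupport hc.mul_left)
      ((hc1.mul cφe).integrable_of_hasCompactSupport cce.mul_left)
      ((hc1.mul hφ.continuous).integrable_of_hasCompactSupport hc.mul_left)
      (fun x _ => (hd x).differentiableAt) (fun x _ => hφ.differentiable (by simp) x)
    simp_rw [mul_comm _ (posApprox _ _)]
    rw [h1]
    congr 1
    refine integral_congr_ae (Eventually.of_forall fun x => ?_)
    simp only
    rw [(hd x).fderiv, ← fderiv_moll h (bumpSeq j) x e]
    simp only [smul_apply, smul_eq_mul, hW]
    ring
  have hwL := moll_tendsto_lintegral hw hSm hSf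
  have hgL := moll_tendsto_lintegral hg hSm hSf
  have pbm : AEStronglyMeasurable (fun x => posApproxDeriv ε (w x)) :=
    (continuous_posApproxDeriv hε).comp_aestronglyMeasurable hw.1
  have hint2 : ∀ (k : EuclideanSpace ℝ (Fin n) → ℝ)
      (v : EuclideanSpace ℝ (Fin n) → EuclideanSpace ℝ (Fin n)),
      AEStronglyMeasurable k → LocallyIntegrable v →
      Integrable (fun x => φ x * (posApproxDeriv ε (k x) * inner ℝ (v x) e)) := by
    intro k v hk hv
    have i1 := integrable_mul_inner_of_locallyIntegrableOn (Ω := univ)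
      (hv.locallyIntegrableOn _) hφ.continuous hc (subset_univ _) e
    refine i1.mono (hφ.continuous.aestronglyMeasurable.mul
      (((continuous_posApproxDeriv hε).comp_aestronglyMeasurable hk).mul
        (hv.aestronglyMeasurable.inner aestronglyMeasurable_const)))
      (Eventually.of_forall fun x => ?_)
    rw [norm_mul, norm_mul, norm_mul]
    refine mul_le_mul_of_nonneg_left ?_ (norm_nonneg _)
    exact mul_le_of_le_one_left (norm_nonneg _) (abs_posApproxDeriv_le hε _)
  have lim1 : Tendsto (fun j => ∫ x, fderiv ℝ φ x e * posApprox ε (W j x)) atTop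
      (𝓝 (∫ x, fderiv ℝ φ x e * posApprox ε (w x))) := by
    refine tendsto_integral_of_L1 _ (Integrable.aestronglyMeasurable ?_)
      (Eventually.of_forall fun j => ?_) ?_
    · refine (integrable_mul_of_locallyIntegrableOn (Ω := univ) (hwl.locallyIntegrableOn _) cφe cce
        (subset_univ _)).mono (cφe.aestronglyMeasurable.mul
          ((continuous_posApprox hε).comp_aestronglyMeasurable hw.1))
        (Eventually.of_forall fun x => ?_)
      rw [norm_mul, norm_mul]
      exact mul_le_mul_of_nonneg_left (abs_posApprox_le hε _) (norm_nonneg _)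
    · exact (cφe.mul ((continuous_posApprox hε).comp
        (hWs j).continuous)).integrable_of_hasCompactSupport cce.mul_right
    · have hz : Tendsto (fun j => ENNReal.ofReal C *
          ∫⁻ x in S, ‖moll (bumpSeq j) w x - w x‖ₑ) atTop (𝓝 0) := by
        simpa using ENNReal.Tendsto.const_mul hwL (Or.inr ENNReal.ofReal_ne_top)
      refine tendsto_of_tendsto_of_tendsto_of_le_of_le tendsto_const_nhds hz
        (fun _ => zero_le) fun j => ?_
      rw [← lintegral_const_mul' _ _ ENNReal.ofReal_ne_top, ← lintegral_indicator hSm]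
      refine lintegral_mono fun x => ?_
      by_cases hx : x ∈ S
      · rw [indicator_of_mem hx, ← mul_sub, enorm_mul]
        gcongr
        · rw [← ofReal_norm]; exact ENNReal.ofReal_le_ofReal (hC x)
        · rw [← ofReal_norm, ← ofReal_norm]
          exact ENNReal.ofReal_le_ofReal (abs_posApprox_sub_le hε _ _)
      · simp [hout' x hx]
  have lim2 : Tendsto (fun j => ∫ x, φ x * (posApproxDeriv ε (W j x) * inner ℝ (V j x) e)) atTop
      (𝓝 (∫ x, φ x * (posApproxDeriv ε (w x) * inner ℝ (g x) e))) := by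
    refine tendsto_integral_of_L1 _ (hint2 w g hw.1 hg.locallyIntegrable).1
      (Eventually.of_forall fun j => hint2 (W j) (V j)
        (hWs j).continuous.aestronglyMeasurable (hVc j).locallyIntegrable) ?_
    have hz : Tendsto (fun j => ENNReal.ofReal (D * ‖e‖) *
        ∫⁻ x in S, ‖moll (bumpSeq j) g x - g x‖ₑ) atTop (𝓝 0) := by
      simpa using ENNReal.Tendsto.const_mul hgL (Or.inr ENNReal.ofReal_ne_top)
    -- The difference of products splits in two. The gradients converge in `L¹` against a bounded
    -- factor; the change in the factor `posApproxDeriv`, known only to converge almost everywhere,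
    -- is handled by dominated convergence against the fixed integrable `g`.
    have hz2 : Tendsto (fun j => ∫⁻ x, ‖φ x * inner ℝ (g x) e *
        (posApproxDeriv ε (W j x) - posApproxDeriv ε (w x))‖ₑ) atTop (𝓝 0) := by
      have hi := integrable_mul_inner_of_locallyIntegrableOn (Ω := univ)
        (hg.locallyIntegrable.locallyIntegrableOn _) hφ.continuous hc (subset_univ _) e
      have hd := tendsto_lintegral_of_dominated_convergence'
        (F := fun j x => ‖φ x * inner ℝ (g x) e *
          (posApproxDeriv ε (W j x) - posApproxDeriv ε (w x))‖ₑ) (f := fun _ => 0)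
        (μ := volume) (fun x => 2 * ‖φ x * inner ℝ (g x) e‖ₑ) (fun j => ?_) (fun j => ?_) ?_ ?_
      · simpa using hd
      · exact (hi.1.mul (((continuous_posApproxDeriv hε).comp_aestronglyMeasurable
          (hWs j).continuous.aestronglyMeasurable).sub pbm)).enorm
      · refine Eventually.of_forall fun x => ?_
        simp only
        rw [enorm_mul, mul_comm]
        gcongr
        rw [← ofReal_norm, ← ENNReal.ofReal_ofNat 2]
        refine ENNReal.ofReal_le_ofReal ((norm_sub_le _ _).trans ?_)
        have := abs_posApproxDeriv_le hε (W j x)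
        have := abs_posApproxDeriv_le hε (w x)
        simp only [Real.norm_eq_abs]
        linarith
      · rw [lintegral_const_mul' _ _ (by simp)]
        exact ENNReal.mul_ne_top (by simp) hi.2.ne
      · filter_upwards [moll_tendsto_ae hwl] with x hx
        have h1 := ((continuous_posApproxDeriv hε).tendsto (w x)).comp hx
        have h2 := ((h1.sub_const (posApproxDeriv ε (w x))).const_mul
          (φ x * inner ℝ (g x) e)).enorm
        simpa using h2
    have hz3 := hz.add hz2
    rw [add_zero] at hz3
    refine tendsto_of_tendsto_of_tendsto_of_le_of_le tendsto_const_nhds hz3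
        (fun _ => zero_le) fun j => ?_
    simp only
    have hmeas : AEMeasurable (fun x => ‖φ x * inner ℝ (g x) e *
        (posApproxDeriv ε (W j x) - posApproxDeriv ε (w x))‖ₑ) := by
      exact ((hφ.continuous.aestronglyMeasurable.mul (hg.1.inner aestronglyMeasurable_const)).mul
        (((continuous_posApproxDeriv hε).comp_aestronglyMeasurable
          (hWs j).continuous.aestronglyMeasurable).sub pbm)).enorm
    rw [← lintegral_const_mul' _ _ ENNReal.ofReal_ne_top, ← lintegral_indicator hSm,
      ← lintegral_add_right' _ hmeas]
    refine lintegral_mono fun x => ?_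
    by_cases hx : x ∈ S
    · rw [indicator_of_mem hx]
      have e1 : φ x * (posApproxDeriv ε (W j x) * inner ℝ (V j x) e) -
          φ x * (posApproxDeriv ε (w x) * inner ℝ (g x) e) =
          φ x * posApproxDeriv ε (W j x) * inner ℝ (V j x - g x) e +
          φ x * inner ℝ (g x) e * (posApproxDeriv ε (W j x) - posApproxDeriv ε (w x)) := by
        rw [inner_sub_left]; ring
      rw [e1]
      refine (enorm_add_le _ _).trans ?_
      gcongr
      rw [← ofReal_norm, ← ofReal_norm, ← ENNReal.ofReal_mul (by positivity)]
      refine ENNReal.ofReal_le_ofReal ?_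
      rw [norm_mul, norm_mul]
      calc ‖φ x‖ * ‖posApproxDeriv ε (W j x)‖ * ‖inner ℝ (V j x - g x) e‖
          ≤ D * 1 * (‖V j x - g x‖ * ‖e‖) := by
            gcongr
            · exact hD x
            · exact abs_posApproxDeriv_le hε _
            · exact norm_inner_le_norm _ _
        _ = _ := by ring
    · simp [hout x hx]
  refine tendsto_nhds_unique lim1 ?_
  simp_rw [step]
  exact lim2.neg

/-- As `ε → 0` the approximations and their derivatives are dominated by `|w|` and `1`. The
derivatives tend to the indicator of `{w > 0}`, with limit `0` where `w` vanishes, so no separate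
analysis of the zero set is needed. -/
lemma integral_posPart {w : EuclideanSpace ℝ (Fin n) → ℝ}
    {g : EuclideanSpace ℝ (Fin n) → EuclideanSpace ℝ (Fin n)} (h : HasWeakGradient univ w g)
    (hw : Integrable w) (hg : Integrable g)
    {φ : EuclideanSpace ℝ (Fin n) → ℝ} (hφ : ContDiff ℝ ((⊤ : ℕ∞) : WithTop ℕ∞) φ)
    (hc : HasCompactSupport φ) (e : EuclideanSpace ℝ (Fin n)) :
    ∫ x, fderiv ℝ φ x e * max (w x) 0 =
      - ∫ x, φ x * ((if 0 < w x then 1 else 0) * inner ℝ (g x) e) := by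
  set ε : ℕ → ℝ := fun m => 1 / ((m : ℝ) + 1) with hεd
  have hε : ∀ m, 0 < ε m := fun m => by positivity
  have hlim : Tendsto ε atTop (𝓝 0) := tendsto_one_div_add_atTop_nhds_zero_nat
  have cφe := continuous_fderiv_apply_of_smooth hφ e
  have cce := hasCompactSupport_fderiv_apply hc e
  have lim1 : Tendsto (fun m => ∫ x, fderiv ℝ φ x e * posApprox (ε m) (w x)) atTop
      (𝓝 (∫ x, fderiv ℝ φ x e * max (w x) 0)) := by
    refine tendsto_integral_of_dominated_convergence (fun x => ‖fderiv ℝ φ x e * w x‖)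
      (fun m => cφe.aestronglyMeasurable.mul
        ((continuous_posApprox (hε m)).comp_aestronglyMeasurable hw.1))
      (integrable_mul_of_locallyIntegrableOn (Ω := univ)
        (hw.locallyIntegrable.locallyIntegrableOn _) cφe cce (subset_univ _)).norm
      (fun m => Eventually.of_forall fun x => ?_) (Eventually.of_forall fun x => ?_)
    · rw [norm_mul, norm_mul]
      exact mul_le_mul_of_nonneg_left (abs_posApprox_le (hε m) _) (norm_nonneg _)
    · exact (tendsto_posApprox hlim (w x)).const_mul _
  have lim2 : Tendsto (fun m => ∫ x, φ x * (posApproxDeriv (ε m) (w x) * inner ℝ (g x) e)) atTop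
      (𝓝 (∫ x, φ x * ((if 0 < w x then 1 else 0) * inner ℝ (g x) e))) := by
    refine tendsto_integral_of_dominated_convergence (fun x => ‖φ x * inner ℝ (g x) e‖)
      (fun m => hφ.continuous.aestronglyMeasurable.mul
        (((continuous_posApproxDeriv (hε m)).comp_aestronglyMeasurable hw.1).mul
          (hg.1.inner aestronglyMeasurable_const)))
      (integrable_mul_inner_of_locallyIntegrableOn (Ω := univ)
        (hg.locallyIntegrable.locallyIntegrableOn _) hφ.continuous hc (subset_univ _) e).norm
      (fun m => Eventually.of_forall fun x => ?_) (Eventually.of_forall fun x => ?_)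
    · rw [norm_mul, norm_mul, norm_mul]
      refine mul_le_mul_of_nonneg_left ?_ (norm_nonneg _)
      exact mul_le_of_le_one_left (norm_nonneg _) (abs_posApproxDeriv_le (hε m) _)
    · exact ((tendsto_posApproxDeriv hlim (w x)).mul_const _).const_mul _
  refine tendsto_nhds_unique lim1 ?_
  simp_rw [fun m => h.integral_posApprox hw hg (hε m) hφ hc e]
  exact lim2.neg

/-- The weak gradient of the positive part. -/
lemma posPart {Ω : Set (EuclideanSpace ℝ (Fin n))} {u : EuclideanSpace ℝ (Fin n) → ℝ}
    {Du : EuclideanSpace ℝ (Fin n) → EuclideanSpace ℝ (Fin n)} (h : HasWeakGradient Ω u Du)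
    (hΩ : IsOpen Ω) :
    HasWeakGradient Ω (fun x => max (u x) 0) (fun x => if 0 < u x then Du x else 0) := by
  have hum : AEStronglyMeasurable u (volume.restrict Ω) := h.locInt.aestronglyMeasurable
  have hgm : AEStronglyMeasurable Du (volume.restrict Ω) := h.locInt_grad.aestronglyMeasurable
  have h1 : LocallyIntegrableOn (fun x => max (u x) 0) Ω := by
    refine locallyIntegrableOn_of_norm_le h.locInt (hum.sup aestronglyMeasurable_const)
      fun x => ?_
    simp only [Real.norm_eq_abs]
    rw [abs_of_nonneg (le_max_right _ _)]
    exact max_le (le_abs_self _) (abs_nonneg _)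
  have h2 : LocallyIntegrableOn (fun x => if 0 < u x then Du x else 0) Ω := by
    refine locallyIntegrableOn_of_norm_le h.locInt_grad ?_ fun x => ?_
    · have hset : NullMeasurableSet {x | 0 < u x} (volume.restrict Ω) :=
        nullMeasurableSet_lt aemeasurable_const hum.aemeasurable
      have := hgm.indicator₀ hset
      refine this.congr (Eventually.of_forall fun x => ?_)
      simp [indicator]
    · split_ifs
      · exact le_rfl
      · simp
  refine of_univ h1 h2 fun φ hφ hc hs e => ?_
  -- Since `ζ = 1` near the support of `φ`, its gradient vanishes there and the global statement for
  -- `ζ u` reduces to the local one for `u`.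
  obtain ⟨ζ, hζ, hζc, hζs, hζ1⟩ := exists_smooth_cutoff hc.isCompact hΩ hs
  obtain ⟨hw, hi1, hi2⟩ := h.cutoff_mul hζ hζc hζs
  have key := hw.integral_posPart hi1 hi2 hφ hc e
  have hz : ∀ x ∈ tsupport φ, ζ x = 1 ∧ gradient ζ x = 0 := by
    intro x hx
    have h3 : ∀ᶠ y in 𝓝 x, ζ y = 1 := hζ1.filter_mono (nhds_le_nhdsSet hx)
    refine ⟨h3.self_of_nhds, ?_⟩
    have h4 : ζ =ᶠ[𝓝 x] fun _ => (1 : ℝ) := h3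
    rw [gradient, h4.fderiv_eq]
    simp
  convert! key using 1
  · refine integral_congr_ae (Eventually.of_forall fun x => ?_)
    simp only
    by_cases hx : x ∈ tsupport φ
    · rw [(hz x hx).1, one_mul]
    · have : fderiv ℝ φ x e = 0 := image_eq_zero_of_notMem_tsupport
        (f := fun x => fderiv ℝ φ x e) (fun hh => hx (tsupport_fderiv_apply_subset' e hh))
      rw [this, zero_mul, zero_mul]
  · congr 1
    refine integral_congr_ae (Eventually.of_forall fun x => ?_)
    simp only
    by_cases hx : x ∈ tsupport φ
    · rw [(hz x hx).1, (hz x hx).2]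
      by_cases hux : 0 < u x <;> simp [hux]
    · rw [image_eq_zero_of_notMem_tsupport hx, zero_mul, zero_mul]

end HasWeakGradient

end MultiPhase

/-! ### Sobolev's inequality for growth functions. -/

namespace MultiPhase

variable {n : ℕ}

lemma IsGrowth.continuous_abs {q : ℕ} {φ : ℝ → ℝ} (h : IsGrowth q φ) :
    Continuous fun t => φ |t| := h.contDiff_abs.continuous

lemma IsGrowth.aemeasurable_ofReal_norm {q : ℕ} {φ : ℝ → ℝ} (h : IsGrowth q φ) {α F : Type*}
    [MeasurableSpace α] {μ : Measure α} [NormedAddCommGroup F] {f : α → F}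
    (hf : AEStronglyMeasurable f μ) : AEMeasurable (fun x => ENNReal.ofReal (φ ‖f x‖)) μ := by
  have := (h.continuous_abs.measurable.comp_aemeasurable hf.norm.aemeasurable).ennreal_ofReal
  simpa [Function.comp_def] using this

lemma one_sub_inv_pos (hn : 2 ≤ n) : (0 : ℝ) < 1 - 1 / n := by
  have : (2 : ℝ) ≤ n := by exact_mod_cast hn
  rw [sub_pos, div_lt_one (by linarith)]
  linarith

/-- The embedding of `W^{1,1}` into `L^(n/(n-1))` is applied to the `C¹` function `φ(|f|/R)`. Its
gradient is at most `|φ'(|f|/R)| |Df| / R`, and `abs_deriv_mul_le` separates the two factors. -/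
lemma IsGrowth.sobolev_smooth (hn : 2 ≤ n) {q : ℕ} {φ : ℝ → ℝ} (h : IsGrowth q φ)
    {f : EuclideanSpace ℝ (Fin n) → ℝ} (hf : ContDiff ℝ 1 f) (hc : HasCompactSupport f) {R : ℝ}
    (hR : 0 < R) :
    ∫⁻ x, ENNReal.ofReal (φ (|f x| / R)) ^ (1 - 1 / (n : ℝ))⁻¹ ≤
      lintegralPowLePowLIntegralFDerivConst (volume : Measure (EuclideanSpace ℝ (Fin n)))
        (1 - 1 / (n : ℝ))⁻¹ *
      (ENNReal.ofReal (2 ^ q / R) * ((∫⁻ x, ENNReal.ofReal (φ (|f x| / R))) +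
        ∫⁻ x, ENNReal.ofReal (φ ‖fderiv ℝ f x‖))) ^ (1 - 1 / (n : ℝ))⁻¹ := by
  set p : ℝ := (1 - 1 / (n : ℝ))⁻¹ with hp
  have h0 := one_sub_inv_pos hn
  have hn0 : (0 : ℝ) < n := by have : 0 < n := by omega
                               exact_mod_cast this
  have hconj : (Module.finrank ℝ (EuclideanSpace ℝ (Fin n)) : ℝ).HolderConjugate p := by
    rw [finrank_euclideanSpace_fin, Real.holderConjugate_iff]
    refine ⟨by have : 1 < n := by omega
               exact_mod_cast this, ?_⟩
    rw [hp, inv_inv]; ring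
  set v : EuclideanSpace ℝ (Fin n) → ℝ := fun x => φ |R⁻¹ * f x| with hv
  have hvC : ContDiff ℝ 1 v := h.contDiff_abs.comp (contDiff_const.mul hf)
  have hvc : HasCompactSupport v := by
    refine hc.mono fun x hx => ?_
    intro h0
    exact hx (by simp [hv, h0, h.zero])
  have hveq : ∀ x, v x = φ (|f x| / R) := fun x => by
    simp only [hv, abs_mul, abs_of_pos (inv_pos.2 hR)]
    rw [div_eq_inv_mul]
  have key := lintegral_pow_le_pow_lintegral_fderiv (volume : Measure (EuclideanSpace ℝ (Fin n)))
    hvC hvc hconj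
  have e1 : ∀ x, ‖v x‖ₑ = ENNReal.ofReal (φ (|f x| / R)) := fun x => by
    rw [hveq, ← ofReal_norm, Real.norm_of_nonneg (h.nonneg (by positivity))]
  simp_rw [e1] at key
  refine key.trans ?_
  gcongr
  have hm : Measurable fun x => ENNReal.ofReal (φ (|f x| / R)) := by
    have : Continuous fun x => φ (|f x| / R) := by
      simp_rw [← hveq]; exact hvC.continuous
    exact this.measurable.ennreal_ofReal
  rw [← lintegral_add_left hm, ← lintegral_const_mul' _ _ ENNReal.ofReal_ne_top]
  refine lintegral_mono fun x => ?_
  simp only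
  rw [← ENNReal.ofReal_add (h.nonneg (by positivity)) (h.nonneg (norm_nonneg _)),
    ← ENNReal.ofReal_mul (by positivity), ← ofReal_norm]
  refine ENNReal.ofReal_le_ofReal ?_
  have hd : HasFDerivAt v (deriv (fun t => φ |t|) (R⁻¹ * f x) • (R⁻¹ • fderiv ℝ f x)) x := by
    have h1 := (h.contDiff_abs.differentiable one_ne_zero (R⁻¹ * f x)).hasDerivAt
    have h2 := ((hf.differentiable one_ne_zero x).hasFDerivAt).const_mul R⁻¹
    exact HasDerivAt.comp_hasFDerivAt (h₂ := fun t => φ |t|) (f := fun y => R⁻¹ * f y) x h1 h2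
  rw [hd.fderiv, norm_smul, norm_smul, Real.norm_of_nonneg (inv_pos.2 hR).le]
  have h3 := h.abs_deriv_mul_le (R⁻¹ * f x) (norm_nonneg (fderiv ℝ f x))
  change ‖deriv (fun t => φ |t|) (R⁻¹ * f x)‖ * (R⁻¹ * ‖fderiv ℝ f x‖) ≤ _
  rw [Real.norm_eq_abs]
  have h4 : φ |R⁻¹ * f x| = φ (|f x| / R) := hveq x
  rw [h4] at h3
  calc |deriv (fun t => φ |t|) (R⁻¹ * f x)| * (R⁻¹ * ‖fderiv ℝ f x‖)
      = R⁻¹ * (|deriv (fun t => φ |t|) (R⁻¹ * f x)| * ‖fderiv ℝ f x‖) := by ring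
    _ ≤ R⁻¹ * (2 ^ q * (φ (|f x| / R) + φ ‖fderiv ℝ f x‖)) :=
        mul_le_mul_of_nonneg_left h3 (inv_pos.2 hR).le
    _ = _ := by ring

lemma norm_fderiv_moll {w : EuclideanSpace ℝ (Fin n) → ℝ}
    {g : EuclideanSpace ℝ (Fin n) → EuclideanSpace ℝ (Fin n)} (h : HasWeakGradient univ w g)
    (b : ContDiffBump (0 : EuclideanSpace ℝ (Fin n))) (x : EuclideanSpace ℝ (Fin n)) :
    ‖fderiv ℝ (moll b w) x‖ = ‖moll b g x‖ := by
  have : fderiv ℝ (moll b w) x = InnerProductSpace.toDual ℝ _ (moll b g x) := by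
    ext e
    rw [fderiv_moll h, InnerProductSpace.toDual_apply_apply]
  rw [this, LinearIsometryEquiv.norm_map]

/-- **Sobolev's inequality** for growth functions. -/
lemma exists_sobolev_const (hn : 2 ≤ n) (q : ℕ) : ∃ C : ℝ≥0, ∀ φ : ℝ → ℝ, IsGrowth q φ →
    ∀ (w : EuclideanSpace ℝ (Fin n) → ℝ)
      (g : EuclideanSpace ℝ (Fin n) → EuclideanSpace ℝ (Fin n)) (R : ℝ),
      HasWeakGradient univ w g → Integrable w → Integrable g → HasCompactSupport w → 0 < R →
      (∫⁻ x, ENNReal.ofReal (φ (|w x| / R)) ^ (1 - 1 / (n : ℝ))⁻¹) ^ (1 - 1 / (n : ℝ)) ≤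
        C * ENNReal.ofReal (1 / R) * ((∫⁻ x, ENNReal.ofReal (φ (|w x| / R))) +
          ∫⁻ x, ENNReal.ofReal (φ ‖g x‖)) := by
  set p : ℝ := (1 - 1 / (n : ℝ))⁻¹ with hp
  have h0 := one_sub_inv_pos hn
  have hp0 : 0 < p := inv_pos.2 h0
  set A := lintegralPowLePowLIntegralFDerivConst (volume : Measure (EuclideanSpace ℝ (Fin n))) p
  refine ⟨A ^ (1 - 1 / (n : ℝ)) * 2 ^ q, fun φ h w g R hw hwi hgi hc hR => ?_⟩
  -- The class is invariant under scaling of the argument, with the same `q`, so Jensen's inequality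
  -- for mollifications also covers `φ(|w|/R)`.
  have hgr : IsGrowth q (fun t => φ (t / R)) := by
    refine ⟨by simp [h.zero], fun t ht => h.pos _ (by positivity), fun x hx y hy hxy => ?_, ?_,
      ?_, ?_, ?_⟩
    · have hx : (0 : ℝ) ≤ x := hx
      exact h.le_of_le (by positivity) (by gcongr)
    · refine ⟨convex_Ici 0, fun x hx y hy a b ha hb hab => ?_⟩
      have := h.convex.2 (mem_Ici.2 (div_nonneg hx hR.le)) (mem_Ici.2 (div_nonneg hy hR.le))
        ha hb hab
      simp only [smul_eq_mul] at this ⊢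
      convert! this using 2
      ring
    · exact h.cont.comp (continuous_id.div_const R).continuousOn
        fun t ht => mem_Ici.2 (div_nonneg ht hR.le)
    · intro c t hc ht
      have := h.doubling c (t / R) hc (by positivity)
      rwa [← mul_div_assoc] at this
    · have := h.contDiff_abs.comp (contDiff_id.div_const R)
      simpa [Function.comp_def, abs_div, abs_of_pos hR] using this
  set S : ℝ≥0∞ := (∫⁻ x, ENNReal.ofReal (φ (|w x| / R))) + ∫⁻ x, ENNReal.ofReal (φ ‖g x‖) with hS
  have step : ∀ j, ∫⁻ x, ENNReal.ofReal (φ (|moll (bumpSeq j) w x| / R)) ^ p ≤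
      A * (ENNReal.ofReal (2 ^ q / R) * S) ^ p := by
    intro j
    have h1 := h.sobolev_smooth hn
      ((contDiff_moll (bumpSeq j) hwi.locallyIntegrable).of_le (by simp))
      (hasCompactSupport_moll (bumpSeq j) hc) hR
    refine h1.trans ?_
    rw [hS]
    refine mul_le_mul_right (ENNReal.rpow_le_rpow (mul_le_mul_right ?_ _) hp0.le) _
    refine add_le_add ?_ ?_
    · calc ∫⁻ x, ENNReal.ofReal (φ (|moll (bumpSeq j) w x| / R))
          ≤ ∫⁻ x, ∫⁻ y, ENNReal.ofReal (φ (|w (x - y)| / R)) ∂(mollMeasure (bumpSeq j)) :=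
            lintegral_mono fun x => hgr.ofReal_norm_moll_le (bumpSeq j) w x
        _ = _ := lintegral_mollMeasure_le (g := fun x => ENNReal.ofReal (φ (|w x| / R))) _
            (hgr.aemeasurable_ofReal_norm hwi.1)
    · calc ∫⁻ x, ENNReal.ofReal (φ ‖fderiv ℝ (moll (bumpSeq j) w) x‖)
          ≤ ∫⁻ x, ∫⁻ y, ENNReal.ofReal (φ ‖g (x - y)‖) ∂(mollMeasure (bumpSeq j)) :=
            lintegral_mono fun x => by
              rw [norm_fderiv_moll hw]; exact h.ofReal_norm_moll_le (bumpSeq j) g x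
        _ = _ := lintegral_mollMeasure_le (g := fun x => ENNReal.ofReal (φ ‖g x‖)) _
            (h.aemeasurable_ofReal_norm hgi.1)
  have hcont : Continuous fun t : ℝ => ENNReal.ofReal (φ (|t| / R)) ^ p :=
    ENNReal.continuous_rpow_const.comp (ENNReal.continuous_ofReal.comp hgr.continuous_abs)
  -- Fatou's lemma along almost everywhere convergent mollifications; their right-hand sides are
  -- already bounded by that of `w`, by Jensen.
  have fatou : ∫⁻ x, ENNReal.ofReal (φ (|w x| / R)) ^ p ≤
      A * (ENNReal.ofReal (2 ^ q / R) * S) ^ p := by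
    calc ∫⁻ x, ENNReal.ofReal (φ (|w x| / R)) ^ p
        ≤ ∫⁻ x, liminf (fun j => ENNReal.ofReal (φ (|moll (bumpSeq j) w x| / R)) ^ p) atTop := by
          refine lintegral_mono_ae ?_
          filter_upwards [moll_tendsto_ae hwi.locallyIntegrable] with x hx
          exact (((hcont.tendsto (w x)).comp hx).liminf_eq).ge
      _ ≤ liminf (fun j => ∫⁻ x, ENNReal.ofReal (φ (|moll (bumpSeq j) w x| / R)) ^ p) atTop :=
          lintegral_liminf_le fun j => (hcont.comp
            (contDiff_moll (bumpSeq j) hwi.locallyIntegrable).continuous).measurable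
      _ ≤ _ := by
          refine liminf_le_of_le (by isBoundedDefault) fun b hb => ?_
          obtain ⟨j, hj⟩ := hb.exists
          exact hj.trans (step j)
  have e : (1 - 1 / (n : ℝ)) = p⁻¹ := by rw [hp, inv_inv]
  calc (∫⁻ x, ENNReal.ofReal (φ (|w x| / R)) ^ p) ^ (1 - 1 / (n : ℝ))
      ≤ (A * (ENNReal.ofReal (2 ^ q / R) * S) ^ p) ^ (1 - 1 / (n : ℝ)) := by gcongr
    _ = (A : ℝ≥0∞) ^ (1 - 1 / (n : ℝ)) * (ENNReal.ofReal (2 ^ q / R) * S) := by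
        rw [ENNReal.mul_rpow_of_nonneg _ _ h0.le, ← ENNReal.rpow_mul, e,
          mul_inv_cancel₀ hp0.ne', ENNReal.rpow_one]
    _ = _ := by
        rw [div_eq_mul_one_div (2 ^ q) R, ENNReal.ofReal_mul (by positivity), ENNReal.coe_mul,
          ENNReal.coe_rpow_of_nonneg _ h0.le]
        have : ENNReal.ofReal (2 ^ q) = ((2 ^ q : ℝ≥0) : ℝ≥0∞) := by
          rw [← ENNReal.ofReal_coe_nnreal]; simp
        rw [this]
        ring

end MultiPhase

/-! ### A Poincaré inequality on balls. -/

namespace MultiPhase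

variable {n : ℕ}

/-- The homothety centred at `y` maps the convex set into itself, and its inverse Jacobian `s^(-n)`
is at most `2^n` for `s ≥ 1/2`. -/
lemma setLIntegral_homothety_le {S : Set (EuclideanSpace ℝ (Fin n))} (hS : Convex ℝ S)
    (hSm : MeasurableSet S) {G : EuclideanSpace ℝ (Fin n) → ℝ≥0∞} (hG : Measurable G)
    {y : EuclideanSpace ℝ (Fin n)} (hy : y ∈ S) {s : ℝ} (hs : 1 / 2 ≤ s) (hs1 : s ≤ 1) :
    ∫⁻ x in S, G (s • x + (1 - s) • y) ≤ 2 ^ n * ∫⁻ x in S, G x := by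
  have hs0 : 0 < s := by linarith
  have hm : Measurable (S.indicator G) := hG.indicator hSm
  calc ∫⁻ x in S, G (s • x + (1 - s) • y)
      ≤ ∫⁻ x, S.indicator G (s • x + (1 - s) • y) := by
        rw [← lintegral_indicator hSm]
        refine lintegral_mono fun x => ?_
        by_cases hx : x ∈ S
        · rw [indicator_of_mem hx, indicator_of_mem (hS hx hy hs0.le (by linarith) (by ring))]
        · simp [hx]
    _ = ∫⁻ z, S.indicator G (z + (1 - s) • y) ∂(Measure.map (fun x => s • x) volume) := by
        exact (lintegral_map (hm.comp (measurable_add_const _)) (measurable_const_smul s)).symm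
    _ = ENNReal.ofReal |(s ^ n)⁻¹| * ∫⁻ x in S, G x := by
        rw [Measure.map_addHaar_smul _ hs0.ne', lintegral_smul_measure,
          lintegral_add_right_eq_self, finrank_euclideanSpace_fin, lintegral_indicator hSm,
          smul_eq_mul]
    _ ≤ _ := by
        gcongr
        rw [abs_of_pos (by positivity), ← inv_pow, ENNReal.ofReal_pow (by positivity)]
        gcongr
        rw [← ENNReal.ofReal_ofNat]
        refine ENNReal.ofReal_le_ofReal ?_
        rw [inv_le_comm₀ hs0 (by norm_num)]
        linarith

/-- A **Poincaré inequality** on balls, for smooth functions. -/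
lemma IsGrowth.poincare_smooth {q : ℕ} {φ : ℝ → ℝ} (h : IsGrowth q φ)
    {f : EuclideanSpace ℝ (Fin n) → ℝ} (hf : ContDiff ℝ 1 f) (x₀ : EuclideanSpace ℝ (Fin n))
    {r : ℝ} (hr : 0 < r) :
    ∫⁻ x in Metric.ball x₀ r, ∫⁻ y in Metric.ball x₀ r, ENNReal.ofReal (φ (|f x - f y| / (2 * r))) ≤
      2 ^ n * (volume (Metric.ball x₀ r) *
        ∫⁻ x in Metric.ball x₀ r, ENNReal.ofReal (φ ‖fderiv ℝ f x‖)) := by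
  set S := Metric.ball x₀ r with hS
  set G : EuclideanSpace ℝ (Fin n) → ℝ≥0∞ := fun x => ENNReal.ofReal (φ ‖fderiv ℝ f x‖) with hGd
  have hconv : Convex ℝ S := convex_ball _ _
  have hSm : MeasurableSet S := Metric.isOpen_ball.measurableSet
  have hfd : Continuous (fderiv ℝ f) := hf.continuous_fderiv one_ne_zero
  have hG : Measurable G := by
    have h1 : Continuous fun x => φ |‖fderiv ℝ f x‖| := h.continuous_abs.comp hfd.norm
    simp only [abs_norm] at h1
    exact h1.measurable.ennreal_ofReal
  have hprob : IsProbabilityMeasure (volume.restrict (Icc (0 : ℝ) 1)) := ⟨by simp⟩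
  -- The fundamental theorem of calculus along the segment, then Jensen in the parameter; the length
  -- `|y - x| ≤ 2r` is cancelled by the scaling `2r`.
  have pt : ∀ x ∈ S, ∀ y ∈ S, ENNReal.ofReal (φ (|f x - f y| / (2 * r))) ≤
      ∫⁻ t in Icc (0 : ℝ) 1, G ((1 - t) • x + t • y) := by
    intro x hx y hy
    have hγ : ∀ t : ℝ, HasDerivAt (fun t : ℝ => f ((1 - t) • x + t • y))
        (fderiv ℝ f ((1 - t) • x + t • y) (y - x)) t := by
      intro t
      have h1 : HasDerivAt (fun t : ℝ => (1 - t) • x + t • y) (y - x) t := by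
        have h2 := (((hasDerivAt_id t).const_sub 1).smul_const x).add
          ((hasDerivAt_id t).smul_const y)
        convert! h2 using 1
        simp; abel
      exact ((hf.differentiable one_ne_zero _).hasFDerivAt).comp_hasDerivAt t h1
    have hγc : Continuous fun t : ℝ => fderiv ℝ f ((1 - t) • x + t • y) (y - x) :=
      (hfd.comp (by fun_prop)).clm_apply continuous_const
    have ftc := intervalIntegral.integral_eq_sub_of_hasDerivAt (a := 0) (b := 1)
      (fun t _ => hγ t) (hγc.intervalIntegrable 0 1)
    simp only [sub_self, zero_smul, one_smul, zero_add, sub_zero, add_zero] at ftc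
    have e1 : |f x - f y| / (2 * r) = ‖∫ t in Icc (0 : ℝ) 1,
        fderiv ℝ f ((1 - t) • x + t • y) (y - x) / (2 * r)‖ := by
      rw [integral_div, integral_Icc_eq_integral_Ioc,
        ← intervalIntegral.integral_of_le zero_le_one, ftc, Real.norm_eq_abs, abs_div,
        abs_of_pos (by positivity : 0 < 2 * r), abs_sub_comm]
    rw [e1]
    refine (h.ofReal_norm_integral_le _ _).trans (lintegral_mono fun t => ?_)
    refine ENNReal.ofReal_le_ofReal (h.le_of_le (norm_nonneg _) ?_)
    rw [norm_div, Real.norm_of_nonneg (by positivity : 0 ≤ 2 * r), div_le_iff₀ (by positivity)]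
    refine (ContinuousLinearMap.le_opNorm _ _).trans ?_
    gcongr
    have := dist_triangle_right y x x₀
    rw [← dist_eq_norm]
    rw [hS, Metric.mem_ball] at hx hy
    linarith
  have hmeas3 : Measurable fun p : (EuclideanSpace ℝ (Fin n) × EuclideanSpace ℝ (Fin n)) × ℝ =>
      G ((1 - p.2) • p.1.1 + p.2 • p.1.2) := by
    refine hG.comp (Continuous.measurable ?_)
    fun_prop
  have bound : ∀ t ∈ Icc (0 : ℝ) 1, ∫⁻ x in S, ∫⁻ y in S, G ((1 - t) • x + t • y) ≤
      2 ^ n * (volume S * ∫⁻ x in S, G x) := by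
    intro t ht
    have fin : ∀ c : ℝ≥0∞, ∫⁻ _ in S, c = volume S * c := fun c => by
      rw [setLIntegral_const, mul_comm]
    -- One integrates first in whichever of `x`, `y` carries the coefficient at least `1/2`, so that
    -- the Jacobian never degenerates.
    rcases le_total t (1 / 2) with h2 | h2
    · rw [lintegral_lintegral_swap]
      · calc _ ≤ ∫⁻ y in S, 2 ^ n * ∫⁻ x in S, G x := by
              refine setLIntegral_mono_ae (by fun_prop) (Eventually.of_forall fun y hy => ?_)
              have := setLIntegral_homothety_le hconv hSm hG hy (s := 1 - t) (by linarith)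
                (by linarith [ht.1])
              simpa using this
          _ = _ := by rw [fin]; ring
      · exact Measurable.aemeasurable (hG.comp (Continuous.measurable (by fun_prop)))
    · calc _ ≤ ∫⁻ x in S, 2 ^ n * ∫⁻ x in S, G x := by
              refine setLIntegral_mono_ae (by fun_prop) (Eventually.of_forall fun x hx => ?_)
              have := setLIntegral_homothety_le hconv hSm hG hx (s := t) h2 ht.2
              simpa [add_comm] using this
          _ = _ := by rw [fin]; ring
  calc ∫⁻ x in S, ∫⁻ y in S, ENNReal.ofReal (φ (|f x - f y| / (2 * r)))
      ≤ ∫⁻ x in S, ∫⁻ y in S, ∫⁻ t in Icc (0 : ℝ) 1, G ((1 - t) • x + t • y) := by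
        refine setLIntegral_mono' hSm fun x hx => setLIntegral_mono' hSm fun y hy => pt x hx y hy
    _ = ∫⁻ x in S, ∫⁻ t in Icc (0 : ℝ) 1, ∫⁻ y in S, G ((1 - t) • x + t • y) := by
        refine lintegral_congr fun x => lintegral_lintegral_swap ?_
        exact Measurable.aemeasurable (hG.comp (Continuous.measurable (by fun_prop)))
    _ = ∫⁻ t in Icc (0 : ℝ) 1, ∫⁻ x in S, ∫⁻ y in S, G ((1 - t) • x + t • y) := by
        refine lintegral_lintegral_swap (Measurable.aemeasurable ?_)
        refine Measurable.lintegral_prod_right' (ν := volume.restrict S)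
          (f := fun p : (EuclideanSpace ℝ (Fin n) × ℝ) × EuclideanSpace ℝ (Fin n) =>
            G ((1 - p.1.2) • p.1.1 + p.1.2 • p.2)) ?_
        exact hG.comp (Continuous.measurable (by fun_prop))
    _ ≤ ∫⁻ t in Icc (0 : ℝ) 1, 2 ^ n * (volume S * ∫⁻ x in S, G x) :=
        setLIntegral_mono' measurableSet_Icc bound
    _ = _ := by simp

/-- On a strictly smaller ball, fine mollifications see `u` only where the cutoff is `1`, and Fatou
removes the mollification. The right-hand side already refers to the full ball, so `r` can
afterwards increase to `R`. -/
lemma HasWeakGradient.poincare_aux {q : ℕ} {φ : ℝ → ℝ} (h : IsGrowth q φ)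
    {u : EuclideanSpace ℝ (Fin n) → ℝ} {Du : EuclideanSpace ℝ (Fin n) → EuclideanSpace ℝ (Fin n)}
    {x₀ : EuclideanSpace ℝ (Fin n)} {R : ℝ} (hu : HasWeakGradient (Metric.ball x₀ R) u Du)
    {r : ℝ} (hr : 0 < r) (hrR : r < R) :
    ∫⁻ z in Metric.ball x₀ r ×ˢ Metric.ball x₀ r,
        ENNReal.ofReal (φ (|u z.1 - u z.2| / (2 * r))) ∂(volume.prod volume) ≤
      2 ^ n * (volume (Metric.ball x₀ R) *
        ∫⁻ x in Metric.ball x₀ R, ENNReal.ofReal (φ ‖Du x‖)) := by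
  obtain ⟨r', hrr', hr'R⟩ := exists_between hrR
  obtain ⟨ζ, hζ, hζc, hζs, hζ1⟩ := exists_smooth_cutoff (isCompact_closedBall x₀ r')
    Metric.isOpen_ball (Metric.closedBall_subset_ball hr'R)
  obtain ⟨hw, hwi, hgi⟩ := hu.cutoff_mul hζ hζc hζs
  set w := fun x => ζ x * u x with hwd
  set g := fun x => ζ x • Du x + u x • gradient ζ x with hgd
  have hz : ∀ x ∈ Metric.closedBall x₀ r', w x = u x ∧ g x = Du x := by
    intro x hx
    have h3 : ∀ᶠ y in 𝓝 x, ζ y = 1 := hζ1.filter_mono (nhds_le_nhdsSet hx)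
    have h4 : ζ =ᶠ[𝓝 x] fun _ => (1 : ℝ) := h3
    have h5 : gradient ζ x = 0 := by rw [gradient, h4.fderiv_eq]; simp
    simp [hwd, hgd, h3.self_of_nhds, h5]
  set S := Metric.ball x₀ r with hS
  have hSm : MeasurableSet S := Metric.isOpen_ball.measurableSet
  have hWs : ∀ j, ContDiff ℝ ((⊤ : ℕ∞) : WithTop ℕ∞) (moll (bumpSeq j) w) := fun j =>
    contDiff_moll _ hwi.locallyIntegrable
  set B : ℝ≥0∞ := 2 ^ n * (volume (Metric.ball x₀ R) *
        ∫⁻ x in Metric.ball x₀ R, ENNReal.ofReal (φ ‖Du x‖)) with hB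
  have hcont : Continuous fun t : ℝ => ENNReal.ofReal (φ (|t| / (2 * r))) := by
    have : Continuous fun t : ℝ => φ |t / (2 * r)| := h.continuous_abs.comp (by fun_prop)
    simp only [abs_div, abs_of_pos (by positivity : 0 < 2 * r)] at this
    exact ENNReal.continuous_ofReal.comp this
  have step : ∀ᶠ j in atTop, ∫⁻ z in S ×ˢ S, ENNReal.ofReal
      (φ (|moll (bumpSeq j) w z.1 - moll (bumpSeq j) w z.2| / (2 * r))) ∂(volume.prod volume)
      ≤ B := by
    have hsmall : ∀ᶠ j in atTop,
        (bumpSeq j : ContDiffBump (0 : EuclideanSpace ℝ (Fin n))).rOut < r' - r :=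
      bumpSeq_rOut_tendsto.eventually_lt_const (by linarith)
    filter_upwards [hsmall] with j hj
    rw [← Measure.prod_restrict, lintegral_prod]
    swap
    · have hc := (hWs j).continuous
      exact (hcont.comp ((hc.comp continuous_fst).sub (hc.comp continuous_snd))).measurable.aemeasurable
    refine (h.poincare_smooth ((hWs j).of_le (by simp)) x₀ hr).trans ?_
    rw [hB]
    gcongr 2 ^ n * (?_ * ?_)
    · exact measure_mono (Metric.ball_subset_ball hrR.le)
    · calc ∫⁻ x in S, ENNReal.ofReal (φ ‖fderiv ℝ (moll (bumpSeq j) w) x‖)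
          ≤ ∫⁻ x in S, ∫⁻ y, ENNReal.ofReal (φ ‖g (x - y)‖) ∂(mollMeasure (bumpSeq j)) :=
            lintegral_mono fun x => by
              simp only
              rw [norm_fderiv_moll hw]; exact h.ofReal_norm_moll_le (bumpSeq j) g x
        _ = ∫⁻ y, (∫⁻ x in (fun x => x + y) ⁻¹' S, ENNReal.ofReal (φ ‖g x‖))
              ∂(mollMeasure (bumpSeq j)) :=
            lintegral_lintegral_mollMeasure (g := fun x => ENNReal.ofReal (φ ‖g x‖)) _
              (h.aemeasurable_ofReal_norm hgi.1) hSm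
        _ ≤ ∫⁻ y, (∫⁻ x in Metric.ball x₀ R, ENNReal.ofReal (φ ‖Du x‖))
              ∂(mollMeasure (bumpSeq j)) := by
            refine lintegral_mono_ae ?_
            filter_upwards [compl_mem_ae_iff.2 (mollMeasure_compl_ball (bumpSeq j))] with y hy
            rw [compl_compl, Metric.mem_ball, dist_zero_right] at hy
            -- The mollification radius is below `r' - r`, so all translates involved stay in the
            -- ball where `g = Du`.
            have hsub : (fun x => x + y) ⁻¹' S ⊆ Metric.ball x₀ r' := by
              intro x hx
              rw [mem_preimage, hS, Metric.mem_ball] at hx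
              rw [Metric.mem_ball]
              have h1 := dist_triangle x (x + y) x₀
              have h2 : dist x (x + y) = ‖y‖ := by simp [dist_eq_norm]
              linarith
            calc ∫⁻ x in (fun x => x + y) ⁻¹' S, ENNReal.ofReal (φ ‖g x‖)
                ≤ ∫⁻ x in Metric.ball x₀ r', ENNReal.ofReal (φ ‖g x‖) := lintegral_mono_set hsub
              _ = ∫⁻ x in Metric.ball x₀ r', ENNReal.ofReal (φ ‖Du x‖) :=
                  setLIntegral_congr_fun Metric.isOpen_ball.measurableSet fun x hx => by
                    rw [(hz x (Metric.ball_subset_closedBall hx)).2]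
              _ ≤ _ := lintegral_mono_set (Metric.ball_subset_ball hr'R.le)
        _ = _ := by simp
  calc ∫⁻ z in S ×ˢ S, ENNReal.ofReal (φ (|u z.1 - u z.2| / (2 * r))) ∂(volume.prod volume)
      ≤ ∫⁻ z in S ×ˢ S, liminf (fun j => ENNReal.ofReal
          (φ (|moll (bumpSeq j) w z.1 - moll (bumpSeq j) w z.2| / (2 * r)))) atTop
          ∂(volume.prod volume) := by
        refine lintegral_mono_ae ?_
        have hae := moll_tendsto_ae hwi.locallyIntegrable
        have ae1 := (Measure.quasiMeasurePreserving_fst (μ := (volume : Measure (EuclideanSpace ℝ (Fin n)))) (ν := (volume : Measure (EuclideanSpace ℝ (Fin n))))).ae hae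
        have ae2 := (Measure.quasiMeasurePreserving_snd (μ := (volume : Measure (EuclideanSpace ℝ (Fin n)))) (ν := (volume : Measure (EuclideanSpace ℝ (Fin n))))).ae hae
        filter_upwards [ae_restrict_of_ae ae1, ae_restrict_of_ae ae2,
          ae_restrict_mem (hSm.prod hSm)] with z h1 h2 hzS
        have hsub : S ⊆ Metric.closedBall x₀ r' :=
          Metric.ball_subset_closedBall.trans (Metric.closedBall_subset_closedBall hrr'.le)
        have e1 := (hz z.1 (hsub hzS.1)).1
        have e2 := (hz z.2 (hsub hzS.2)).1
        have hl := (hcont.tendsto (w z.1 - w z.2)).comp (h1.sub h2)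
        rw [e1, e2] at hl
        exact hl.liminf_eq.ge
    _ ≤ liminf (fun j => ∫⁻ z in S ×ˢ S, ENNReal.ofReal
          (φ (|moll (bumpSeq j) w z.1 - moll (bumpSeq j) w z.2| / (2 * r)))
          ∂(volume.prod volume)) atTop := by
        refine lintegral_liminf_le fun j => ?_
        have hc := (hWs j).continuous
        exact (hcont.comp ((hc.comp continuous_fst).sub (hc.comp continuous_snd))).measurable
    _ ≤ B := by
        refine liminf_le_of_le (by isBoundedDefault) fun b hb => ?_
        obtain ⟨j, hj, hj'⟩ := (hb.and step).exists
        exact hj.trans hj'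

/-- The **Poincaré inequality** on balls, for growth functions. -/
lemma HasWeakGradient.poincare {q : ℕ} {φ : ℝ → ℝ} (h : IsGrowth q φ)
    {u : EuclideanSpace ℝ (Fin n) → ℝ} {Du : EuclideanSpace ℝ (Fin n) → EuclideanSpace ℝ (Fin n)}
    {x₀ : EuclideanSpace ℝ (Fin n)} {R : ℝ} (hR : 0 < R)
    (hu : HasWeakGradient (Metric.ball x₀ R) u Du) (hui : IntegrableOn u (Metric.ball x₀ R)) :
    ∫⁻ x in Metric.ball x₀ R,
        ENNReal.ofReal (φ (|u x - ⨍ y in Metric.ball x₀ R, u y| / R)) ≤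
      2 ^ (q + n) * ∫⁻ x in Metric.ball x₀ R, ENNReal.ofReal (φ ‖Du x‖) := by
  set S := Metric.ball x₀ R with hS
  have hSm : MeasurableSet S := Metric.isOpen_ball.measurableSet
  have hS0 : volume S ≠ 0 := (Metric.measure_ball_pos volume x₀ hR).ne'
  have hSt : volume S ≠ ∞ := measure_ball_lt_top.ne
  set I : ℝ≥0∞ := ∫⁻ x in S, ENNReal.ofReal (φ ‖Du x‖) with hI
  have hprod : ∫⁻ z in S ×ˢ S, ENNReal.ofReal (φ (|u z.1 - u z.2| / (2 * R)))
      ∂(volume.prod volume) ≤ 2 ^ n * (volume S * I) := by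
    -- Radii increasing to `R`; the products of the corresponding balls exhaust `S ×ˢ S`, and
    -- monotone convergence passes the bound to the limit.
    set rr : ℕ → ℝ := fun k => R * (1 - 1 / (k + 2)) with hrr
    have hr0 : ∀ k, 0 < rr k := fun k => by
      have : (1 : ℝ) / (k + 2) < 1 := by
        rw [div_lt_one (by positivity)]
        linarith [(Nat.cast_nonneg k : (0 : ℝ) ≤ k)]
      exact mul_pos hR (by linarith)
    have hrR : ∀ k, rr k < R := fun k => by
      have : (0 : ℝ) < 1 / (k + 2) := by positivity
      simp only [hrr]; nlinarith
    have hmono : Monotone rr := fun i j hij => by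
      have : (i : ℝ) ≤ j := by exact_mod_cast hij
      simp only [hrr]; gcongr
    have hun : S ×ˢ S = ⋃ k, Metric.ball x₀ (rr k) ×ˢ Metric.ball x₀ (rr k) := by
      ext z
      simp only [mem_iUnion, mem_prod, hS, Metric.mem_ball]
      constructor
      · rintro ⟨h1, h2⟩
        have hlim : Tendsto rr atTop (𝓝 R) := by
          have h3 : Tendsto (fun k : ℕ => (1 : ℝ) / (k + 2)) atTop (𝓝 0) := by
            have := (tendsto_add_atTop_iff_nat 1).2 (tendsto_one_div_add_atTop_nhds_zero_nat (𝕜 := ℝ))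
            refine this.congr fun k => ?_
            push_cast; ring
          have h4 := (h3.const_sub 1).const_mul R
          rwa [sub_zero, mul_one] at h4
        obtain ⟨k, hk1, hk2⟩ :=
          ((hlim.eventually_const_lt h1).and (hlim.eventually_const_lt h2)).exists
        exact ⟨k, hk1, hk2⟩
      · rintro ⟨k, h1, h2⟩
        exact ⟨h1.trans (hrR k), h2.trans (hrR k)⟩
    rw [hun, setLIntegral_iUnion_of_directed]
    · refine iSup_le fun k => ?_
      refine le_trans ?_ (hu.poincare_aux h (hr0 k) (hrR k))
      refine lintegral_mono fun z => ENNReal.ofReal_le_ofReal ?_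
      have := hr0 k
      exact h.le_of_le (by positivity) (by gcongr; exact (hrR k).le)
    · refine Monotone.directed_le fun i j hij => ?_
      exact prod_mono (Metric.ball_subset_ball (hmono hij)) (Metric.ball_subset_ball (hmono hij))
  have hgr : Continuous fun t : ℝ => ENNReal.ofReal (φ (|t| / (2 * R))) := by
    have : Continuous fun t : ℝ => φ |t / (2 * R)| := h.continuous_abs.comp (by fun_prop)
    simp only [abs_div, abs_of_pos (by positivity : 0 < 2 * R)] at this
    exact ENNReal.continuous_ofReal.comp this
  rw [← Measure.prod_restrict, lintegral_prod] at hprod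
  swap
  · have hm := hui.aemeasurable
    exact hgr.measurable.comp_aemeasurable (hm.comp_fst.sub hm.comp_snd)
  set ν : Measure (EuclideanSpace ℝ (Fin n)) := (volume S)⁻¹ • volume.restrict S with hν
  have hνp : IsProbabilityMeasure ν := ⟨by
    simp [hν, ENNReal.inv_mul_cancel hS0 hSt]⟩
  have hmean : ⨍ y in S, u y = ∫ y, u y ∂ν := by
    rw [average, hν]; simp
  have hiν : Integrable u ν := hui.smul_measure (ENNReal.inv_ne_top.2 hS0)
  have hgrow : IsGrowth q fun t => φ t := h
  -- Jensen with respect to the normalized measure replaces the mean by an average of differences;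
  -- the factor `2^q` is the price of passing from the scale `2R` to `R`.
  have jens : ∀ x, ENNReal.ofReal (φ (|u x - ⨍ y in S, u y| / R)) ≤
      2 ^ q * ((volume S)⁻¹ * ∫⁻ y in S, ENNReal.ofReal (φ (|u x - u y| / (2 * R)))) := by
    intro x
    have e1 : |u x - ⨍ y in S, u y| / (2 * R) = ‖∫ y, (u x - u y) / (2 * R) ∂ν‖ := by
      rw [integral_div, integral_sub (integrable_const _) hiν, hmean, norm_div,
        Real.norm_of_nonneg (by positivity : 0 ≤ 2 * R)]
      simp
    have e2 := h.ofReal_norm_integral_le ν (fun y => (u x - u y) / (2 * R))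
    rw [← e1] at e2
    simp only [norm_div, Real.norm_eq_abs, abs_of_pos (by positivity : 0 < 2 * R)] at e2
    rw [hν, lintegral_smul_measure, smul_eq_mul] at e2
    have e3 := h.doubling 2 (|u x - ⨍ y in S, u y| / (2 * R)) one_le_two (by positivity)
    have e4 : 2 * (|u x - ⨍ y in S, u y| / (2 * R)) = |u x - ⨍ y in S, u y| / R := by
      field_simp
    rw [e4] at e3
    refine (ENNReal.ofReal_le_ofReal e3).trans ?_
    rw [ENNReal.ofReal_mul (by positivity), ENNReal.ofReal_pow (by norm_num), ENNReal.ofReal_ofNat]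
    gcongr
  calc ∫⁻ x in S, ENNReal.ofReal (φ (|u x - ⨍ y in S, u y| / R))
      ≤ ∫⁻ x in S, 2 ^ q * ((volume S)⁻¹ *
          ∫⁻ y in S, ENNReal.ofReal (φ (|u x - u y| / (2 * R)))) := lintegral_mono jens
    _ = 2 ^ q * ((volume S)⁻¹ * ∫⁻ x in S,
          ∫⁻ y in S, ENNReal.ofReal (φ (|u x - u y| / (2 * R)))) := by
        rw [lintegral_const_mul' _ _ (by simp),
          lintegral_const_mul' _ _ (ENNReal.inv_ne_top.2 hS0)]
    _ ≤ 2 ^ q * ((volume S)⁻¹ * (2 ^ n * (volume S * I))) := by gcongr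
    _ = 2 ^ (q + n) * ((volume S)⁻¹ * volume S) * I := by rw [pow_add]; ring
    _ = _ := by rw [ENNReal.inv_mul_cancel hS0 hSt, mul_one]

end MultiPhase

/-! ### Energy of mollifications and essential supports. -/

namespace MultiPhase

variable {n : ℕ}

/-- The mollifier's density is at most a constant times `rOut^(-n)`, with a constant independent of
`j`. This is the scale against which the structural exponent `1/n` is calibrated. -/
lemma exists_mollMeasure_bound (n : ℕ) : ∃ C : ℝ≥0, ∀ (j : ℕ)
    (G : EuclideanSpace ℝ (Fin n) → ℝ≥0∞) (x : EuclideanSpace ℝ (Fin n)),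
    ∫⁻ y, G (x - y) ∂(mollMeasure (bumpSeq j)) ≤
      C * ENNReal.ofReal (((bumpSeq j : ContDiffBump (0 : EuclideanSpace ℝ (Fin n))).rOut ^ n)⁻¹) *
        ∫⁻ y, G y := by
  set v := volume.real (Metric.ball (0 : EuclideanSpace ℝ (Fin n)) 1) with hv
  have hv0 : 0 ≤ v := measureReal_nonneg
  refine ⟨Real.toNNReal (2 ^ n / v), fun j G x => ?_⟩
  set b : ContDiffBump (0 : EuclideanSpace ℝ (Fin n)) := bumpSeq j with hb
  have hbd : ∀ y, b.normed volume y ≤ 2 ^ n / v * (b.rOut ^ n)⁻¹ := by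
    intro y
    have h1 := b.normed_le_div_measure_closedBall_rOut volume 2 (bumpSeq_rOut_le j) y
    rw [finrank_euclideanSpace_fin, measureReal_def, Measure.addHaar_closedBall _ _ b.rOut_pos.le,
      finrank_euclideanSpace_fin, ENNReal.toReal_mul, ENNReal.toReal_ofReal
        (pow_nonneg b.rOut_pos.le n), ← measureReal_def, ← hv] at h1
    refine h1.trans (le_of_eq ?_)
    rw [div_mul_eq_div_div, div_right_comm, div_eq_mul_inv (2 ^ n / v)]
  calc ∫⁻ y, G (x - y) ∂(mollMeasure b)
      ≤ ∫⁻ y, ENNReal.ofReal (b.normed volume y) * G (x - y) :=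
        lintegral_withDensity_le_lintegral_mul _ b.continuous_normed.measurable.ennreal_ofReal _
    _ ≤ ∫⁻ y, ENNReal.ofReal (2 ^ n / v * (b.rOut ^ n)⁻¹) * G (x - y) := by
        gcongr with y; exact hbd y
    _ = ENNReal.ofReal (2 ^ n / v * (b.rOut ^ n)⁻¹) * ∫⁻ y, G y := by
        rw [lintegral_const_mul' _ _ ENNReal.ofReal_ne_top, lintegral_sub_left_eq_self]
    _ = _ := by
        rw [ENNReal.ofReal_mul (by positivity)]; rfl

section

variable {Ω : Set (EuclideanSpace ℝ (Fin n))} {q : ℕ} {K : ℝ}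
  {Ψ : EuclideanSpace ℝ (Fin n) → ℝ → ℝ} {Ψm : EuclideanSpace ℝ (Fin n) → ℝ → ℝ → ℝ}

lemma IsMultiPhase.aemeasurable_ofReal {F : Type*} [NormedAddCommGroup F]
    (hM : IsMultiPhase Ω q K Ψ Ψm) {f : EuclideanSpace ℝ (Fin n) → F}
    (hf : AEStronglyMeasurable f (volume.restrict Ω)) :
    AEMeasurable (fun x => ENNReal.ofReal (Ψ x ‖f x‖)) (volume.restrict Ω) :=
  (hM.aemeasurable (fun x => ‖f x‖) hf.norm.aemeasurable fun _ => norm_nonneg _).ennreal_ofReal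

/-- The absence of the Lavrentiev phenomenon: the energy density of a mollification is controlled by
the mollification of the energy density. -/
lemma IsMultiPhase.exists_moll_bound (hn : n ≠ 0) (hM : IsMultiPhase Ω q K Ψ Ψm) (hΩ : IsOpen Ω)
    {T : Set (EuclideanSpace ℝ (Fin n))} (hT : IsCompact T) (hTΩ : T ⊆ Ω)
    {g : EuclideanSpace ℝ (Fin n) → EuclideanSpace ℝ (Fin n)} (hg : ∀ x ∉ T, g x = 0)
    (hfin : ∫⁻ x in Ω, ENNReal.ofReal (Ψ x ‖g x‖) ≠ ∞) :
    ∃ M : ℝ≥0, ∀ᶠ j in atTop, ∀ x ∈ Ω, ENNReal.ofReal (Ψ x ‖moll (bumpSeq j) g x‖) ≤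
      M * ∫⁻ y, Ω.indicator (fun x => ENNReal.ofReal (Ψ x ‖g x‖)) (x - y)
        ∂(mollMeasure (bumpSeq j)) := by
  set G : EuclideanSpace ℝ (Fin n) → ℝ≥0∞ := Ω.indicator (fun x => ENNReal.ofReal (Ψ x ‖g x‖))
    with hG
  have hGA : ∫⁻ y, G y = ∫⁻ x in Ω, ENNReal.ofReal (Ψ x ‖g x‖) :=
    lintegral_indicator hΩ.measurableSet _
  set A : ℝ := (∫⁻ x in Ω, ENNReal.ofReal (Ψ x ‖g x‖)).toReal with hA
  have hGA' : ∫⁻ y, G y = ENNReal.ofReal A := by rw [hGA, hA, ENNReal.ofReal_toReal hfin]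
  obtain ⟨C, hC⟩ := exists_mollMeasure_bound n
  have hA0 : 0 ≤ A := ENNReal.toReal_nonneg
  have hK := hM.const_nonneg
  have hM0 : 0 ≤ K * (1 + (C * A) ^ (1 / (n : ℝ))) := by positivity
  refine ⟨Real.toNNReal (K * (1 + (C * A) ^ (1 / (n : ℝ)))), ?_⟩
  obtain ⟨d, hd0, hd⟩ := hT.exists_thickening_subset_open hΩ hTΩ
  have hsmall : ∀ᶠ j in atTop,
      (bumpSeq j : ContDiffBump (0 : EuclideanSpace ℝ (Fin n))).rOut < min (d / 2) 1 :=
    bumpSeq_rOut_tendsto.eventually_lt_const (by positivity)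
  filter_upwards [hsmall] with j hj x hx
  set b : ContDiffBump (0 : EuclideanSpace ℝ (Fin n)) := bumpSeq j with hb
  have hδ0 : 0 < b.rOut := b.rOut_pos
  have hδ1 : b.rOut ≤ 1 := (hj.trans_le (min_le_right _ _)).le
  have hδd : b.rOut < d / 2 := hj.trans_le (min_le_left _ _)
  by_cases hmeet : ∃ z ∈ T, z ∈ Metric.ball x b.rOut
  swap
  · have : moll b g x = 0 := moll_eq_zero b fun y hy => hg y fun hyT => hmeet ⟨y, hyT, hy⟩
    simp [this, (hM.growth x hx).zero]
  obtain ⟨z, hzT, hz⟩ := hmeet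
  have hball : Metric.ball x b.rOut ⊆ Ω := by
    intro y hy
    refine hd (Metric.mem_thickening_iff.2 ⟨z, hzT, ?_⟩)
    rw [Metric.mem_ball] at hy hz
    have := dist_triangle_right y z x
    linarith
  have hφ := hM.growth_minus x b.rOut hδ0 hball
  set φ := Ψm x b.rOut with hφd
  set t := ‖moll b g x‖ with ht
  have ht0 : 0 ≤ t := norm_nonneg _
  -- Jensen needs an integrand not depending on the point, so it is applied to `Ψ^-` of the ball of
  -- the mollification radius, which lies below `Ψ` there.
  have h1 : ENNReal.ofReal (φ t) ≤ ∫⁻ y, G (x - y) ∂(mollMeasure b) := by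
    refine (hφ.ofReal_norm_moll_le b g x).trans (lintegral_mono_ae ?_)
    filter_upwards [compl_mem_ae_iff.2 (mollMeasure_compl_ball b)] with y hy
    rw [compl_compl, Metric.mem_ball, dist_zero_right] at hy
    have hxy : x - y ∈ Metric.ball x b.rOut := by
      simpa [Metric.mem_ball, dist_eq_norm] using hy
    rw [hG, indicator_of_mem (hball hxy)]
    exact ENNReal.ofReal_le_ofReal (hM.minus_le x _ hball _ hxy _ (norm_nonneg _))
  -- Total energy `A` and density bound together give `rOut φ(t)^(1/n) ≤ (C A)^(1/n)`. So the factor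
  -- by which `Ψ x` may exceed `φ` at this scale stays bounded as the radius tends to `0`.
  have h2 : φ t ≤ C * A * (b.rOut ^ n)⁻¹ := by
    have h3 := h1.trans (hC j G x)
    rw [hGA', ← ENNReal.ofReal_coe_nnreal, ← ENNReal.ofReal_mul C.coe_nonneg,
      ← ENNReal.ofReal_mul (by positivity)] at h3
    have h4 := (ENNReal.ofReal_le_ofReal_iff (by positivity)).1 h3
    linarith
  have hφt : 0 ≤ φ t := hφ.nonneg ht0
  have h5 : b.rOut * (φ t) ^ (1 / (n : ℝ)) ≤ (C * A) ^ (1 / (n : ℝ)) := by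
    have h6 : (φ t) ^ (1 / (n : ℝ)) ≤ (C * A * (b.rOut ^ n)⁻¹) ^ (1 / (n : ℝ)) := by gcongr
    have h7 : (C * A * (b.rOut ^ n)⁻¹) ^ (1 / (n : ℝ)) = (C * A) ^ (1 / (n : ℝ)) * b.rOut⁻¹ := by
      rw [Real.mul_rpow (by positivity) (by positivity), ← inv_pow, one_div,
        Real.pow_rpow_inv_natCast (by positivity) hn]
    rw [h7] at h6
    calc b.rOut * (φ t) ^ (1 / (n : ℝ)) ≤ b.rOut * ((C * A) ^ (1 / (n : ℝ)) * b.rOut⁻¹) := by gcongr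
      _ = _ := by field_simp
  have h8 := hM.le_minus x b.rOut hδ0 hδ1 hball x (Metric.mem_ball_self hδ0) t ht0
  have h9 : Ψ x t ≤ K * (1 + (C * A) ^ (1 / (n : ℝ))) * φ t := by
    refine h8.trans ?_
    gcongr
  calc ENNReal.ofReal (Ψ x t) ≤ ENNReal.ofReal (K * (1 + (C * A) ^ (1 / (n : ℝ))) * φ t) :=
        ENNReal.ofReal_le_ofReal h9
    _ = ENNReal.ofReal (K * (1 + (C * A) ^ (1 / (n : ℝ)))) * ENNReal.ofReal (φ t) :=
        ENNReal.ofReal_mul hM0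
    _ ≤ _ := by
        change _ ≤ ENNReal.ofReal (K * (1 + (C * A) ^ (1 / (n : ℝ)))) * _
        gcongr

end

section EssSupport

variable {Ω : Set (EuclideanSpace ℝ (Fin n))} {w : EuclideanSpace ℝ (Fin n) → ℝ}

lemma essSupport_subset_of_eq_zero {F : Set (EuclideanSpace ℝ (Fin n))} (hF : IsClosed F)
    (h : ∀ x ∉ F, w x = 0) : essSupport Ω w ⊆ F := by
  intro x hx
  by_contra hxF
  refine hx.2 Fᶜ (hF.isOpen_compl.mem_nhds hxF) ?_
  filter_upwards [ae_restrict_mem hF.isOpen_compl.measurableSet] with y hy using h y hy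

lemma isCompact_essSupport {T : Set (EuclideanSpace ℝ (Fin n))} (hT : IsCompact T) (hTΩ : T ⊆ Ω)
    (h : ∀ x ∉ T, w x = 0) : IsCompact (essSupport Ω w) := by
  have hsub := essSupport_subset_of_eq_zero (Ω := Ω) hT.isClosed h
  refine hT.of_isClosed_subset ?_ hsub
  rw [← isOpen_compl_iff, isOpen_iff_mem_nhds]
  intro x hx
  by_cases hxT : x ∈ T
  · have : ¬ ∀ U ∈ 𝓝 x, ¬ ∀ᵐ y ∂(volume.restrict U), w y = 0 := fun h' => hx ⟨hTΩ hxT, h'⟩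
    push Not at this
    obtain ⟨U, hU, hwU⟩ := this
    filter_upwards [interior_mem_nhds.2 hU] with y hy hy'
    exact hy'.2 U (mem_interior_iff_mem_nhds.1 hy) hwU
  · filter_upwards [hT.isClosed.isOpen_compl.mem_nhds hxT] with y hy hy'
    exact hy (hsub hy')

/-- By definition each point off the support has a neighbourhood on which `w` vanishes almost
everywhere, and in a second countable space a locally null set is null. -/
lemma ae_eq_zero_of_notMem_essSupport : ∀ᵐ x, x ∈ Ω → x ∉ essSupport Ω w → w x = 0 := by
  rw [ae_iff]
  refine measure_null_of_locally_null _ fun x hx => ?_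
  simp only [mem_ofPred_eq, Classical.not_imp] at hx
  obtain ⟨hxΩ, hxS, -⟩ := hx
  have : ¬ ∀ U ∈ 𝓝 x, ¬ ∀ᵐ y ∂(volume.restrict U), w y = 0 := fun h' => hxS ⟨hxΩ, h'⟩
  push Not at this
  obtain ⟨U, hU, hwU⟩ := this
  refine ⟨interior U ∩ {y | w y ≠ 0}, ?_, ?_⟩
  · refine inter_mem (mem_nhdsWithin_of_mem_nhds (interior_mem_nhds.2 hU)) ?_
    filter_upwards [self_mem_nhdsWithin] with y hy
    simp only [Classical.not_imp] at hy
    exact hy.2.2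
  · have h1 := ae_restrict_of_ae_restrict_of_subset (interior_subset (s := U)) hwU
    rw [ae_restrict_iff' isOpen_interior.measurableSet, ae_iff] at h1
    refine measure_mono_null (fun y hy => ?_) h1
    simpa [Classical.not_imp] using hy

end EssSupport

end MultiPhase

/-! ### Minimality on the positivity set of a perturbation. -/

namespace MultiPhase

variable {n : ℕ} {Ω : Set (EuclideanSpace ℝ (Fin n))} {q : ℕ} {K Q : ℝ}
  {Ψ : EuclideanSpace ℝ (Fin n) → ℝ → ℝ} {Ψm : EuclideanSpace ℝ (Fin n) → ℝ → ℝ → ℝ}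
  {u : EuclideanSpace ℝ (Fin n) → ℝ} {Du : EuclideanSpace ℝ (Fin n) → EuclideanSpace ℝ (Fin n)}

/-- The minimality inequality on any closed set containing the support of the perturbation. -/
lemma IsLocalQMinimizer.energy_le_of_closed (hmin : IsLocalQMinimizer Ω Ψ Q u Du) (hQ : 1 ≤ Q)
    (hΩ : IsOpen Ω) {w : EuclideanSpace ℝ (Fin n) → ℝ}
    {g : EuclideanSpace ℝ (Fin n) → EuclideanSpace ℝ (Fin n)}
    (hw : HasWeakGradient Ω w g) {T F : Set (EuclideanSpace ℝ (Fin n))} (hT : IsCompact T)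
    (hTΩ : T ⊆ Ω) (hwT : ∀ x ∉ T, w x = 0) (hF : IsClosed F) (hwF : ∀ x ∉ F, w x = 0)
    (hg : ∀ x, w x = 0 → g x = 0) :
    energy Ψ Du (F ∩ Ω) ≤ ENNReal.ofReal Q * energy Ψ (fun x => Du x - g x) (F ∩ Ω) := by
  set v := fun x => u x - w x with hv
  have huv : u - v = w := by funext x; simp [hv]
  have hS := isCompact_essSupport hT hTΩ hwT
  have hSF := essSupport_subset_of_eq_zero (Ω := Ω) hF hwF
  have key := hmin.minimal v (fun x => Du x - g x) (hmin.hasWeakGradient.sub hw)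
    (by rw [huv]; exact hS)
  rw [huv] at key
  set S := essSupport Ω w with hSd
  have hSm : MeasurableSet S := hS.isClosed.measurableSet
  have hSsub : S ⊆ F ∩ Ω := fun x hx => ⟨hSF hx, hx.1⟩
  have hFm : MeasurableSet (F ∩ Ω) := hF.measurableSet.inter hΩ.measurableSet
  -- Off the support `w` vanishes almost everywhere, hence so does `g`; the two energies agree there
  -- and, as `Q ≥ 1`, may be added to both sides.
  have e1 : energy Ψ Du ((F ∩ Ω) \ S) = energy Ψ (fun x => Du x - g x) ((F ∩ Ω) \ S) := by
    refine setLIntegral_congr_fun_ae (hFm.diff hSm) ?_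
    filter_upwards [ae_eq_zero_of_notMem_essSupport (Ω := Ω) (w := w)] with x hx hxF
    simp [hg x (hx hxF.1.2 hxF.2)]
  have hsplit : ∀ D : EuclideanSpace ℝ (Fin n) → EuclideanSpace ℝ (Fin n),
      energy Ψ D (F ∩ Ω) = energy Ψ D S + energy Ψ D ((F ∩ Ω) \ S) := by
    intro D
    simp only [energy]
    rw [← lintegral_inter_add_sdiff _ (F ∩ Ω) hSm, inter_eq_self_of_subset_right hSsub]
  have hQ1 : 1 ≤ ENNReal.ofReal Q := by rw [← ENNReal.ofReal_one]; exact ENNReal.ofReal_le_ofReal hQ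
  rw [hsplit Du, hsplit (fun x => Du x - g x), e1, mul_add]
  gcongr
  exact le_mul_of_one_le_left zero_le hQ1

/-- The minimality inequality on the set where a nonnegative perturbation does not vanish. -/
theorem IsLocalQMinimizer.energy_pos_le (hn : n ≠ 0) (hmin : IsLocalQMinimizer Ω Ψ Q u Du)
    (hQ : 1 ≤ Q) (hM : IsMultiPhase Ω q K Ψ Ψm)
    (hΩ : IsOpen Ω) {w : EuclideanSpace ℝ (Fin n) → ℝ}
    {g : EuclideanSpace ℝ (Fin n) → EuclideanSpace ℝ (Fin n)}
    (hw : HasWeakGradient univ w g) (hwi : Integrable w) (hgi : Integrable g)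
    {T : Set (EuclideanSpace ℝ (Fin n))} (hT : IsCompact T)
    (hTΩ : T ⊆ Ω) (hwT : ∀ x ∉ T, w x = 0) (hw0 : ∀ x, 0 ≤ w x)
    (hg : ∀ x, w x = 0 → g x = 0) (hfin : energy Ψ g Ω ≠ ∞) :
    energy Ψ Du (Ω ∩ {x | 0 < w x}) ≤
      ENNReal.ofReal Q * energy Ψ (fun x => Du x - g x) (Ω ∩ {x | 0 < w x}) := by
  have hΩm := hΩ.measurableSet
  have hDum : AEStronglyMeasurable Du (volume.restrict Ω) :=
    hmin.hasWeakGradient.locInt_grad.aestronglyMeasurable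
  set G : EuclideanSpace ℝ (Fin n) → ℝ≥0∞ := Ω.indicator (fun x => ENNReal.ofReal (Ψ x ‖g x‖))
    with hG
  have hGm : AEMeasurable G := (aemeasurable_indicator_iff hΩm).2
    (hM.aemeasurable_ofReal hgi.1.restrict)
  have hGfin : ∫⁻ x, G x ≠ ∞ := by rw [hG, lintegral_indicator hΩm]; exact hfin
  obtain ⟨M, hMb⟩ := hM.exists_moll_bound hn hΩ hT hTΩ
    (fun x hx => hg x (hwT x hx)) hfin
  have hwc : HasCompactSupport w := HasCompactSupport.intro hT hwT
  -- All mollifiers have radius at most `1`, so every mollification of `w` vanishes outside this one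
  -- compact set; its finite measure turns almost everywhere convergence into convergence in
  -- measure.
  set L := Metric.cthickening 1 T with hL
  have hLc : IsCompact L := hT.cthickening
  have hTL : T ⊆ L := Metric.self_subset_cthickening _
  have hVm : ∀ j x, ∀ _ : x ∉ L, moll (bumpSeq j) w x = 0 := by
    intro j x hx
    refine moll_eq_zero _ fun y hy => hwT y fun hyT => hx ?_
    refine Metric.mem_cthickening_of_dist_le x y 1 T hyT ?_
    have h1 : (bumpSeq j : ContDiffBump (0 : EuclideanSpace ℝ (Fin n))).rOut ≤ 1 := by
      simp only [bumpSeq]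
      rw [div_le_one (by positivity)]
      linarith [(Nat.cast_nonneg j : (0 : ℝ) ≤ j)]
    rw [Metric.mem_ball'] at hy
    linarith
  set c : ℝ≥0∞ := ENNReal.ofReal Q * (8 ^ q * (2 + M)) + 1 with hc
  have hctop : c ≠ ∞ := by
    rw [hc]
    refine ENNReal.add_ne_top.2 ⟨ENNReal.mul_ne_top ENNReal.ofReal_ne_top
      (ENNReal.mul_ne_top (by simp) (by simp)), by simp⟩
  -- The truncated perturbation differs from `w` only on a small set, where all energies involved
  -- are at most multiples of `η`; the constant `c` does not depend on `η`, so the error disappears.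
  suffices hmain : ∀ η : ℝ≥0∞, η ≠ 0 → energy Ψ Du (Ω ∩ {x | 0 < w x}) ≤
      ENNReal.ofReal Q * energy Ψ (fun x => Du x - g x) (Ω ∩ {x | 0 < w x}) + c * η by
    have hlim : Tendsto (fun m : ℕ => ENNReal.ofReal Q * energy Ψ (fun x => Du x - g x)
        (Ω ∩ {x | 0 < w x}) + c * ((m : ℝ≥0∞))⁻¹) atTop (𝓝 (ENNReal.ofReal Q *
        energy Ψ (fun x => Du x - g x) (Ω ∩ {x | 0 < w x}) + c * 0)) :=
      tendsto_const_nhds.add (ENNReal.Tendsto.const_mul ENNReal.tendsto_inv_nat_nhds_zero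
        (Or.inr hctop))
    rw [mul_zero, add_zero] at hlim
    exact ge_of_tendsto' hlim fun m => hmain _ (by simp)
  intro η hη
  -- uniform absolute continuity of the energies
  obtain ⟨δ₁, hδ₁, h₁⟩ := exists_pos_setLIntegral_lt_of_measure_lt (μ := volume.restrict Ω)
    (f := fun x => ENNReal.ofReal (Ψ x ‖Du x‖)) hmin.energy_lt_top.ne hη
  obtain ⟨δ₂, hδ₂, h₂⟩ := exists_pos_setLIntegral_lt_of_measure_lt (μ := volume.restrict Ω)
    (f := fun x => ENNReal.ofReal (Ψ x ‖g x‖)) hfin hη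
  obtain ⟨δ₃, hδ₃, h₃⟩ := setLIntegral_mollMeasure_lt hGm hGfin hη
  set δ := min δ₁ (min δ₂ δ₃) with hδ
  have hδ0 : 0 < δ := lt_min hδ₁ (lt_min hδ₂ hδ₃)
  -- The sets `{0 < w < 3ε}` decrease to the empty set and have finite measure, being contained in
  -- `T`.
  obtain ⟨ε, hε, hε1⟩ : ∃ ε : ℝ, 0 < ε ∧ volume {x | 0 < w x ∧ w x < 3 * ε} < δ / 2 := by
    set s : ℕ → Set (EuclideanSpace ℝ (Fin n)) :=
      fun m => {x | 0 < w x ∧ w x < 3 * (1 / ((m : ℝ) + 1))} with hs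
    have hsm : ∀ m, NullMeasurableSet (s m) := fun m =>
      (nullMeasurableSet_lt aemeasurable_const hwi.aemeasurable).inter
        (nullMeasurableSet_lt hwi.aemeasurable aemeasurable_const)
    have hanti : Antitone s := by
      intro i j hij x hx
      have : (i : ℝ) ≤ j := by exact_mod_cast hij
      refine ⟨hx.1, hx.2.trans_le ?_⟩
      gcongr
    have hfin0 : volume (s 0) ≠ ∞ := by
      refine ((measure_mono fun x hx => ?_).trans_lt hT.measure_lt_top).ne
      by_contra hxT
      exact hx.1.ne' (hwT x hxT)
    have hl := tendsto_measure_iInter_atTop hsm hanti ⟨0, hfin0⟩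
    have hemp : ⋂ m, s m = ∅ := by
      ext x
      simp only [mem_iInter, mem_empty_iff_false, iff_false, not_forall]
      by_cases hx : 0 < w x
      · obtain ⟨m, hm⟩ := exists_nat_one_div_lt (show 0 < w x / 3 by positivity)
        exact ⟨m, fun h => by have := h.2; linarith⟩
      · exact ⟨0, fun h => hx h.1⟩
    rw [hemp, measure_empty] at hl
    obtain ⟨m, hm⟩ := (hl.eventually_lt_const (ENNReal.half_pos hδ0.ne')).exists
    exact ⟨1 / ((m : ℝ) + 1), by positivity, hm⟩
  have hLm : MeasurableSet L := hLc.isClosed.measurableSet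
  obtain ⟨j, hj1, hj2⟩ : ∃ j, volume {x | ε / 2 ≤ dist (moll (bumpSeq j) w x) (w x)} < δ / 2 ∧
      ∀ x ∈ Ω, ENNReal.ofReal (Ψ x ‖moll (bumpSeq j) g x‖) ≤
        M * ∫⁻ y, G (x - y) ∂(mollMeasure (bumpSeq j)) := by
    have : IsFiniteMeasure (volume.restrict L) := ⟨by simpa using hLc.measure_lt_top⟩
    have hTM := tendstoInMeasure_of_tendsto_ae (μ := volume.restrict L)
      (f := fun j => moll (bumpSeq j) w) (g := w)
      (fun j => (contDiff_moll _ hwi.locallyIntegrable).continuous.aestronglyMeasurable)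
      (ae_restrict_of_ae (moll_tendsto_ae hwi.locallyIntegrable))
    rw [tendstoInMeasure_iff_dist] at hTM
    have h4 := (hTM (ε / 2) (by positivity)).eventually_lt_const (ENNReal.half_pos hδ0.ne')
    obtain ⟨j, h5, h6⟩ := (h4.and hMb).exists
    refine ⟨j, ?_, h6⟩
    rw [Measure.restrict_apply' hLm] at h5
    have hsub : {x | ε / 2 ≤ dist (moll (bumpSeq j) w x) (w x)} ⊆
        {x | ε / 2 ≤ dist (moll (bumpSeq j) w x) (w x)} ∩ L := fun x hx => ⟨hx, ?_⟩
    · exact (measure_mono hsub).trans_lt h5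
    by_contra hxL
    have hx' : ε / 2 ≤ dist (moll (bumpSeq j) w x) (w x) := hx
    rw [hVm j x hxL, hwT x fun h => hxL (hTL h), dist_self] at hx'
    linarith
  set f := moll (bumpSeq j) w with hf
  have hfs : ContDiff ℝ ((⊤ : ℕ∞) : WithTop ℕ∞) f := contDiff_moll _ hwi.locallyIntegrable
  set E₀ := {x | 0 < w x ∧ w x < 3 * ε} ∪ {x | ε / 2 ≤ dist (f x) (w x)} with hE₀
  set E := toMeasurable volume E₀ with hE
  have hEm : MeasurableSet E := measurableSet_toMeasurable _ _
  have hEδ : volume E < δ := by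
    rw [hE, measure_toMeasurable]
    calc volume E₀ ≤ _ := measure_union_le _ _
      _ < δ / 2 + δ / 2 := ENNReal.add_lt_add hε1 hj1
      _ = δ := ENNReal.add_halves δ
  -- Off `E`, `|f - w| < ε/2` and either `w = 0` or `w ≥ 3ε`. In the second case `2 (f - ε) ≥ 2w -
  -- 3ε ≥ w`, which explains the factors `3` and `2`: the truncation leaves `w` unchanged.
  have hnE : ∀ x, x ∉ E → (w x = 0 ∧ f x < ε) ∨ (0 < w x ∧ ε ≤ f x ∧ w x ≤ 2 * max (f x - ε) 0) := by
    intro x hx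
    have hx0 : x ∉ E₀ := fun h => hx (subset_toMeasurable _ _ h)
    simp only [hE₀, mem_union, mem_ofPred_eq, not_or, not_and, not_lt, not_le, Real.dist_eq] at hx0
    obtain ⟨ha, hb⟩ := hx0
    rw [abs_lt] at hb
    rcases (hw0 x).eq_or_lt with h0 | h0
    · left; exact ⟨h0.symm, by linarith⟩
    · right
      have := ha h0
      refine ⟨h0, by linarith, ?_⟩
      have := le_max_left (f x - ε) 0
      linarith
  -- the competitor
  set h : EuclideanSpace ℝ (Fin n) → ℝ := fun x => 2 * max (f x - ε) 0 with hh
  set Dh : EuclideanSpace ℝ (Fin n) → EuclideanSpace ℝ (Fin n) :=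
    fun x => (2 : ℝ) • (if 0 < f x - ε then gradient f x else 0) with hDh
  have hhg : HasWeakGradient univ h Dh :=
    (((HasWeakGradient.of_smooth hfs).sub_const ε).posPart isOpen_univ).const_mul 2
  -- This is `min w h`, written as `w - (w - h)_+` so that the rule for positive parts supplies its
  -- gradient.
  set w' : EuclideanSpace ℝ (Fin n) → ℝ := fun x => w x - max (w x - h x) 0 with hw'
  set g' : EuclideanSpace ℝ (Fin n) → EuclideanSpace ℝ (Fin n) :=
    fun x => g x - (if 0 < w x - h x then g x - Dh x else 0) with hg'
  have hw'g : HasWeakGradient univ w' g' := hw.sub ((hw.sub hhg).posPart isOpen_univ)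
  have hh0 : ∀ x, 0 ≤ h x := fun x => by
    have := le_max_right (f x - ε) 0
    simp only [hh]; linarith
  have hw'min : ∀ x, w' x = min (w x) (h x) := fun x => by
    simp only [hw']
    rcases le_total (w x) (h x) with hx | hx
    · rw [max_eq_right (by linarith), min_eq_left hx, sub_zero]
    · rw [max_eq_left (by linarith), min_eq_right hx]; ring
  have hg'0 : ∀ x, w' x = 0 → g' x = 0 := by
    intro x hx
    rw [hw'min] at hx
    rcases (hw0 x).eq_or_lt with h0 | h0
    · have : ¬ (0 < w x - h x) := by have := hh0 x; linarith
      simp only [hg', this, if_false, sub_zero]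
      exact hg x h0.symm
    · have hhx : h x = 0 := by
        rcases min_choice (w x) (h x) with h5 | h5 <;> rw [h5] at hx
        · exact absurd hx h0.ne'
        · exact hx
      have h6 : 0 < w x - h x := by linarith
      have h7 : ¬ (0 < f x - ε) := by
        intro h8
        have : 0 < h x := by simp only [hh, max_eq_left h8.le]; linarith
        linarith
      simp only [hg', hDh, h6, h7, if_true, if_false, smul_zero, sub_zero, sub_self]
  -- Continuity of `f` makes `F` closed, so it contains the support of `w'`; within `Ω` and outside
  -- `E` it coincides with `{w > 0}`.
  set F := {x | ε ≤ f x} with hF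
  have hFc : IsClosed F := isClosed_le continuous_const hfs.continuous
  have step := hmin.energy_le_of_closed hQ hΩ (hw'g.mono (subset_univ Ω)) hT hTΩ
    (fun x hx => by rw [hw'min, hwT x hx]; exact min_eq_left (hh0 x)) hFc
    (fun x hx => by
      have h5 : f x - ε ≤ 0 := by
        have : ¬ (ε ≤ f x) := hx
        linarith
      have h6 : h x = 0 := by simp only [hh, max_eq_right h5, mul_zero]
      rw [hw'min, h6]; exact min_eq_right (hw0 x)) hg'0
  -- The mollified gradient enters because `g'` can equal the gradient of `2 (f - ε)_+`. Two
  -- splittings of sums and one doubling give `2^q` three times.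
  have hbound : ∀ x ∈ Ω, ENNReal.ofReal (Ψ x ‖Du x - g' x‖) ≤ 8 ^ q * (ENNReal.ofReal (Ψ x ‖Du x‖) +
      ENNReal.ofReal (Ψ x ‖g x‖) + ENNReal.ofReal (Ψ x ‖moll (bumpSeq j) g x‖)) := by
    intro x hx
    have hgr := hM.growth x hx
    set m := moll (bumpSeq j) g x with hm
    have hgm : ‖gradient f x‖ = ‖m‖ := by
      rw [gradient, LinearIsometryEquiv.norm_map, norm_fderiv_moll hw]
    have h5 : ‖Du x - g' x‖ ≤ ‖Du x‖ + (‖g x‖ + 2 * ‖m‖) := by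
      refine (norm_sub_le _ _).trans (add_le_add le_rfl ?_)
      have hDhx : ‖Dh x‖ ≤ 2 * ‖m‖ := by
        simp only [hDh]
        rw [norm_smul, Real.norm_of_nonneg (by norm_num : (0 : ℝ) ≤ 2)]
        gcongr
        split_ifs
        · exact hgm.le
        · simp
      simp only [hg']
      split_ifs
      · rw [sub_sub_cancel]; exact hDhx.trans (by linarith [norm_nonneg (g x)])
      · rw [sub_zero]; linarith [norm_nonneg m]
    have p1 := hgr.nonneg (norm_nonneg (Du x))
    have p2 := hgr.nonneg (norm_nonneg (g x))
    have p3 := hgr.nonneg (norm_nonneg m)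
    have h6 : Ψ x ‖Du x - g' x‖ ≤ 8 ^ q * (Ψ x ‖Du x‖ + Ψ x ‖g x‖ + Ψ x ‖m‖) := by
      calc Ψ x ‖Du x - g' x‖ ≤ Ψ x (‖Du x‖ + (‖g x‖ + 2 * ‖m‖)) := hgr.le_of_le (norm_nonneg _) h5
        _ ≤ 2 ^ q * (Ψ x ‖Du x‖ + Ψ x (‖g x‖ + 2 * ‖m‖)) :=
            hgr.map_add_le (norm_nonneg _) (by positivity)
        _ ≤ 2 ^ q * (Ψ x ‖Du x‖ + 2 ^ q * (Ψ x ‖g x‖ + Ψ x (2 * ‖m‖))) := by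
            gcongr; exact hgr.map_add_le (norm_nonneg _) (by positivity)
        _ ≤ 2 ^ q * (Ψ x ‖Du x‖ + 2 ^ q * (Ψ x ‖g x‖ + 2 ^ q * Ψ x ‖m‖)) := by
            gcongr; exact hgr.doubling 2 _ one_le_two (norm_nonneg _)
        _ ≤ 2 ^ q * (2 ^ q * 2 ^ q * Ψ x ‖Du x‖ +
              2 ^ q * (2 ^ q * Ψ x ‖g x‖ + 2 ^ q * Ψ x ‖m‖)) := by
            have h2 : (1 : ℝ) ≤ 2 ^ q := one_le_pow₀ one_le_two
            gcongr
            · exact le_mul_of_one_le_left p1 (one_le_mul_of_one_le_of_one_le h2 h2)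
            · exact le_mul_of_one_le_left p2 h2
        _ = _ := by
            have : (8 : ℝ) ^ q = 2 ^ q * 2 ^ q * 2 ^ q := by rw [← mul_pow, ← mul_pow]; norm_num
            rw [this]; ring
    refine (ENNReal.ofReal_le_ofReal h6).trans ?_
    rw [ENNReal.ofReal_mul (by positivity), ENNReal.ofReal_pow (by norm_num),
      ENNReal.ofReal_add (by positivity) p3, ENNReal.ofReal_add p1 p2, ENNReal.ofReal_ofNat]
  have hEΩ : ∀ k : EuclideanSpace ℝ (Fin n) → ℝ≥0∞, ∫⁻ x in E ∩ Ω, k x =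
      ∫⁻ x in E, k x ∂(volume.restrict Ω) := fun k => by rw [Measure.restrict_restrict hEm]
  have hEr : volume.restrict Ω E ≤ volume E := Measure.restrict_apply_le _ _
  have b1 : ∫⁻ x in E ∩ Ω, ENNReal.ofReal (Ψ x ‖Du x‖) ≤ η := by
    rw [hEΩ]
    exact (h₁ E (hEr.trans_lt (hEδ.trans_le (min_le_left _ _)))).le
  have b2 : ∫⁻ x in E ∩ Ω, ENNReal.ofReal (Ψ x ‖g x‖) ≤ η := by
    rw [hEΩ]
    exact (h₂ E (hEr.trans_lt (hEδ.trans_le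
      ((min_le_right _ _).trans (min_le_left _ _))))).le
  have b3 : ∫⁻ x in E ∩ Ω, ENNReal.ofReal (Ψ x ‖moll (bumpSeq j) g x‖) ≤ M * η := by
    calc _ ≤ ∫⁻ x in E ∩ Ω, M * ∫⁻ y, G (x - y) ∂(mollMeasure (bumpSeq j)) :=
          setLIntegral_mono' (hEm.inter hΩm) fun x hx => hj2 x hx.2
      _ = M * ∫⁻ x in E ∩ Ω, ∫⁻ y, G (x - y) ∂(mollMeasure (bumpSeq j)) :=
          lintegral_const_mul' _ _ ENNReal.coe_ne_top
      _ ≤ M * η := by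
          gcongr
          exact h₃ _ _ (hEm.inter hΩm) ((measure_mono inter_subset_left).trans_lt
            (hEδ.trans_le ((min_le_right _ _).trans (min_le_right _ _))))
  have b4 : ∫⁻ x in E ∩ Ω, ENNReal.ofReal (Ψ x ‖Du x - g' x‖) ≤ 8 ^ q * (2 + M) * η := by
    have m1 : AEMeasurable (fun x => ENNReal.ofReal (Ψ x ‖Du x‖)) (volume.restrict (E ∩ Ω)) :=
      (hM.aemeasurable_ofReal hDum).mono_set inter_subset_right
    have m2 : AEMeasurable (fun x => ENNReal.ofReal (Ψ x ‖g x‖)) (volume.restrict (E ∩ Ω)) :=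
      (hM.aemeasurable_ofReal hgi.1.restrict).mono_set inter_subset_right
    have m12 : AEMeasurable (fun x => ENNReal.ofReal (Ψ x ‖Du x‖) + ENNReal.ofReal (Ψ x ‖g x‖))
        (volume.restrict (E ∩ Ω)) := m1.add m2
    calc _ ≤ ∫⁻ x in E ∩ Ω, 8 ^ q * (ENNReal.ofReal (Ψ x ‖Du x‖) +
            ENNReal.ofReal (Ψ x ‖g x‖) + ENNReal.ofReal (Ψ x ‖moll (bumpSeq j) g x‖)) :=
          setLIntegral_mono' (hEm.inter hΩm) fun x hx => hbound x hx.2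
      _ ≤ 8 ^ q * (η + η + M * η) := by
          rw [lintegral_const_mul' _ _ (by simp), lintegral_add_left' m12,
            lintegral_add_left' m1]
          gcongr
      _ = _ := by ring
  have c1 : energy Ψ Du (Ω ∩ {x | 0 < w x}) ≤ energy Ψ Du (F ∩ Ω) + η := by
    calc energy Ψ Du (Ω ∩ {x | 0 < w x}) ≤ energy Ψ Du ((F ∩ Ω) ∪ (E ∩ Ω)) := by
          refine lintegral_mono_set fun x hx => ?_
          by_cases hxE : x ∈ E
          · exact Or.inr ⟨hxE, hx.1⟩
          · rcases hnE x hxE with h5 | h5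
            · exact absurd h5.1 (ne_of_gt hx.2)
            · exact Or.inl ⟨h5.2.1, hx.1⟩
      _ ≤ energy Ψ Du (F ∩ Ω) + energy Ψ Du (E ∩ Ω) := lintegral_union_le _ _ _
      _ ≤ _ := by gcongr; exact b1
  have c2 : energy Ψ (fun x => Du x - g' x) (F ∩ Ω) ≤
      energy Ψ (fun x => Du x - g x) (Ω ∩ {x | 0 < w x}) + 8 ^ q * (2 + M) * η := by
    calc energy Ψ (fun x => Du x - g' x) (F ∩ Ω)
        ≤ energy Ψ (fun x => Du x - g' x) (((F ∩ Ω) \ E) ∪ (E ∩ Ω)) := by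
          refine lintegral_mono_set fun x hx => ?_
          by_cases hxE : x ∈ E
          · exact Or.inr ⟨hxE, hx.2⟩
          · exact Or.inl ⟨hx, hxE⟩
      _ ≤ energy Ψ (fun x => Du x - g' x) ((F ∩ Ω) \ E) +
          energy Ψ (fun x => Du x - g' x) (E ∩ Ω) := lintegral_union_le _ _ _
      _ ≤ _ := by
          refine add_le_add ?_ b4
          have hFE : MeasurableSet ((F ∩ Ω) \ E) :=
            (hFc.measurableSet.inter hΩm).diff hEm
          have hcase : ∀ x ∈ (F ∩ Ω) \ E, 0 < w x ∧ w x ≤ h x := by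
            intro x hx
            rcases hnE x hx.2 with h5 | h5
            · exact absurd h5.2 (not_lt.2 hx.1.1)
            · exact ⟨h5.1, h5.2.2⟩
          calc energy Ψ (fun x => Du x - g' x) ((F ∩ Ω) \ E)
              = energy Ψ (fun x => Du x - g x) ((F ∩ Ω) \ E) := by
                refine setLIntegral_congr_fun hFE fun x hx => ?_
                have : ¬ (0 < w x - h x) := by linarith [(hcase x hx).2]
                simp only [hg', this, if_false, sub_zero]
            _ ≤ _ := lintegral_mono_set (show (F ∩ Ω) \ E ⊆ Ω ∩ {x | 0 < w x} from
                fun x hx => ⟨hx.1.2, (hcase x hx).1⟩)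
  calc energy Ψ Du (Ω ∩ {x | 0 < w x}) ≤ energy Ψ Du (F ∩ Ω) + η := c1
    _ ≤ ENNReal.ofReal Q * (energy Ψ (fun x => Du x - g x) (Ω ∩ {x | 0 < w x}) +
        8 ^ q * (2 + M) * η) + η := by
        refine add_le_add (step.trans ?_) le_rfl
        gcongr
    _ = _ := by rw [hc]; ring

end MultiPhase

/-! ### Cutoff functions and hole filling. -/

namespace MultiPhase

lemma exists_deriv_smoothTransition_bound :
    ∃ C : ℝ, 0 < C ∧ ∀ x, |deriv Real.smoothTransition x| ≤ C ∧
      (x < 0 → deriv Real.smoothTransition x = 0) := by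
  have hs : ContDiff ℝ 1 Real.smoothTransition := Real.smoothTransition.contDiff (n := 1)
  have hc : Continuous (deriv Real.smoothTransition) := hs.continuous_deriv le_rfl
  have h0 : ∀ x, x < 0 → deriv Real.smoothTransition x = 0 := by
    intro x hx
    have : Real.smoothTransition =ᶠ[𝓝 x] fun _ => (0 : ℝ) := by
      filter_upwards [Iio_mem_nhds hx] with y hy
      exact Real.smoothTransition.zero_of_nonpos (le_of_lt hy)
    rw [this.deriv_eq]; simp
  have h1 : ∀ x, 1 < x → deriv Real.smoothTransition x = 0 := by
    intro x hx
    have : Real.smoothTransition =ᶠ[𝓝 x] fun _ => (1 : ℝ) := by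
      filter_upwards [Ioi_mem_nhds hx] with y hy
      exact Real.smoothTransition.one_of_one_le (le_of_lt hy)
    rw [this.deriv_eq]; simp
  obtain ⟨C, hC⟩ := (isCompact_Icc (a := (0 : ℝ)) (b := 1)).exists_bound_of_continuousOn
    hc.continuousOn
  refine ⟨max C 1, by positivity, fun x => ⟨?_, h0 x⟩⟩
  rcases lt_or_ge x 0 with hx | hx
  · rw [h0 x hx]; simp
  rcases lt_or_ge 1 x with hx' | hx'
  · rw [h1 x hx']; simp
  exact (hC x ⟨hx, hx'⟩).trans (le_max_left _ _)

/-- Smooth cutoff functions between concentric balls, with the natural gradient bound. -/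
lemma exists_radial_cutoff : ∃ C : ℝ, 1 ≤ C ∧ ∀ (n : ℕ) (x₀ : EuclideanSpace ℝ (Fin n)) (s t : ℝ),
    0 < s → s < t → ∃ η : EuclideanSpace ℝ (Fin n) → ℝ,
      ContDiff ℝ ((⊤ : ℕ∞) : WithTop ℕ∞) η ∧ (∀ x, 0 ≤ η x ∧ η x ≤ 1) ∧
      (∀ x ∈ Metric.closedBall x₀ s, η x = 1) ∧ tsupport η ⊆ Metric.closedBall x₀ t ∧
      (∀ x, ‖gradient η x‖ ≤ C / (t - s)) ∧ ∀ x, η x = 0 → gradient η x = 0 := by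
  obtain ⟨C₀, hC₀, hb⟩ := exists_deriv_smoothTransition_bound
  refine ⟨max 1 (2 * C₀), le_max_left _ _, fun n x₀ s t hs hst => ?_⟩
  have hd : 0 < t ^ 2 - s ^ 2 := by nlinarith
  -- Squared norms keep the profile smooth at the centre; as `t² - s² = (t - s)(t + s)`, the
  -- gradient is still of order `1 / (t - s)`.
  set p : EuclideanSpace ℝ (Fin n) → ℝ := fun x => (t ^ 2 - ‖x - x₀‖ ^ 2) / (t ^ 2 - s ^ 2) with hp
  have hps : ContDiff ℝ ((⊤ : ℕ∞) : WithTop ℕ∞) p := by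
    refine ContDiff.div_const (contDiff_const.sub ?_) _
    exact (contDiff_id.sub contDiff_const).norm_sq ℝ
  set η : EuclideanSpace ℝ (Fin n) → ℝ := fun x => Real.smoothTransition (p x) with hη
  have hηs : ContDiff ℝ ((⊤ : ℕ∞) : WithTop ℕ∞) η :=
    (Real.smoothTransition.contDiff (n := ⊤)).comp hps
  have h01 : ∀ x, 0 ≤ η x ∧ η x ≤ 1 := fun x =>
    ⟨Real.smoothTransition.nonneg _, Real.smoothTransition.le_one _⟩
  refine ⟨η, hηs, h01, ?_, ?_, ?_, ?_⟩
  · intro x hx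
    rw [mem_closedBall_iff_norm] at hx
    refine Real.smoothTransition.one_of_one_le ?_
    rw [hp, one_le_div hd]
    nlinarith [norm_nonneg (x - x₀)]
  · refine closure_minimal ?_ Metric.isClosed_closedBall
    intro x hx
    by_contra h
    rw [mem_closedBall_iff_norm, not_le] at h
    refine hx (Real.smoothTransition.zero_of_nonpos ?_)
    refine div_nonpos_of_nonpos_of_nonneg ?_ hd.le
    nlinarith
  · intro x
    have hst' : 0 < t - s := sub_pos.2 hst
    have hpd : HasFDerivAt p ((-(2 / (t ^ 2 - s ^ 2))) • innerSL ℝ (x - x₀)) x := by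
      have h1 : HasFDerivAt (fun x : EuclideanSpace ℝ (Fin n) => ‖x - x₀‖ ^ 2)
          ((2 : ℝ) • innerSL ℝ (x - x₀)) x := by
        have := ((hasFDerivAt_id x).sub_const x₀).norm_sq
        rw [← Nat.cast_smul_eq_nsmul ℝ] at this
        simpa using this
      have h2 := ((hasFDerivAt_const (t ^ 2) x).sub h1).const_mul ((t ^ 2 - s ^ 2)⁻¹)
      have h3 : (-(2 / (t ^ 2 - s ^ 2))) • innerSL ℝ (x - x₀) =
          (t ^ 2 - s ^ 2)⁻¹ • (0 - (2 : ℝ) • innerSL ℝ (x - x₀)) := by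
        rw [zero_sub, ← neg_smul, smul_smul]; congr 1; ring
      have h4 : p = fun x => (t ^ 2 - s ^ 2)⁻¹ * (t ^ 2 - ‖x - x₀‖ ^ 2) := by
        funext y; simp only [hp, div_eq_inv_mul]
      rw [h3, h4]
      exact h2
    have hηd : HasFDerivAt η (deriv Real.smoothTransition (p x) •
        ((-(2 / (t ^ 2 - s ^ 2))) • innerSL ℝ (x - x₀))) x := by
      have hsd : DifferentiableAt ℝ Real.smoothTransition (p x) :=
        (Real.smoothTransition.contDiff (n := 1)).differentiable (by simp) _
      exact hsd.hasDerivAt.comp_hasFDerivAt x hpd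
    rw [gradient, LinearIsometryEquiv.norm_map, hηd.fderiv, norm_smul, norm_smul,
      innerSL_apply_norm, Real.norm_eq_abs, Real.norm_eq_abs, abs_neg,
      abs_of_pos (div_pos two_pos hd)]
    have hle : C₀ * (2 * t / (t ^ 2 - s ^ 2)) ≤ max 1 (2 * C₀) / (t - s) := by
      have h3 : C₀ * (2 * t / (t ^ 2 - s ^ 2)) = (2 * C₀) / (t - s) * (t / (t + s)) := by
        have : t ^ 2 - s ^ 2 = (t - s) * (t + s) := by ring
        have h5 : t + s ≠ 0 := by linarith
        rw [this]; field_simp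
      have h4 : t / (t + s) ≤ 1 := by rw [div_le_one (by linarith)]; linarith
      rw [h3]
      calc (2 * C₀) / (t - s) * (t / (t + s)) ≤ (2 * C₀) / (t - s) * 1 := by gcongr
        _ ≤ _ := by rw [mul_one]; gcongr; exact le_max_right _ _
    rcases le_or_gt ‖x - x₀‖ t with hx | hx
    · refine le_trans ?_ hle
      have e : |deriv Real.smoothTransition (p x)| * (2 / (t ^ 2 - s ^ 2) * ‖x - x₀‖) =
          |deriv Real.smoothTransition (p x)| * (2 * ‖x - x₀‖ / (t ^ 2 - s ^ 2)) := by ring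
      rw [e]
      gcongr
      exact (hb _).1
    · rw [(hb (p x)).2 (div_neg_of_neg_of_pos (by nlinarith) hd)]
      simp
      positivity
  · intro x hx
    -- A zero of a nonnegative function is a minimum, so the gradient vanishes there.
    have hmin : IsLocalMin η x := Eventually.of_forall fun y => by rw [hx]; exact (h01 y).1
    rw [gradient, hmin.fderiv_eq_zero]
    simp

/-- Unrolling `N` times leaves `θ^N f N`, which vanishes in the limit because `f` is bounded, plus a
geometric series of ratio `θ b`. The result carries information when `θ b < 1`. -/
lemma le_of_geometric_recursion {f : ℕ → ℝ≥0∞} {θ b A M : ℝ≥0∞} (hθ : θ < 1)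
    (hM : M ≠ ∞) (hf : ∀ i, f i ≤ M) (h : ∀ i, f i ≤ θ * f (i + 1) + A * b ^ i) :
    f 0 ≤ A * (1 - θ * b)⁻¹ := by
  have step : ∀ N : ℕ, f 0 ≤ θ ^ N * f N + A * ∑ i ∈ Finset.range N, (θ * b) ^ i := by
    intro N
    induction N with
    | zero => simp
    | succ N ih =>
      refine ih.trans ?_
      calc _ ≤ θ ^ N * (θ * f (N + 1) + A * b ^ N) + A * ∑ i ∈ Finset.range N, (θ * b) ^ i := by
            gcongr; exact h N
        _ = _ := by rw [Finset.sum_range_succ, mul_pow]; ring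
  have step' : ∀ N : ℕ, f 0 ≤ θ ^ N * M + A * (1 - θ * b)⁻¹ := by
    intro N
    refine (step N).trans ?_
    gcongr
    · exact hf N
    · rw [← ENNReal.tsum_geometric]; exact ENNReal.sum_le_tsum _
  have hlim : Tendsto (fun N : ℕ => θ ^ N * M + A * (1 - θ * b)⁻¹) atTop
      (𝓝 (0 * M + A * (1 - θ * b)⁻¹)) :=
    (ENNReal.Tendsto.mul_const (ENNReal.tendsto_pow_atTop_nhds_zero_of_lt_one hθ)
      (Or.inr hM)).add tendsto_const_nhds
  rw [zero_mul, zero_add] at hlim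
  exact ge_of_tendsto' hlim step'

end MultiPhase

/-! ### The Caccioppoli inequality. -/

namespace MultiPhase

section

variable {n : ℕ} {Ω : Set (EuclideanSpace ℝ (Fin n))} {q : ℕ} {K Q : ℝ}
  {Ψ : EuclideanSpace ℝ (Fin n) → ℝ → ℝ} {Ψm : EuclideanSpace ℝ (Fin n) → ℝ → ℝ → ℝ}
  {u : EuclideanSpace ℝ (Fin n) → ℝ} {Du : EuclideanSpace ℝ (Fin n) → EuclideanSpace ℝ (Fin n)}

lemma ofReal_map_mul_le {φ : ℝ → ℝ} (h : IsGrowth q φ) {c t : ℝ} (hc : 1 ≤ c) (ht : 0 ≤ t) :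
    ENNReal.ofReal (φ (c * t)) ≤ ENNReal.ofReal c ^ q * ENNReal.ofReal (φ t) := by
  rw [← ENNReal.ofReal_pow (by linarith), ← ENNReal.ofReal_mul (by positivity)]
  exact ENNReal.ofReal_le_ofReal (h.doubling c t hc ht)

lemma ofReal_map_le_of_le_add {φ : ℝ → ℝ} (h : IsGrowth q φ) {r s t : ℝ} (hr : 0 ≤ r)
    (hs : 0 ≤ s) (ht : 0 ≤ t) (hrst : r ≤ s + t) :
    ENNReal.ofReal (φ r) ≤ 2 ^ q * (ENNReal.ofReal (φ s) + ENNReal.ofReal (φ t)) := by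
  rw [← ENNReal.ofReal_add (h.nonneg hs) (h.nonneg ht),
    show (2 : ℝ≥0∞) = ENNReal.ofReal 2 by simp, ← ENNReal.ofReal_pow (by norm_num),
    ← ENNReal.ofReal_mul (by positivity)]
  exact ENNReal.ofReal_le_ofReal ((h.le_of_le hr hrst).trans (h.map_add_le hs ht))

/-- One step of the Caccioppoli estimate, before the hole filling. -/
lemma IsLocalQMinimizer.caccioppoli_step {C₁ : ℝ} (hC₁ : 1 ≤ C₁)
    (hcut : ∀ (x₀ : EuclideanSpace ℝ (Fin n)) (s t : ℝ),
      0 < s → s < t → ∃ η : EuclideanSpace ℝ (Fin n) → ℝ,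
      ContDiff ℝ ((⊤ : ℕ∞) : WithTop ℕ∞) η ∧ (∀ x, 0 ≤ η x ∧ η x ≤ 1) ∧
      (∀ x ∈ Metric.closedBall x₀ s, η x = 1) ∧ tsupport η ⊆ Metric.closedBall x₀ t ∧
      (∀ x, ‖gradient η x‖ ≤ C₁ / (t - s)) ∧ ∀ x, η x = 0 → gradient η x = 0)
    (hn : n ≠ 0) (hmin : IsLocalQMinimizer Ω Ψ Q u Du)
    (hQ : 1 ≤ Q) (hM : IsMultiPhase Ω q K Ψ Ψm) (hΩ : IsOpen Ω)
    {x₀ : EuclideanSpace ℝ (Fin n)} {s t ρ d : ℝ} (k : ℝ) (hs : 0 < s) (hst : s < t) (htρ : t < ρ)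
    (hd : t - s ≤ d) (hball : Metric.ball x₀ ρ ⊆ Ω)
    (hfin : ∫⁻ x in Metric.ball x₀ ρ, ENNReal.ofReal (Ψ x (max (u x - k) 0 / d)) ≠ ∞) :
    ∫⁻ x in Metric.closedBall x₀ s ∩ {x | k < u x}, ENNReal.ofReal (Ψ x ‖Du x‖) ≤
      ENNReal.ofReal Q * (2 ^ q *
        ((∫⁻ x in (Metric.closedBall x₀ t ∩ {x | k < u x}) \ Metric.closedBall x₀ s,
          ENNReal.ofReal (Ψ x ‖Du x‖)) +
        ENNReal.ofReal (C₁ * d / (t - s)) ^ q *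
          ∫⁻ x in Metric.ball x₀ ρ, ENNReal.ofReal (Ψ x (max (u x - k) 0 / d)))) := by
  obtain ⟨η, hη, h01, hη1, hηs, hηg, hη0⟩ := hcut x₀ s t hs hst
  have hts : 0 < t - s := sub_pos.2 hst
  have hd0 : 0 < d := hts.trans_le hd
  have htρ' : Metric.closedBall x₀ t ⊆ Metric.ball x₀ ρ := Metric.closedBall_subset_ball htρ
  have htΩ := htρ'.trans hball
  have hcpt : IsCompact (Metric.closedBall x₀ t) := isCompact_closedBall x₀ t
  have hηc : HasCompactSupport η := hcpt.of_isClosed_subset (isClosed_tsupport η) hηs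
  have hv := (hmin.hasWeakGradient.sub_const k).posPart hΩ
  obtain ⟨hw, hwi, hgi⟩ := hv.cutoff_mul hη hηc (hηs.trans htΩ)
  set v : EuclideanSpace ℝ (Fin n) → ℝ := fun x => max (u x - k) 0 with hvd
  set Dv : EuclideanSpace ℝ (Fin n) → EuclideanSpace ℝ (Fin n) :=
    fun x => if 0 < u x - k then Du x else 0 with hDv
  set w : EuclideanSpace ℝ (Fin n) → ℝ := fun x => η x * v x with hwd
  set g : EuclideanSpace ℝ (Fin n) → EuclideanSpace ℝ (Fin n) :=
    fun x => η x • Dv x + v x • gradient η x with hgd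
  have hv0 : ∀ x, 0 ≤ v x := fun x => le_max_right _ _
  have hw0 : ∀ x, 0 ≤ w x := fun x => mul_nonneg (h01 x).1 (hv0 x)
  have hηT : ∀ x ∉ Metric.closedBall x₀ t, η x = 0 := fun x hx =>
    image_eq_zero_of_notMem_tsupport fun h => hx (hηs h)
  have hwT : ∀ x ∉ Metric.closedBall x₀ t, w x = 0 := fun x hx => by simp [hwd, hηT x hx]
  have hg0 : ∀ x, w x = 0 → g x = 0 := by
    intro x hx
    rcases mul_eq_zero.1 hx with h | h
    · simp [hgd, h, hη0 x h]
    · have h1 : ¬ (0 < u x - k) := by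
        intro h'
        have : v x = u x - k := max_eq_left h'.le
        linarith
      simp only [hgd, hDv, h, h1, if_false, smul_zero, zero_smul, add_zero]
  set P : EuclideanSpace ℝ (Fin n) → ℝ≥0∞ :=
    fun x => ENNReal.ofReal (Ψ x (C₁ / (t - s) * v x)) with hP
  -- Doubling is available only for factors at least `1`; this is why the scale `d` must dominate `t
  -- - s`.
  have hc1 : 1 ≤ C₁ * d / (t - s) := by
    rw [le_div_iff₀ hts]; nlinarith
  have hPint : ∫⁻ x in Metric.ball x₀ ρ, P x ≤ ENNReal.ofReal (C₁ * d / (t - s)) ^ q *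
      ∫⁻ x in Metric.ball x₀ ρ, ENNReal.ofReal (Ψ x (v x / d)) := by
    rw [← lintegral_const_mul' _ _ (by simp)]
    refine setLIntegral_mono' measurableSet_ball fun x hx => ?_
    have e : C₁ / (t - s) * v x = (C₁ * d / (t - s)) * (v x / d) := by field_simp
    rw [hP]
    simp only
    rw [e]
    exact ofReal_map_mul_le (hM.growth x (hball hx)) hc1 (div_nonneg (hv0 x) hd0.le)
  have hvg : ∀ x, ‖v x • gradient η x‖ ≤ C₁ / (t - s) * v x := by
    intro x
    rw [norm_smul, Real.norm_eq_abs, abs_of_nonneg (hv0 x), mul_comm]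
    exact mul_le_mul_of_nonneg_right (hηg x) (hv0 x)
  have hcv : ∀ x, 0 ≤ C₁ / (t - s) * v x := fun x =>
    mul_nonneg (div_nonneg (by linarith) hts.le) (hv0 x)
  have hDum : AEStronglyMeasurable Du (volume.restrict Ω) :=
    hmin.hasWeakGradient.locInt_grad.aestronglyMeasurable
  -- Finite energy of the perturbation itself is what makes its mollifications uniformly integrable
  -- in energy.
  have hgfin : energy Ψ g Ω ≠ ∞ := by
    have h1 : energy Ψ g Ω ≤ ∫⁻ x in Ω, 2 ^ q * (ENNReal.ofReal (Ψ x ‖Du x‖) +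
        (Metric.closedBall x₀ t).indicator P x) := by
      refine setLIntegral_mono' hΩ.measurableSet fun x hx => ?_
      have hgr := hM.growth x hx
      by_cases hxt : x ∈ Metric.closedBall x₀ t
      · rw [indicator_of_mem hxt]
        refine ofReal_map_le_of_le_add hgr (norm_nonneg _) (norm_nonneg _) (hcv x) ?_
        refine (norm_add_le _ _).trans (add_le_add ?_ (hvg x))
        rw [norm_smul, Real.norm_eq_abs, abs_of_nonneg (h01 x).1]
        have h2 : ‖Dv x‖ ≤ ‖Du x‖ := by simp only [hDv]; split_ifs <;> simp
        calc η x * ‖Dv x‖ ≤ 1 * ‖Du x‖ :=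
              mul_le_mul (h01 x).2 h2 (norm_nonneg _) zero_le_one
          _ = _ := one_mul _
      · rw [hg0 x (hwT x hxt)]
        simp [hgr.zero]
    refine ne_top_of_le_ne_top ?_ h1
    rw [lintegral_const_mul' _ _ (by simp), lintegral_add_left' (hM.aemeasurable_ofReal hDum),
      setLIntegral_indicator measurableSet_closedBall]
    refine ENNReal.mul_ne_top (by simp) (ENNReal.add_ne_top.2 ⟨hmin.energy_lt_top.ne, ?_⟩)
    have h2 : ∫⁻ x in Metric.closedBall x₀ t ∩ Ω, P x ≤ ∫⁻ x in Metric.ball x₀ ρ, P x :=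
      lintegral_mono_set (inter_subset_left.trans htρ')
    exact ne_top_of_le_ne_top (ENNReal.mul_ne_top (by simp) hfin) (h2.trans hPint)
  have key := hmin.energy_pos_le hn hQ hM hΩ hw hwi hgi hcpt htΩ hwT hw0 hg0 hgfin
  set S := Ω ∩ {x | 0 < w x} with hS
  have hSm : NullMeasurableSet S := hΩ.measurableSet.nullMeasurableSet.inter
    (nullMeasurableSet_lt aemeasurable_const hwi.aemeasurable)
  have hSA : S ⊆ Metric.closedBall x₀ t ∩ {x | k < u x} := by
    intro x hx
    refine ⟨by_contra fun h => hx.2.ne' (hwT x h), ?_⟩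
    by_contra h
    have h1 : v x = 0 := max_eq_right (by simp only [mem_ofPred_eq, not_lt] at h; linarith)
    have h2 : w x = 0 := by simp [hwd, h1]
    exact hx.2.ne' h2
  have hle1 : ∫⁻ x in Metric.closedBall x₀ s ∩ {x | k < u x}, ENNReal.ofReal (Ψ x ‖Du x‖) ≤
      energy Ψ Du S := by
    refine lintegral_mono_set fun x hx => ?_
    refine ⟨htΩ (Metric.closedBall_subset_closedBall hst.le hx.1), ?_⟩
    have h1 : 0 < v x := lt_max_of_lt_left (sub_pos.2 hx.2)
    simpa [hwd, hη1 x hx.1] using h1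
  refine hle1.trans (key.trans ?_)
  gcongr
  -- On `S` one has `Du - g = (1 - η) Du - v Dη`; since `1 - η` vanishes on the inner ball, the
  -- energy of `Du` reappears only on the annulus.
  have hpt : ∀ x ∈ S, ENNReal.ofReal (Ψ x ‖Du x - g x‖) ≤ 2 ^ q *
      ((Metric.closedBall x₀ s)ᶜ.indicator (fun x => ENNReal.ofReal (Ψ x ‖Du x‖)) x + P x) := by
    intro x hx
    have hgr := hM.growth x hx.1
    have hDx : Dv x = Du x := by
      have : 0 < u x - k := sub_pos.2 (hSA hx).2
      simp only [hDv, this, if_true]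
    have e : Du x - g x = (1 - η x) • Du x - v x • gradient η x := by
      simp only [hgd, hDx, sub_smul, one_smul]; abel
    have hle : ‖Du x - g x‖ ≤ (1 - η x) * ‖Du x‖ + C₁ / (t - s) * v x := by
      rw [e]
      refine (norm_sub_le _ _).trans (add_le_add ?_ (hvg x))
      rw [norm_smul, Real.norm_eq_abs, abs_of_nonneg (by linarith [(h01 x).2])]
    have h1 := ofReal_map_le_of_le_add hgr (norm_nonneg _)
      (mul_nonneg (by linarith [(h01 x).2]) (norm_nonneg _)) (hcv x) hle
    refine h1.trans ?_
    gcongr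
    by_cases hxs : x ∈ Metric.closedBall x₀ s
    · simp [hη1 x hxs, hgr.zero]
    · rw [indicator_of_mem (show x ∈ (Metric.closedBall x₀ s)ᶜ from hxs)]
      refine ENNReal.ofReal_le_ofReal (hgr.le_of_le
        (mul_nonneg (by linarith [(h01 x).2]) (norm_nonneg _)) ?_)
      nlinarith [norm_nonneg (Du x), (h01 x).1]
  have hDuS : AEMeasurable (fun x => ENNReal.ofReal (Ψ x ‖Du x‖)) (volume.restrict S) :=
    (hM.aemeasurable_ofReal hDum).mono_set inter_subset_left
  calc energy Ψ (fun x => Du x - g x) S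
      ≤ ∫⁻ x in S, 2 ^ q * ((Metric.closedBall x₀ s)ᶜ.indicator
          (fun x => ENNReal.ofReal (Ψ x ‖Du x‖)) x + P x) :=
        lintegral_mono_ae ((ae_restrict_iff'₀ hSm).2 (Eventually.of_forall hpt))
    _ = 2 ^ q * ((∫⁻ x in (Metric.closedBall x₀ s)ᶜ ∩ S, ENNReal.ofReal (Ψ x ‖Du x‖)) +
          ∫⁻ x in S, P x) := by
        rw [lintegral_const_mul' _ _ (by simp), lintegral_add_left'
          (hDuS.indicator measurableSet_closedBall.compl),
          setLIntegral_indicator measurableSet_closedBall.compl]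
    _ ≤ _ := by
        gcongr
        · exact fun x hx => ⟨hSA hx.2, hx.1⟩
        · exact (lintegral_mono_set fun x hx => htρ' (hSA hx).1).trans hPint

end

/-- The Caccioppoli inequality on superlevel sets. -/
theorem exists_caccioppoli_const {n : ℕ} (hn : n ≠ 0) (q : ℕ) {Q : ℝ} (hQ : 1 ≤ Q) :
    ∃ C : ℝ≥0, ∀ {Ω : Set (EuclideanSpace ℝ (Fin n))} {K : ℝ}
      {Ψ : EuclideanSpace ℝ (Fin n) → ℝ → ℝ} {Ψm : EuclideanSpace ℝ (Fin n) → ℝ → ℝ → ℝ}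
      {u : EuclideanSpace ℝ (Fin n) → ℝ}
      {Du : EuclideanSpace ℝ (Fin n) → EuclideanSpace ℝ (Fin n)},
      IsLocalQMinimizer Ω Ψ Q u Du → IsMultiPhase Ω q K Ψ Ψm → IsOpen Ω →
      ∀ (x₀ : EuclideanSpace ℝ (Fin n)) (r ρ k : ℝ), 0 < r → r < ρ → Metric.ball x₀ ρ ⊆ Ω →
      ∫⁻ x in Metric.ball x₀ ρ, ENNReal.ofReal (Ψ x (max (u x - k) 0 / (ρ - r))) ≠ ∞ →
      ∫⁻ x in Metric.closedBall x₀ r ∩ {x | k < u x}, ENNReal.ofReal (Ψ x ‖Du x‖) ≤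
        C * ∫⁻ x in Metric.ball x₀ ρ, ENNReal.ofReal (Ψ x (max (u x - k) 0 / (ρ - r))) := by
  obtain ⟨C₁, hC₁, hcut⟩ := exists_radial_cutoff
  set θ₀ : ℝ := Q * 2 ^ q with hθ₀
  have hθ₀0 : 0 < θ₀ := by positivity
  -- Hole filling: adding `θ₀ f i` to both sides turns the annulus into the larger ball and leaves a
  -- contraction factor.
  set θ : ℝ := θ₀ / (1 + θ₀) with hθ
  have hθ0 : 0 < θ := by positivity
  have hθ1 : θ < 1 := by rw [hθ, div_lt_one (by positivity)]; linarith
  -- Radii approach `ρ` at rate `τ^i`, which inflates the error terms by `τ^(-q i)`. The exponent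
  -- `1/(q + 1)` ensures `θ τ^(-q) < 1`.
  set τ : ℝ := θ ^ (((q + 1 : ℕ) : ℝ))⁻¹ with hτ
  have hτ0 : 0 < τ := Real.rpow_pos_of_pos hθ0 _
  have hτ1 : τ < 1 := Real.rpow_lt_one hθ0.le hθ1 (by positivity)
  have hτq : θ < τ ^ q := by
    have h1 : τ ^ (q + 1) = θ := Real.rpow_inv_natCast_pow hθ0.le (by simp)
    rw [← h1]
    exact pow_lt_pow_right_of_lt_one₀ hτ0 hτ1 (by simp)
  have hratio : ENNReal.ofReal θ * ENNReal.ofReal (1 / τ ^ q) < 1 := by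
    rw [← ENNReal.ofReal_mul hθ0.le, ENNReal.ofReal_lt_one, mul_one_div, div_lt_one (by positivity)]
    exact hτq
  have htop : ENNReal.ofReal (C₁ / (1 - τ)) ^ q *
      (1 - ENNReal.ofReal θ * ENNReal.ofReal (1 / τ ^ q))⁻¹ ≠ ∞ :=
    ENNReal.mul_ne_top (by simp) (ENNReal.inv_ne_top.2 (tsub_pos_of_lt hratio).ne')
  refine ⟨(ENNReal.ofReal (C₁ / (1 - τ)) ^ q *
      (1 - ENNReal.ofReal θ * ENNReal.ofReal (1 / τ ^ q))⁻¹).toNNReal, ?_⟩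
  intro Ω K Ψ Ψm u Du hmin hM hΩ x₀ r ρ k hr hrρ hball hfin
  rw [ENNReal.coe_toNNReal htop]
  set D := ∫⁻ x in Metric.ball x₀ ρ, ENNReal.ofReal (Ψ x (max (u x - k) 0 / (ρ - r))) with hD
  set t : ℕ → ℝ := fun i => ρ - (ρ - r) * τ ^ i with ht
  set f : ℕ → ℝ≥0∞ := fun i => ∫⁻ x in Metric.closedBall x₀ (t i) ∩ {x | k < u x},
    ENNReal.ofReal (Ψ x ‖Du x‖) with hf
  have hd : 0 < ρ - r := sub_pos.2 hrρ
  have hpow : ∀ i, 0 < τ ^ i := fun i => pow_pos hτ0 i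
  have hpow1 : ∀ i, τ ^ i ≤ 1 := fun i => pow_le_one₀ hτ0.le hτ1.le
  have htlt : ∀ i, t i < ρ := fun i => by simp only [ht]; nlinarith [hpow i]
  have htpos : ∀ i, 0 < t i := fun i => by simp only [ht]; nlinarith [hpow1 i]
  have htsub : ∀ i, t (i + 1) - t i = (ρ - r) * τ ^ i * (1 - τ) := fun i => by
    simp only [ht]; rw [pow_succ]; ring
  have h0 : t 0 = r := by simp [ht]
  have h1τ : 0 < 1 - τ := by linarith
  have hM' : ∀ i, f i ≤ energy Ψ Du Ω := fun i => lintegral_mono_set fun x hx =>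
    hball (Metric.closedBall_subset_ball (htlt i) hx.1)
  have hrec : ∀ i, f i ≤ ENNReal.ofReal θ * f (i + 1) +
      (ENNReal.ofReal (C₁ / (1 - τ)) ^ q * D) * ENNReal.ofReal (1 / τ ^ q) ^ i := by
    intro i
    have hpos : 0 < (ρ - r) * τ ^ i * (1 - τ) := mul_pos (mul_pos hd (hpow i)) h1τ
    have hlt : t i < t (i + 1) := by linarith [htsub i]
    have hle : t (i + 1) - t i ≤ ρ - r := by
      rw [htsub i]
      have h3 : τ ^ i * (1 - τ) ≤ 1 := mul_le_one₀ (hpow1 i) h1τ.le (by linarith)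
      nlinarith
    have step := hmin.caccioppoli_step hC₁ (hcut n) hn hQ hM hΩ k (htpos i) hlt (htlt (i + 1)) hle
      hball hfin
    have hsplit : f (i + 1) = f i + ∫⁻ x in (Metric.closedBall x₀ (t (i + 1)) ∩ {x | k < u x}) \
        Metric.closedBall x₀ (t i), ENNReal.ofReal (Ψ x ‖Du x‖) := by
      have hset : (Metric.closedBall x₀ (t (i + 1)) ∩ {x | k < u x}) ∩
          Metric.closedBall x₀ (t i) = Metric.closedBall x₀ (t i) ∩ {x | k < u x} := by
        ext x
        constructor
        · rintro ⟨⟨-, h2⟩, h3⟩; exact ⟨h3, h2⟩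
        · rintro ⟨h2, h3⟩
          exact ⟨⟨Metric.closedBall_subset_closedBall hlt.le h2, h3⟩, h2⟩
      simp only [hf]
      rw [← lintegral_inter_add_sdiff _ _ (measurableSet_closedBall (x := x₀) (ε := t i)), hset]
    set J := ∫⁻ x in (Metric.closedBall x₀ (t (i + 1)) ∩ {x | k < u x}) \
        Metric.closedBall x₀ (t i), ENNReal.ofReal (Ψ x ‖Du x‖) with hJ
    have hcoef : ENNReal.ofReal (C₁ * (ρ - r) / (t (i + 1) - t i)) ^ q =
        ENNReal.ofReal (C₁ / (1 - τ)) ^ q * ENNReal.ofReal (1 / τ ^ q) ^ i := by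
      rw [htsub i, ← ENNReal.ofReal_pow (by positivity), ← ENNReal.ofReal_pow (by positivity),
        ← ENNReal.ofReal_pow (by positivity), ← ENNReal.ofReal_mul (by positivity)]
      congr 1
      have h5 : C₁ * (ρ - r) / ((ρ - r) * τ ^ i * (1 - τ)) = (C₁ / (1 - τ)) * (1 / τ ^ i) := by
        field_simp
      rw [h5, mul_pow, one_div_pow, one_div_pow, ← pow_mul, ← pow_mul, mul_comm i q]
    set L := ENNReal.ofReal (C₁ / (1 - τ)) ^ q * ENNReal.ofReal (1 / τ ^ q) ^ i with hL
    have step2 : f i ≤ ENNReal.ofReal θ₀ * (J + L * D) := by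
      refine step.trans (le_of_eq ?_)
      rw [hcoef, hθ₀, ENNReal.ofReal_mul (by linarith), ENNReal.ofReal_pow (by norm_num),
        ENNReal.ofReal_ofNat, mul_assoc (ENNReal.ofReal Q)]
    have e1 : ENNReal.ofReal (1 + θ₀) * ENNReal.ofReal θ = ENNReal.ofReal θ₀ := by
      rw [← ENNReal.ofReal_mul (by positivity)]
      congr 1; rw [hθ]; field_simp
    have e2 : ENNReal.ofReal (1 + θ₀) = 1 + ENNReal.ofReal θ₀ := by
      rw [ENNReal.ofReal_add zero_le_one hθ₀0.le, ENNReal.ofReal_one]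
    have step3 : ENNReal.ofReal (1 + θ₀) * f i ≤
        ENNReal.ofReal (1 + θ₀) * (ENNReal.ofReal θ * (f (i + 1) + L * D)) := by
      rw [← mul_assoc, e1, e2, add_mul, one_mul, hsplit]
      calc f i + ENNReal.ofReal θ₀ * f i ≤ ENNReal.ofReal θ₀ * (J + L * D) +
            ENNReal.ofReal θ₀ * f i := by gcongr
        _ = _ := by ring
    have step4 := (ENNReal.mul_le_mul_iff_right (by simp; positivity) ENNReal.ofReal_ne_top).1 step3
    refine step4.trans ?_
    rw [mul_add]
    refine add_le_add le_rfl ?_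
    calc ENNReal.ofReal θ * (L * D) ≤ 1 * (L * D) := by
          gcongr; exact ENNReal.ofReal_le_one.2 hθ1.le
      _ = _ := by rw [hL]; ring
  have := le_of_geometric_recursion (ENNReal.ofReal_lt_one.2 hθ1) hmin.energy_lt_top.ne hM' hrec
  simp only [hf, h0] at this
  refine this.trans (le_of_eq ?_)
  ring

end MultiPhase

/-! ### The Sobolev–Poincaré inequality for the full density. -/

namespace MultiPhase

/-- Hölder with exponents `n` and `n/(n-1)`. With `f = F` it absorbs the structural factor
`φ^(1/n)`; with `f` the excess over a lower level it yields the gain in the De Giorgi step. -/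
lemma lintegral_rpow_mul_self_le {α : Type*} [MeasurableSpace α] {μ : Measure α} {n : ℕ}
    (hn : 2 ≤ n) {f F : α → ℝ≥0∞} (hf : AEMeasurable f μ) (hF : AEMeasurable F μ) :
    ∫⁻ x, f x ^ (1 / (n : ℝ)) * F x ∂μ ≤ (∫⁻ x, f x ∂μ) ^ (1 / (n : ℝ)) *
      (∫⁻ x, F x ^ (1 - 1 / (n : ℝ))⁻¹ ∂μ) ^ (1 - 1 / (n : ℝ)) := by
  have h1 := one_sub_inv_pos hn
  have := ENNReal.lintegral_mul_norm_pow_le hf (hF.pow_const (1 - 1 / (n : ℝ))⁻¹)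
    (p := 1 / (n : ℝ)) (q := 1 - 1 / (n : ℝ)) (by positivity) h1.le (by ring)
  refine le_trans (le_of_eq ?_) this
  refine lintegral_congr fun x => ?_
  rw [← ENNReal.rpow_mul, inv_mul_cancel₀ h1.ne', ENNReal.rpow_one]

section

variable {n : ℕ} {Ω : Set (EuclideanSpace ℝ (Fin n))} {q : ℕ} {K Q : ℝ}
  {Ψ : EuclideanSpace ℝ (Fin n) → ℝ → ℝ} {Ψm : EuclideanSpace ℝ (Fin n) → ℝ → ℝ → ℝ}
  {u : EuclideanSpace ℝ (Fin n) → ℝ} {Du : EuclideanSpace ℝ (Fin n) → EuclideanSpace ℝ (Fin n)}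

lemma IsMultiPhase.ofReal_le (hM : IsMultiPhase Ω q K Ψ Ψm) {x₀ x : EuclideanSpace ℝ (Fin n)}
    {R t : ℝ} (hR : 0 < R) (hR1 : R ≤ 1) (hball : Metric.ball x₀ R ⊆ Ω)
    (hx : x ∈ Metric.ball x₀ R) (ht : 0 ≤ t) :
    ENNReal.ofReal (Ψ x t) ≤ ENNReal.ofReal K * (ENNReal.ofReal (Ψm x₀ R t) +
      ENNReal.ofReal R * (ENNReal.ofReal (Ψm x₀ R t) ^ (1 / (n : ℝ)) *
        ENNReal.ofReal (Ψm x₀ R t))) := by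
  have h0 := (hM.growth_minus x₀ R hR hball).nonneg ht
  have hK := hM.const_nonneg
  rw [ENNReal.ofReal_rpow_of_nonneg h0 (by positivity), ← ENNReal.ofReal_mul (by positivity),
    ← ENNReal.ofReal_mul (by positivity), ← ENNReal.ofReal_add h0 (by positivity),
    ← ENNReal.ofReal_mul hK]
  refine ENNReal.ofReal_le_ofReal ((hM.le_minus x₀ R hR hR1 hball x hx t ht).trans (le_of_eq ?_))
  ring

lemma IsMultiPhase.ofReal_minus_le (hM : IsMultiPhase Ω q K Ψ Ψm)
    {x₀ x : EuclideanSpace ℝ (Fin n)} {R t : ℝ} (hball : Metric.ball x₀ R ⊆ Ω)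
    (hx : x ∈ Metric.ball x₀ R) (ht : 0 ≤ t) :
    ENNReal.ofReal (Ψm x₀ R t) ≤ ENNReal.ofReal (Ψ x t) :=
  ENNReal.ofReal_le_ofReal (hM.minus_le x₀ R hball x hx t ht)

/-- The excess term `R φ^(1/n) φ` is integrated by Hölder. The norm in `L^(n/(n-1))` that results is
the one Sobolev's inequality controls, and the prefactor `R` cancels the `1/R` there. -/
lemma IsMultiPhase.setLIntegral_le (hn : 2 ≤ n) (hM : IsMultiPhase Ω q K Ψ Ψm)
    {x₀ : EuclideanSpace ℝ (Fin n)} {R : ℝ} (hR : 0 < R) (hR1 : R ≤ 1)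
    (hball : Metric.ball x₀ R ⊆ Ω) {w : EuclideanSpace ℝ (Fin n) → ℝ}
    (hw : AEStronglyMeasurable w volume) {E : Set (EuclideanSpace ℝ (Fin n))}
    (hE : MeasurableSet E) (hEB : E ⊆ Metric.ball x₀ R) :
    ∫⁻ x in E, ENNReal.ofReal (Ψ x (|w x| / R)) ≤ ENNReal.ofReal K *
      ((∫⁻ x in E, ENNReal.ofReal (Ψm x₀ R (|w x| / R))) + ENNReal.ofReal R *
        ((∫⁻ x, ENNReal.ofReal (Ψm x₀ R (|w x| / R))) ^ (1 / (n : ℝ)) *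
        (∫⁻ x, ENNReal.ofReal (Ψm x₀ R (|w x| / R)) ^ (1 - 1 / (n : ℝ))⁻¹) ^
          (1 - 1 / (n : ℝ)))) := by
  have hφ := hM.growth_minus x₀ R hR hball
  set F : EuclideanSpace ℝ (Fin n) → ℝ≥0∞ :=
    fun x => ENNReal.ofReal (Ψm x₀ R (|w x| / R)) with hF
  have hFm : AEMeasurable F := by
    have h1 := hφ.aemeasurable_ofReal_norm (hw.mul_const (1 / R))
    refine h1.congr (Eventually.of_forall fun x => ?_)
    simp only [hF, Real.norm_eq_abs, abs_mul, abs_div, abs_one, abs_of_pos hR]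
    rw [mul_one_div]
  calc ∫⁻ x in E, ENNReal.ofReal (Ψ x (|w x| / R))
      ≤ ∫⁻ x in E, ENNReal.ofReal K * (F x + ENNReal.ofReal R * (F x ^ (1 / (n : ℝ)) * F x)) :=
        setLIntegral_mono' hE fun x hx => hM.ofReal_le hR hR1 hball (hEB hx) (by positivity)
    _ = ENNReal.ofReal K * ((∫⁻ x in E, F x) + ENNReal.ofReal R *
          ∫⁻ x in E, F x ^ (1 / (n : ℝ)) * F x) := by
        rw [lintegral_const_mul' _ _ (by simp), lintegral_add_left' hFm.restrict,
          lintegral_const_mul' _ _ (by simp)]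
    _ ≤ _ := by
        gcongr
        exact (setLIntegral_le_lintegral _ _).trans (lintegral_rpow_mul_self_le hn hFm hFm)

end

/-- The Sobolev–Poincaré inequality for a multi-phase functional. -/
theorem exists_sobolev_poincare_const {n : ℕ} (hn : 2 ≤ n) (q : ℕ) :
    ∃ C : ℝ≥0, ∀ {Ω : Set (EuclideanSpace ℝ (Fin n))} {K : ℝ}
      {Ψ : EuclideanSpace ℝ (Fin n) → ℝ → ℝ} {Ψm : EuclideanSpace ℝ (Fin n) → ℝ → ℝ → ℝ}
      {u : EuclideanSpace ℝ (Fin n) → ℝ}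
      {Du : EuclideanSpace ℝ (Fin n) → EuclideanSpace ℝ (Fin n)},
      HasWeakGradient Ω u Du → IsMultiPhase Ω q K Ψ Ψm →
      ∀ (x₀ : EuclideanSpace ℝ (Fin n)) (R : ℝ), 0 < R → R ≤ 1 → Metric.ball x₀ R ⊆ Ω →
      IntegrableOn u (Metric.ball x₀ R) →
      ∫⁻ x in Metric.ball x₀ (3 * R / 4),
          ENNReal.ofReal (Ψ x (|u x - ⨍ y in Metric.ball x₀ R, u y| / R)) ≤
        C * ENNReal.ofReal K *
          (1 + (∫⁻ x in Metric.ball x₀ R, ENNReal.ofReal (Ψ x ‖Du x‖)) ^ (1 / (n : ℝ))) *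
          ∫⁻ x in Metric.ball x₀ R, ENNReal.ofReal (Ψ x ‖Du x‖) := by
  obtain ⟨C₁, hC₁, hcut⟩ := exists_radial_cutoff
  obtain ⟨CS, hCS⟩ := exists_sobolev_const hn q
  set c₂ : ℝ≥0∞ := 2 ^ (q + n) + 2 ^ q * (1 + ENNReal.ofReal (8 * C₁) ^ q * 2 ^ (q + n)) with hc₂
  set c₃ : ℝ≥0∞ := 2 ^ (q + n) + ((2 : ℝ≥0∞) ^ (q + n)) ^ (1 / (n : ℝ)) * (CS * c₂) with hc₃
  have hc₂top : c₂ ≠ ∞ := by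
    rw [hc₂]
    refine ENNReal.add_ne_top.2 ⟨by simp, ENNReal.mul_ne_top (by simp) (ENNReal.add_ne_top.2
      ⟨by simp, ENNReal.mul_ne_top (ENNReal.pow_ne_top ENNReal.ofReal_ne_top) (by simp)⟩)⟩
  have hc₃top : c₃ ≠ ∞ := by
    rw [hc₃]
    refine ENNReal.add_ne_top.2 ⟨by simp, ENNReal.mul_ne_top
      (ENNReal.rpow_ne_top_of_nonneg (by positivity) (by simp)) (ENNReal.mul_ne_top (by simp) hc₂top)⟩
  refine ⟨c₃.toNNReal, ?_⟩
  intro Ω K Ψ Ψm u Du hu hM x₀ R hR hR1 hball hui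
  rw [ENNReal.coe_toNNReal hc₃top]
  have hφ := hM.growth_minus x₀ R hR hball
  set φ := Ψm x₀ R with hφd
  set m := ⨍ y in Metric.ball x₀ R, u y with hm
  set I := ∫⁻ x in Metric.ball x₀ R, ENNReal.ofReal (φ ‖Du x‖) with hI
  have hIle : I ≤ ∫⁻ x in Metric.ball x₀ R, ENNReal.ofReal (Ψ x ‖Du x‖) :=
    setLIntegral_mono' measurableSet_ball fun x hx =>
      hM.ofReal_minus_le hball hx (norm_nonneg _)
  suffices hmain : ∫⁻ x in Metric.ball x₀ (3 * R / 4), ENNReal.ofReal (Ψ x (|u x - m| / R)) ≤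
      c₃ * ENNReal.ofReal K * (1 + I ^ (1 / (n : ℝ))) * I by
    refine hmain.trans ?_
    gcongr
  have huB : HasWeakGradient (Metric.ball x₀ R) u Du := hu.mono hball
  have hpoin := HasWeakGradient.poincare hφ hR huB hui
  rw [← hm, ← hI] at hpoin
  -- Sobolev's inequality needs compact support, hence a cutoff and the smaller ball on the
  -- left-hand side. The gap `R/8` makes the gradient of the cutoff at most `8 C₁ / R`, so Poincaré
  -- controls that term.
  obtain ⟨ζ, hζ, h01, hζ1, hζs, hζg, -⟩ := hcut n x₀ (3 * R / 4) (7 * R / 8) (by positivity)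
    (by linarith)
  have hcB : Metric.closedBall x₀ (7 * R / 8) ⊆ Metric.ball x₀ R :=
    Metric.closedBall_subset_ball (by linarith)
  have hζc : HasCompactSupport ζ :=
    (isCompact_closedBall x₀ (7 * R / 8)).of_isClosed_subset (isClosed_tsupport ζ) hζs
  obtain ⟨hw, hwi, hgi⟩ := (huB.sub_const m).cutoff_mul hζ hζc (hζs.trans hcB)
  set w : EuclideanSpace ℝ (Fin n) → ℝ := fun x => ζ x * (u x - m) with hwd
  set g : EuclideanSpace ℝ (Fin n) → EuclideanSpace ℝ (Fin n) :=
    fun x => ζ x • Du x + (u x - m) • gradient ζ x with hgd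
  have hζ0 : ∀ x ∉ Metric.ball x₀ R, ζ x = 0 ∧ gradient ζ x = 0 := by
    intro x hx
    have h1 : x ∉ tsupport ζ := fun h => hx (hcB (hζs h))
    refine ⟨image_eq_zero_of_notMem_tsupport h1, ?_⟩
    have h2 : fderiv ℝ ζ x = 0 := by
      have := support_fderiv_subset ℝ (f := ζ)
      by_contra h3
      exact h1 (this h3)
    simp [gradient, h2]
  have hDum : AEStronglyMeasurable Du (volume.restrict (Metric.ball x₀ R)) :=
    huB.locInt_grad.aestronglyMeasurable
  have hF1 : ∫⁻ x, ENNReal.ofReal (φ (|w x| / R)) ≤ 2 ^ (q + n) * I := by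
    refine le_trans ?_ hpoin
    rw [← lintegral_indicator measurableSet_ball]
    refine lintegral_mono fun x => ?_
    by_cases hx : x ∈ Metric.ball x₀ R
    · rw [indicator_of_mem hx]
      refine ENNReal.ofReal_le_ofReal (hφ.le_of_le (by positivity) ?_)
      refine div_le_div_of_nonneg_right ?_ hR.le
      rw [hwd]
      simp only
      rw [abs_mul, abs_of_nonneg (h01 x).1]
      exact mul_le_of_le_one_left (abs_nonneg _) (h01 x).2
    · simp [hwd, (hζ0 x hx).1, hφ.zero]
  have hg1 : ∫⁻ x, ENNReal.ofReal (φ ‖g x‖) ≤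
      2 ^ q * (1 + ENNReal.ofReal (8 * C₁) ^ q * 2 ^ (q + n)) * I := by
    calc ∫⁻ x, ENNReal.ofReal (φ ‖g x‖) ≤ ∫⁻ x in Metric.ball x₀ R, 2 ^ q *
          (ENNReal.ofReal (φ ‖Du x‖) +
            ENNReal.ofReal (8 * C₁) ^ q * ENNReal.ofReal (φ (|u x - m| / R))) := by
          rw [← lintegral_indicator measurableSet_ball]
          refine lintegral_mono fun x => ?_
          by_cases hx : x ∈ Metric.ball x₀ R
          · rw [indicator_of_mem hx]
            refine (ofReal_map_le_of_le_add hφ (norm_nonneg _) (norm_nonneg (Du x))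
              (by positivity : 0 ≤ 8 * C₁ * (|u x - m| / R)) ?_).trans ?_
            · refine (norm_add_le _ _).trans (add_le_add ?_ ?_)
              · rw [norm_smul, Real.norm_eq_abs, abs_of_nonneg (h01 x).1]
                exact mul_le_of_le_one_left (norm_nonneg _) (h01 x).2
              · rw [norm_smul, Real.norm_eq_abs]
                calc |u x - m| * ‖gradient ζ x‖ ≤ |u x - m| * (C₁ / (7 * R / 8 - 3 * R / 4)) := by
                      gcongr; exact hζg x
                  _ = _ := by
                      rw [show 7 * R / 8 - 3 * R / 4 = R / 8 by ring]; field_simp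
            · gcongr
              exact ofReal_map_mul_le hφ (by linarith) (by positivity)
          · simp [hgd, (hζ0 x hx).1, (hζ0 x hx).2, hφ.zero]
      _ = 2 ^ q * (I + ENNReal.ofReal (8 * C₁) ^ q *
            ∫⁻ x in Metric.ball x₀ R, ENNReal.ofReal (φ (|u x - m| / R))) := by
          rw [lintegral_const_mul' _ _ (by simp), lintegral_add_left'
            (hφ.aemeasurable_ofReal_norm hDum), lintegral_const_mul' _ _ (ENNReal.pow_ne_top ENNReal.ofReal_ne_top)]
      _ ≤ 2 ^ q * (I + ENNReal.ofReal (8 * C₁) ^ q * (2 ^ (q + n) * I)) := by gcongr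
      _ = _ := by ring
  have hsob := hCS φ hφ w g R hw hwi hgi
    (HasCompactSupport.mul_right hζc) hR
  set X := (∫⁻ x, ENNReal.ofReal (φ (|w x| / R)) ^ (1 - 1 / (n : ℝ))⁻¹) ^ (1 - 1 / (n : ℝ)) with hX
  have hX1 : ENNReal.ofReal R * X ≤ CS * c₂ * I := by
    have e : ENNReal.ofReal R * ENNReal.ofReal (1 / R) = 1 := by
      rw [← ENNReal.ofReal_mul hR.le, mul_one_div_cancel hR.ne', ENNReal.ofReal_one]
    calc ENNReal.ofReal R * X ≤ ENNReal.ofReal R * (CS * ENNReal.ofReal (1 / R) *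
          (2 ^ (q + n) * I + 2 ^ q * (1 + ENNReal.ofReal (8 * C₁) ^ q * 2 ^ (q + n)) * I)) := by
          gcongr
          exact hsob.trans (by gcongr)
      _ = (ENNReal.ofReal R * ENNReal.ofReal (1 / R)) * (CS * c₂ * I) := by rw [hc₂]; ring
      _ = _ := by rw [e, one_mul]
  have hsub : Metric.ball x₀ (3 * R / 4) ⊆ Metric.ball x₀ R := Metric.ball_subset_ball (by linarith)
  calc ∫⁻ x in Metric.ball x₀ (3 * R / 4), ENNReal.ofReal (Ψ x (|u x - m| / R))
      = ∫⁻ x in Metric.ball x₀ (3 * R / 4), ENNReal.ofReal (Ψ x (|w x| / R)) := by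
        refine setLIntegral_congr_fun measurableSet_ball fun x hx => ?_
        simp only [hwd]
        rw [hζ1 x (Metric.ball_subset_closedBall hx), one_mul]
    _ ≤ ENNReal.ofReal K * ((∫⁻ x in Metric.ball x₀ (3 * R / 4), ENNReal.ofReal (φ (|w x| / R))) +
          ENNReal.ofReal R * ((∫⁻ x, ENNReal.ofReal (φ (|w x| / R))) ^ (1 / (n : ℝ)) * X)) :=
        hM.setLIntegral_le hn hR hR1 hball hwi.1 measurableSet_ball hsub
    _ ≤ ENNReal.ofReal K * (2 ^ (q + n) * I +
          (2 ^ (q + n) * I) ^ (1 / (n : ℝ)) * (CS * c₂ * I)) := by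
        rw [mul_left_comm (ENNReal.ofReal R)]
        gcongr
        exact (setLIntegral_le_lintegral _ _).trans hF1
    _ = ENNReal.ofReal K * (2 ^ (q + n) * I + ((2 : ℝ≥0∞) ^ (q + n)) ^ (1 / (n : ℝ)) *
          (CS * c₂) * (I ^ (1 / (n : ℝ)) * I)) := by
        rw [ENNReal.mul_rpow_of_nonneg _ _ (by positivity : (0 : ℝ) ≤ 1 / n)]; ring
    _ ≤ ENNReal.ofReal K * (c₃ * I + c₃ * (I ^ (1 / (n : ℝ)) * I)) := by
        gcongr
        · rw [hc₃]; exact le_self_add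
        · rw [hc₃]; exact le_add_self
    _ = _ := by ring

end MultiPhase

/-! ### Arithmetic of the superlinear recursion. -/

namespace MultiPhase

/-- Fast geometric convergence. -/
lemma tendsto_zero_of_superlinear {Z : ℕ → ℝ≥0∞} {C B : ℝ≥0∞} {N : ℕ} (hN : N ≠ 0) (hC : 1 ≤ C)
    (hCt : C ≠ ∞) (hB : 1 < B) (hBt : B ≠ ∞)
    (h : ∀ i, Z i ≤ 1 → Z (i + 1) ≤ C * B ^ i * Z i * Z i ^ (1 / (N : ℝ)))
    (h0 : Z 0 ≤ (B⁻¹ ^ N * C⁻¹) ^ N) : Tendsto Z atTop (𝓝 0) := by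
  set μ := B⁻¹ ^ N with hμ
  set δ := (μ * C⁻¹) ^ N with hδ
  have hB1 : B⁻¹ < 1 := ENNReal.inv_lt_one.2 hB
  have hμ1 : μ < 1 := pow_lt_one₀ zero_le hB1 hN
  have hC1 : C⁻¹ ≤ 1 := ENNReal.inv_le_one.2 hC
  have hδ1 : δ ≤ 1 := pow_le_one₀ zero_le (mul_le_one' hμ1.le hC1)
  have hroot : ∀ x : ℝ≥0∞, (x ^ N) ^ (1 / (N : ℝ)) = x := by
    intro x
    rw [one_div, ENNReal.pow_rpow_inv_natCast hN]
  have hB0 : B ≠ 0 := (zero_lt_one.trans hB).ne'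
  have hC0 : C ≠ 0 := (zero_lt_one.trans_le hC).ne'
  -- With `μ = B^(-N)` and `δ = (μ / C)^N`, the power `1/N` of the bound is `(μ / C) B^(-i)`, which
  -- cancels `C B^i` and leaves one more factor `μ`. As `δ μ^i ≤ 1`, the recursion stays applicable.
  have main : ∀ i, Z i ≤ δ * μ ^ i := by
    intro i
    induction i with
    | zero => simpa using h0
    | succ i ih =>
      have hle1 : Z i ≤ 1 := ih.trans (mul_le_one' hδ1 (pow_le_one₀ zero_le hμ1.le))
      have hα : (0 : ℝ) ≤ 1 / (N : ℝ) := by positivity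
      calc Z (i + 1) ≤ C * B ^ i * Z i * Z i ^ (1 / (N : ℝ)) := h i hle1
        _ ≤ C * B ^ i * (δ * μ ^ i) * (δ * μ ^ i) ^ (1 / (N : ℝ)) := by gcongr
        _ = C * B ^ i * (δ * μ ^ i) * ((μ * C⁻¹) * B⁻¹ ^ i) := by
            rw [ENNReal.mul_rpow_of_nonneg _ _ hα, hδ, hroot]
            congr 2
            rw [hμ, ← pow_mul, mul_comm N i, pow_mul, hroot]
        _ = (C * C⁻¹) * (B * B⁻¹) ^ i * (δ * (μ ^ i * μ)) := by rw [mul_pow]; ring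
        _ = δ * μ ^ (i + 1) := by
            rw [ENNReal.mul_inv_cancel hC0 hCt, ENNReal.mul_inv_cancel hB0 hBt, one_pow, one_mul,
              one_mul, pow_succ]
  have hlim : Tendsto (fun i : ℕ => δ * μ ^ i) atTop (𝓝 (δ * 0)) :=
    ENNReal.Tendsto.const_mul (ENNReal.tendsto_pow_atTop_nhds_zero_of_lt_one hμ1)
      (Or.inr (ne_top_of_le_ne_top ENNReal.one_ne_top hδ1))
  rw [mul_zero] at hlim
  exact tendsto_of_tendsto_of_tendsto_of_le_of_le tendsto_const_nhds hlim (fun _ => zero_le) main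

/-- The arithmetic of one De Giorgi step. -/
lemma superlinear_step {n : ℕ} (hn : 2 ≤ n) {K C b M T Z Y Y' S X V ρ : ℝ≥0∞}
    (hC : 1 ≤ C) (hb : 1 ≤ b) (hT : T = ρ ^ n * V) (hT0 : T ≠ 0) (hTt : T ≠ ∞)
    (hZ : Z = Y / T) (hYM : Y ≤ M) (hZ1 : Z ≤ 1)
    (h1 : Y' ≤ K * (S + ρ * (S ^ (1 / (n : ℝ)) * X))) (h2 : ρ * X ≤ C * b * Y)
    (h3 : V ^ (1 / (n : ℝ)) * S ≤ (b * Y) ^ (1 / (n : ℝ)) * X) :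
    Y' / T ≤ K * C ^ 2 * (2 + M) * b ^ 3 * Z * Z ^ (1 / ((n ^ 2 : ℕ) : ℝ)) := by
  have hn0 : n ≠ 0 := by omega
  have hnR : (1 : ℝ) ≤ n := by exact_mod_cast (by omega : 1 ≤ n)
  have hα : (0 : ℝ) ≤ 1 / (n : ℝ) := by positivity
  have hα1 : 1 / (n : ℝ) ≤ 1 := by rw [div_le_one (by positivity)]; exact hnR
  have hY : Y = T * Z := by rw [hZ, ENNReal.mul_div_cancel hT0 hTt]
  have hTr : T ^ (1 / (n : ℝ)) = ρ * V ^ (1 / (n : ℝ)) := by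
    rw [hT, ENNReal.mul_rpow_of_nonneg _ _ hα, one_div, ENNReal.pow_rpow_inv_natCast hn0]
  have hTr0 : T ^ (1 / (n : ℝ)) ≠ 0 := (ENNReal.rpow_pos (pos_iff_ne_zero.2 hT0) hTt).ne'
  have hTrt : T ^ (1 / (n : ℝ)) ≠ ∞ := ENNReal.rpow_ne_top_of_nonneg hα hTt
  have hroot : ∀ x : ℝ≥0∞, 1 ≤ x → x ^ (1 / (n : ℝ)) ≤ x := fun x hx => by
    simpa using ENNReal.rpow_le_rpow_of_exponent_le hx hα1
  -- The level inequality is multiplied by `ρ` and divided by `T^(1/n) = ρ V^(1/n)`, turning `Y`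
  -- into the normalized quantity `Z`.
  have hS : S ≤ (b * Z) ^ (1 / (n : ℝ)) * (C * b * Y) := by
    refine (ENNReal.mul_le_mul_iff_right hTr0 hTrt).1 ?_
    calc T ^ (1 / (n : ℝ)) * S = ρ * (V ^ (1 / (n : ℝ)) * S) := by rw [hTr, mul_assoc]
      _ ≤ ρ * ((b * Y) ^ (1 / (n : ℝ)) * X) := by gcongr
      _ = (b * Y) ^ (1 / (n : ℝ)) * (ρ * X) := by ring
      _ ≤ (b * Y) ^ (1 / (n : ℝ)) * (C * b * Y) := by gcongr
      _ = _ := by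
          rw [← mul_assoc (T ^ (1 / (n : ℝ))), ← ENNReal.mul_rpow_of_nonneg _ _ hα]
          congr 2
          rw [hY]; ring
  set α : ℝ := 1 / ((n ^ 2 : ℕ) : ℝ) with hαd
  have hαα : (1 / (n : ℝ)) * (1 / (n : ℝ)) = α := by
    rw [hαd]; push_cast; field_simp
  have hZn : Z ^ (1 / (n : ℝ)) ≤ Z ^ α := by
    refine ENNReal.rpow_le_rpow_of_exponent_ge hZ1 ?_
    rw [← hαα]
    exact mul_le_of_le_one_left hα hα1
  have hbZ : (b * Z) ^ (1 / (n : ℝ)) ≤ b * Z ^ (1 / (n : ℝ)) := by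
    rw [ENNReal.mul_rpow_of_nonneg _ _ hα]
    gcongr
    exact hroot b hb
  have hS1 : S ≤ C * b ^ 2 * Z ^ α * Y := by
    calc S ≤ (b * Z ^ α) * (C * b * Y) := hS.trans (by gcongr; exact hbZ.trans (by gcongr))
      _ = _ := by ring
  -- Here `Y` is bounded by `M`, so a root of order `n` is taken of `Z^(1/n)` alone. This is the
  -- origin of the exponent `1/n²`, and of the dependence on `M`.
  have hS2 : S ^ (1 / (n : ℝ)) ≤ C * b ^ 2 * (1 + M) * Z ^ α := by
    have h4 : S ≤ (C * b ^ 2 * (1 + M)) * Z ^ (1 / (n : ℝ)) := by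
      calc S ≤ (b * Z ^ (1 / (n : ℝ))) * (C * b * M) := hS.trans (by gcongr)
        _ ≤ (b * Z ^ (1 / (n : ℝ))) * (C * b * (1 + M)) := by gcongr; exact le_add_self
        _ = _ := by ring
    calc S ^ (1 / (n : ℝ)) ≤ ((C * b ^ 2 * (1 + M)) * Z ^ (1 / (n : ℝ))) ^ (1 / (n : ℝ)) := by gcongr
      _ = (C * b ^ 2 * (1 + M)) ^ (1 / (n : ℝ)) * Z ^ α := by
          rw [ENNReal.mul_rpow_of_nonneg _ _ hα, ← ENNReal.rpow_mul, hαα]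
      _ ≤ _ := by
          gcongr
          exact hroot _ (one_le_mul (one_le_mul hC (one_le_pow₀ hb)) le_self_add)
  have hfin : Y' ≤ (K * C ^ 2 * (2 + M) * b ^ 3 * Z * Z ^ α) * T := by
    calc Y' ≤ K * (S + S ^ (1 / (n : ℝ)) * (ρ * X)) := h1.trans (le_of_eq (by ring))
      _ ≤ K * (C * b ^ 2 * Z ^ α * Y + (C * b ^ 2 * (1 + M) * Z ^ α) * (C * b * Y)) := by gcongr
      _ = K * ((C * b ^ 2) * (Z ^ α * Y) + (C ^ 2 * b ^ 3) * (1 + M) * (Z ^ α * Y)) := by ring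
      _ ≤ K * ((C ^ 2 * b ^ 3) * (Z ^ α * Y) + (C ^ 2 * b ^ 3) * (1 + M) * (Z ^ α * Y)) := by
          gcongr
          · exact le_self_pow hC two_ne_zero
          · norm_num
      _ = _ := by rw [hY]; ring
  exact ENNReal.div_le_of_le_mul hfin

end MultiPhase

/-! ### One De Giorgi step. -/

namespace MultiPhase

/-- The analytic part of one De Giorgi step. -/
theorem exists_degiorgi_step_const {n : ℕ} (hn : 2 ≤ n) (q : ℕ) {Q : ℝ} (hQ : 1 ≤ Q) :
    ∃ C : ℝ≥0, 1 ≤ C ∧ ∀ {Ω : Set (EuclideanSpace ℝ (Fin n))} {K : ℝ}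
      {Ψ : EuclideanSpace ℝ (Fin n) → ℝ → ℝ} {Ψm : EuclideanSpace ℝ (Fin n) → ℝ → ℝ → ℝ}
      {u : EuclideanSpace ℝ (Fin n) → ℝ}
      {Du : EuclideanSpace ℝ (Fin n) → EuclideanSpace ℝ (Fin n)},
      IsLocalQMinimizer Ω Ψ Q u Du → IsMultiPhase Ω q K Ψ Ψm → IsOpen Ω →
      ∀ (x₀ : EuclideanSpace ℝ (Fin n)) (R r ρ l h k L : ℝ), 0 < R → R ≤ 1 →
      Metric.ball x₀ R ⊆ Ω → 0 < r → r < ρ → ρ ≤ R → 1 ≤ L → 2 * R ≤ L * (ρ - r) → l < h →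
      0 ≤ k → k ≤ L * (h - l) →
      ∫⁻ x in Metric.ball x₀ ρ, ENNReal.ofReal (Ψ x (max (u x - l) 0 / R)) ≠ ∞ →
      ∃ S X : ℝ≥0∞,
        ∫⁻ x in Metric.ball x₀ r, ENNReal.ofReal (Ψ x (max (u x - h) 0 / R)) ≤
          ENNReal.ofReal K * (S + ENNReal.ofReal R * (S ^ (1 / (n : ℝ)) * X)) ∧
        ENNReal.ofReal R * X ≤ C * ENNReal.ofReal L ^ q *
          ∫⁻ x in Metric.ball x₀ ρ, ENNReal.ofReal (Ψ x (max (u x - l) 0 / R)) ∧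
        ENNReal.ofReal (Ψm x₀ R (k / R)) ^ (1 / (n : ℝ)) * S ≤
          (ENNReal.ofReal L ^ q * ∫⁻ x in Metric.ball x₀ ρ,
            ENNReal.ofReal (Ψ x (max (u x - l) 0 / R))) ^ (1 / (n : ℝ)) * X := by
  obtain ⟨C₁, hC₁, hcut⟩ := exists_radial_cutoff
  obtain ⟨CS, hCS⟩ := exists_sobolev_const hn q
  obtain ⟨CC, hCC⟩ := exists_caccioppoli_const (n := n) (by omega) q hQ
  set c : ℝ≥0 := CS * (1 + 2 ^ q * (CC + C₁.toNNReal ^ q)) with hc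
  refine ⟨max 1 c, le_max_left _ _, ?_⟩
  intro Ω K Ψ Ψm u Du hmin hM hΩ x₀ R r ρ l h k L hR hR1 hball hr hrρ hρR hL hLρ hlh hk hkL hfin
  have hφ := hM.growth_minus x₀ R hR hball
  set φ := Ψm x₀ R with hφd
  set Y := ∫⁻ x in Metric.ball x₀ ρ, ENNReal.ofReal (Ψ x (max (u x - l) 0 / R)) with hY
  have hρB : Metric.ball x₀ ρ ⊆ Metric.ball x₀ R := Metric.ball_subset_ball hρR
  have hρΩ := hρB.trans hball
  -- Half of the gap serves the Caccioppoli inequality between `s` and `ρ`, the other half the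
  -- cutoff between `r` and `s`.
  set s := (r + ρ) / 2 with hs
  have hrs : r < s := by rw [hs]; linarith
  have hsρ : s < ρ := by rw [hs]; linarith
  have hρs0 : 0 < ρ - s := sub_pos.2 hsρ
  have hsr0 : 0 < s - r := sub_pos.2 hrs
  have hRs : R ≤ L * (ρ - s) := by rw [hs]; linarith
  have hRs' : R ≤ L * (s - r) := by rw [hs]; linarith
  have hvle : ∀ x, max (u x - h) 0 ≤ max (u x - l) 0 := fun x => max_le_max (by linarith) le_rfl
  have hv0 : ∀ x, 0 ≤ max (u x - h) 0 := fun x => le_max_right _ _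
  have hl0 : ∀ x, 0 ≤ max (u x - l) 0 := fun x => le_max_right _ _
  -- the Caccioppoli inequality
  have hD : ∫⁻ x in Metric.ball x₀ ρ, ENNReal.ofReal (Ψ x (max (u x - h) 0 / (ρ - s))) ≤
      ENNReal.ofReal L ^ q * Y := by
    rw [hY, ← lintegral_const_mul' _ _ (ENNReal.pow_ne_top ENNReal.ofReal_ne_top)]
    refine setLIntegral_mono' measurableSet_ball fun x hx => ?_
    have hgr := hM.growth x (hρΩ hx)
    refine le_trans (ENNReal.ofReal_le_ofReal (hgr.le_of_le
      (div_nonneg (hv0 x) hρs0.le) ?_)) (ofReal_map_mul_le hgr hL (div_nonneg (hl0 x) hR.le))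
    rw [div_le_iff₀ hρs0]
    calc max (u x - h) 0 ≤ max (u x - l) 0 / R * R := by rw [div_mul_cancel₀ _ hR.ne']; exact hvle x
      _ ≤ max (u x - l) 0 / R * (L * (ρ - s)) := by
          gcongr
      _ = _ := by ring
  have hLY : ENNReal.ofReal L ^ q * Y ≠ ∞ :=
    ENNReal.mul_ne_top (ENNReal.pow_ne_top ENNReal.ofReal_ne_top) hfin
  have hcac := hCC hmin hM hΩ x₀ s ρ h (hr.trans hrs) hsρ hρΩ (ne_top_of_le_ne_top hLY hD)
  obtain ⟨ζ, hζ, h01, hζ1, hζs, hζg, hζ0⟩ := hcut n x₀ r s hr hrs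
  have hsB : Metric.closedBall x₀ s ⊆ Metric.ball x₀ ρ := Metric.closedBall_subset_ball hsρ
  have hζc : HasCompactSupport ζ :=
    (isCompact_closedBall x₀ s).of_isClosed_subset (isClosed_tsupport ζ) hζs
  obtain ⟨hw, hwi, hgi⟩ := ((hmin.hasWeakGradient.sub_const h).posPart hΩ).cutoff_mul hζ hζc
    (hζs.trans (hsB.trans hρΩ))
  set v : EuclideanSpace ℝ (Fin n) → ℝ := fun x => max (u x - h) 0 with hvd
  set Dv : EuclideanSpace ℝ (Fin n) → EuclideanSpace ℝ (Fin n) :=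
    fun x => if 0 < u x - h then Du x else 0 with hDv
  set w : EuclideanSpace ℝ (Fin n) → ℝ := fun x => ζ x * v x with hwd
  set g : EuclideanSpace ℝ (Fin n) → EuclideanSpace ℝ (Fin n) :=
    fun x => ζ x • Dv x + v x • gradient ζ x with hgd
  have hζT : ∀ x ∉ Metric.closedBall x₀ s, ζ x = 0 := fun x hx =>
    image_eq_zero_of_notMem_tsupport fun h => hx (hζs h)
  have hw0 : ∀ x, 0 ≤ w x := fun x => mul_nonneg (h01 x).1 (hv0 x)
  have hwv : ∀ x, w x ≤ v x := fun x => mul_le_of_le_one_left (hv0 x) (h01 x).2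
  set F : EuclideanSpace ℝ (Fin n) → ℝ≥0∞ := fun x => ENNReal.ofReal (φ (|w x| / R)) with hF
  set H : EuclideanSpace ℝ (Fin n) → ℝ≥0∞ := (Metric.ball x₀ ρ).indicator
    fun x => ENNReal.ofReal (Ψ x (max (u x - l) 0 / R)) with hH
  have hHY : ∫⁻ x, H x = Y := lintegral_indicator measurableSet_ball _
  have hFH : ∀ x, F x ≤ H x := by
    intro x
    by_cases hx : x ∈ Metric.closedBall x₀ s
    · rw [hH, indicator_of_mem (hsB hx)]
      refine le_trans ?_ (hM.ofReal_minus_le hball (hρB (hsB hx)) (div_nonneg (hl0 x) hR.le))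
      refine ENNReal.ofReal_le_ofReal (hφ.le_of_le (by positivity) ?_)
      refine div_le_div_of_nonneg_right ?_ hR.le
      rw [abs_of_nonneg (hw0 x)]
      exact (hwv x).trans (hvle x)
    · simp [hF, hwd, hζT x hx, hφ.zero]
  have hum : AEStronglyMeasurable u (volume.restrict Ω) :=
    hmin.hasWeakGradient.locInt.aestronglyMeasurable
  have hHm : AEMeasurable H := by
    rw [hH, aemeasurable_indicator_iff measurableSet_ball]
    refine AEMeasurable.mono_set hρΩ ?_
    refine (hM.aemeasurable (fun x => max (u x - l) 0 / R) ?_ fun x =>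
      div_nonneg (hl0 x) hR.le).ennreal_ofReal
    exact ((hum.aemeasurable.sub_const l).max aemeasurable_const).div_const R
  have hFm : AEMeasurable F := by
    have h1 := hφ.aemeasurable_ofReal_norm (hwi.1.mul_const (1 / R))
    refine h1.congr (Eventually.of_forall fun x => ?_)
    simp only [hF, Real.norm_eq_abs, abs_mul, abs_div, abs_one, abs_of_pos hR]
    rw [mul_one_div]
  have hDum : AEStronglyMeasurable Du (volume.restrict Ω) :=
    hmin.hasWeakGradient.locInt_grad.aestronglyMeasurable
  have hL0 : 0 ≤ L := by linarith
  -- The gradient of the truncation is controlled by Caccioppoli on the superlevel set, the gradient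
  -- of the cutoff by the excess over the lower level `l`.
  have hgint : ∫⁻ x, ENNReal.ofReal (φ ‖g x‖) ≤
      2 ^ q * (CC + ENNReal.ofReal C₁ ^ q) * (ENNReal.ofReal L ^ q * Y) := by
    set A := Metric.closedBall x₀ s ∩ {x | h < u x} with hA
    -- `u` is almost everywhere measurable only on `Ω`, so the superlevel set is first intersected
    -- with `Ω`, which the inner ball already guarantees.
    have hAm : NullMeasurableSet A := by
      have h1 : A = Metric.closedBall x₀ s ∩ (Ω ∩ {x | h < u x}) := by
        ext x
        exact ⟨fun hx => ⟨hx.1, hρΩ (hsB hx.1), hx.2⟩, fun hx => ⟨hx.1, hx.2.2⟩⟩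
      rw [h1]
      refine measurableSet_closedBall.nullMeasurableSet.inter ?_
      have h2 : NullMeasurableSet {x | h < u x} (volume.restrict Ω) :=
        nullMeasurableSet_lt aemeasurable_const hum.aemeasurable
      have h3 := (nullMeasurableSet_restrict hΩ.measurableSet.nullMeasurableSet).1 h2
      rwa [inter_comm] at h3
    have hpt : ∀ x, ENNReal.ofReal (φ ‖g x‖) ≤ 2 ^ q *
        (A.indicator (fun x => ENNReal.ofReal (Ψ x ‖Du x‖)) x +
          (ENNReal.ofReal C₁ ^ q * ENNReal.ofReal L ^ q) * H x) := by
      intro x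
      by_cases hx : x ∈ Metric.closedBall x₀ s
      · have hxB := hρB (hsB hx)
        have hle : ‖g x‖ ≤ ‖Dv x‖ + (C₁ * L) * (max (u x - l) 0 / R) := by
          refine (norm_add_le _ _).trans (add_le_add ?_ ?_)
          · rw [norm_smul, Real.norm_eq_abs, abs_of_nonneg (h01 x).1]
            exact mul_le_of_le_one_left (norm_nonneg _) (h01 x).2
          · rw [norm_smul, Real.norm_eq_abs, abs_of_nonneg (hv0 x)]
            calc v x * ‖gradient ζ x‖ ≤ max (u x - l) 0 * (C₁ * (L / R)) := by
                  refine mul_le_mul (hvle x) ((hζg x).trans ?_) (norm_nonneg _) (hl0 x)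
                  rw [div_eq_mul_inv]
                  gcongr
                  rw [inv_le_comm₀ hsr0 (by positivity), inv_div, div_le_iff₀ (by linarith)]
                  linarith
              _ = _ := by ring
        have hC₁L : 1 ≤ C₁ * L := one_le_mul_of_one_le_of_one_le hC₁ hL
        refine (ofReal_map_le_of_le_add hφ (norm_nonneg _) (norm_nonneg _)
          (mul_nonneg (by linarith) (div_nonneg (hl0 x) hR.le)) hle).trans ?_
        gcongr
        · by_cases hxu : h < u x
          · rw [indicator_of_mem (show x ∈ A from ⟨hx, hxu⟩)]
            have h1 : Dv x = Du x := by simp only [hDv, sub_pos, hxu, if_true]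
            rw [h1]
            exact hM.ofReal_minus_le hball hxB (norm_nonneg _)
          · have h1 : Dv x = 0 := by simp only [hDv, sub_pos, hxu, if_false]
            simp [h1, hφ.zero]
        · rw [← mul_pow, ← ENNReal.ofReal_mul (by linarith), hH, indicator_of_mem (hsB hx)]
          refine (ofReal_map_mul_le hφ hC₁L (div_nonneg (hl0 x) hR.le)).trans ?_
          gcongr
          exact hM.minus_le x₀ R hball x hxB _ (div_nonneg (hl0 x) hR.le)
      · have h1 : g x = 0 := by simp [hgd, hζT x hx, hζ0 x (hζT x hx)]
        simp [h1, hφ.zero]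
    calc ∫⁻ x, ENNReal.ofReal (φ ‖g x‖) ≤ ∫⁻ x, 2 ^ q *
        (A.indicator (fun x => ENNReal.ofReal (Ψ x ‖Du x‖)) x +
          (ENNReal.ofReal C₁ ^ q * ENNReal.ofReal L ^ q) * H x) := lintegral_mono hpt
      _ = 2 ^ q * ((∫⁻ x in A, ENNReal.ofReal (Ψ x ‖Du x‖)) +
            (ENNReal.ofReal C₁ ^ q * ENNReal.ofReal L ^ q) * Y) := by
          rw [lintegral_const_mul' _ _ (by simp), lintegral_add_right' _ (hHm.const_mul _),
            lintegral_const_mul'' _ hHm, hHY, lintegral_indicator₀ hAm]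
      _ ≤ 2 ^ q * (CC * (ENNReal.ofReal L ^ q * Y) +
            (ENNReal.ofReal C₁ ^ q * ENNReal.ofReal L ^ q) * Y) := by
          gcongr
          exact hcac.trans (by gcongr)
      _ = _ := by ring
  have hsob := hCS φ hφ w g R hw hwi hgi (HasCompactSupport.mul_right hζc) hR
  set X := (∫⁻ x, F x ^ (1 - 1 / (n : ℝ))⁻¹) ^ (1 - 1 / (n : ℝ)) with hX
  refine ⟨∫⁻ x, F x, X, ?_, ?_, ?_⟩
  · calc ∫⁻ x in Metric.ball x₀ r, ENNReal.ofReal (Ψ x (max (u x - h) 0 / R))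
        = ∫⁻ x in Metric.ball x₀ r, ENNReal.ofReal (Ψ x (|w x| / R)) := by
          refine setLIntegral_congr_fun measurableSet_ball fun x hx => ?_
          have h1 : w x = v x := by
            simp only [hwd, hζ1 x (Metric.ball_subset_closedBall hx), one_mul]
          simp only [h1, abs_of_nonneg (hv0 x), hvd]
      _ ≤ _ := hM.setLIntegral_le hn hR hR1 hball hwi.1 measurableSet_ball
          (Metric.ball_subset_ball (hrρ.le.trans hρR))
      _ ≤ _ := by
          gcongr
          exact Measure.restrict_le_self
  · have e : ENNReal.ofReal R * ENNReal.ofReal (1 / R) = 1 := by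
      rw [← ENNReal.ofReal_mul hR.le, mul_one_div_cancel hR.ne', ENNReal.ofReal_one]
    have hLq : 1 ≤ ENNReal.ofReal L ^ q :=
      one_le_pow₀ (by rw [← ENNReal.ofReal_one]; exact ENNReal.ofReal_le_ofReal hL)
    have hcc : (c : ℝ≥0∞) = CS * (1 + 2 ^ q * (CC + ENNReal.ofReal C₁ ^ q)) := by
      rw [hc]; push_cast; rfl
    calc ENNReal.ofReal R * X ≤ ENNReal.ofReal R * (CS * ENNReal.ofReal (1 / R) *
          (ENNReal.ofReal L ^ q * Y +
            2 ^ q * (CC + ENNReal.ofReal C₁ ^ q) * (ENNReal.ofReal L ^ q * Y))) := by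
          gcongr
          refine hsob.trans ?_
          gcongr
          calc ∫⁻ x, F x ≤ ∫⁻ x, H x := lintegral_mono hFH
            _ = Y := hHY
            _ ≤ _ := le_mul_of_one_le_left zero_le hLq
      _ = (ENNReal.ofReal R * ENNReal.ofReal (1 / R)) * (c * ENNReal.ofReal L ^ q * Y) := by
          rw [hcc]; ring
      _ ≤ _ := by
          rw [e, one_mul]
          gcongr
          exact le_max_right _ _
  · have hα : (0 : ℝ) ≤ 1 / (n : ℝ) := by positivity
    -- A weighted Chebyshev inequality. Where `F` is nonzero, `u > h`, so `u - l ≥ k / L` and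
    -- `Ψ^-(k/R)` is at most `L^q` times the lower-level density. Hölder then gains over the trivial
    -- bound.
    have hpt : ∀ x, ENNReal.ofReal (φ (k / R)) ^ (1 / (n : ℝ)) * F x ≤
        (ENNReal.ofReal L ^ q * H x) ^ (1 / (n : ℝ)) * F x := by
      intro x
      rcases (hw0 x).eq_or_lt with h1 | h1
      · simp [hF, ← h1, hφ.zero]
      gcongr
      have hxs : x ∈ Metric.closedBall x₀ s := by
        by_contra hx
        simp [hwd, hζT x hx] at h1
      have hxv : 0 < v x := h1.trans_le (hwv x)
      have hxu : h < u x := by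
        by_contra hx
        have : v x = 0 := max_eq_right (by linarith)
        linarith
      rw [hH, indicator_of_mem (hsB hxs)]
      have hgr := hM.growth x (hρΩ (hsB hxs))
      refine (hM.ofReal_minus_le hball (hρB (hsB hxs)) (by positivity)).trans ?_
      refine le_trans (ENNReal.ofReal_le_ofReal (hgr.le_of_le (by positivity) ?_))
        (ofReal_map_mul_le hgr hL (div_nonneg (hl0 x) hR.le))
      rw [mul_div_assoc']
      refine div_le_div_of_nonneg_right (hkL.trans ?_) hR.le
      gcongr
      exact le_trans (by linarith) (le_max_left _ _)
    calc ENNReal.ofReal (φ (k / R)) ^ (1 / (n : ℝ)) * ∫⁻ x, F x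
        = ∫⁻ x, ENNReal.ofReal (φ (k / R)) ^ (1 / (n : ℝ)) * F x :=
          (lintegral_const_mul'' _ hFm).symm
      _ ≤ ∫⁻ x, (ENNReal.ofReal L ^ q * H x) ^ (1 / (n : ℝ)) * F x := lintegral_mono hpt
      _ ≤ _ := lintegral_rpow_mul_self_le hn (hHm.const_mul _) hFm
      _ = _ := by rw [lintegral_const_mul'' _ hHm, hHY]

end MultiPhase

/-! ### The De Giorgi iteration. -/

namespace MultiPhase

/-- The De Giorgi iteration: a small mean excess forces an upper bound on the half ball. -/
theorem exists_degiorgi_const {n : ℕ} (hn : 2 ≤ n) (q : ℕ) {Q : ℝ} (hQ : 1 ≤ Q) (K : ℝ) (M : ℝ≥0) :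
    ∃ δ : ℝ, 0 < δ ∧ ∀ {Ω : Set (EuclideanSpace ℝ (Fin n))}
      {Ψ : EuclideanSpace ℝ (Fin n) → ℝ → ℝ} {Ψm : EuclideanSpace ℝ (Fin n) → ℝ → ℝ → ℝ}
      {u : EuclideanSpace ℝ (Fin n) → ℝ}
      {Du : EuclideanSpace ℝ (Fin n) → EuclideanSpace ℝ (Fin n)},
      IsLocalQMinimizer Ω Ψ Q u Du → IsMultiPhase Ω q K Ψ Ψm → IsOpen Ω →
      ∀ (x₀ : EuclideanSpace ℝ (Fin n)) (R m k : ℝ), 0 < R → R ≤ 1 → Metric.ball x₀ R ⊆ Ω →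
      0 < k →
      ∫⁻ x in Metric.ball x₀ (3 * R / 4), ENNReal.ofReal (Ψ x (max (u x - m) 0 / R)) ≤ M →
      ∫⁻ x in Metric.ball x₀ (3 * R / 4), ENNReal.ofReal (Ψ x (max (u x - m) 0 / R)) ≤
        ENNReal.ofReal (δ * R ^ n * Ψm x₀ R (k / R)) →
      ∀ᵐ x ∂(volume.restrict (Metric.ball x₀ (R / 2))), u x ≤ m + k := by
  obtain ⟨C, hC, hstep⟩ := exists_degiorgi_step_const hn q hQ
  -- With `L = 2^(i+4)` at stage `i`, the factor `(L^q)^3` is `(2^(4q))^3 (2^(3q))^i`. Adding `1` to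
  -- `K` and to the exponent in `B` secures `C' ≥ 1` and `B > 1` even in degenerate cases.
  set C' : ℝ≥0∞ := (ENNReal.ofReal K + 1) * (C : ℝ≥0∞) ^ 2 * (2 + M) * (2 ^ (4 * q)) ^ 3 with hC'
  set B : ℝ≥0∞ := 2 ^ (3 * q + 1) with hB
  have hC1 : (1 : ℝ≥0∞) ≤ C := by exact_mod_cast hC
  have hC'1 : 1 ≤ C' := by
    refine one_le_mul (one_le_mul (one_le_mul le_add_self (one_le_pow₀ hC1)) ?_)
      (one_le_pow₀ (one_le_pow₀ one_le_two))
    exact le_trans one_le_two le_self_add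
  have hC't : C' ≠ ∞ := by
    rw [hC']
    refine ENNReal.mul_ne_top (ENNReal.mul_ne_top (ENNReal.mul_ne_top ?_ (by simp)) ?_) (by simp)
    · exact ENNReal.add_ne_top.2 ⟨ENNReal.ofReal_ne_top, by simp⟩
    · exact ENNReal.add_ne_top.2 ⟨by simp, by simp⟩
  have hB1 : 1 < B := one_lt_pow₀ ENNReal.one_lt_two (by omega)
  have hBt : B ≠ ∞ := by rw [hB]; simp
  set N := n ^ 2 with hN
  have hN0 : N ≠ 0 := by positivity
  set δ : ℝ≥0∞ := (B⁻¹ ^ N * C'⁻¹) ^ N with hδ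
  have hδ0 : δ ≠ 0 := pow_ne_zero _ (mul_ne_zero (pow_ne_zero _ (ENNReal.inv_ne_zero.2 hBt))
    (ENNReal.inv_ne_zero.2 hC't))
  have hδt : δ ≠ ∞ := ENNReal.pow_ne_top (ENNReal.mul_ne_top (ENNReal.pow_ne_top
    (ENNReal.inv_ne_top.2 (zero_lt_one.trans hB1).ne'))
    (ENNReal.inv_ne_top.2 (zero_lt_one.trans_le hC'1).ne'))
  refine ⟨δ.toReal, ENNReal.toReal_pos hδ0 hδt, ?_⟩
  intro Ω Ψ Ψm u Du hmin hM hΩ x₀ R m k hR hR1 hball hk hYM hYδ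
  have hφ := hM.growth_minus x₀ R hR hball
  set φ := Ψm x₀ R with hφd
  set V := ENNReal.ofReal (φ (k / R)) with hV
  have hφk : 0 < φ (k / R) := hφ.pos _ (by positivity)
  set T := ENNReal.ofReal R ^ n * V with hT
  have hT0 : T ≠ 0 := mul_ne_zero (pow_ne_zero _ (by simpa using hR)) (by simpa [hV] using hφk)
  have hTt : T ≠ ∞ := ENNReal.mul_ne_top (ENNReal.pow_ne_top ENNReal.ofReal_ne_top)
    ENNReal.ofReal_ne_top
  -- Radii decrease from `3R/4` to `R/2` while levels rise from `m` to `m + k`, both geometrically.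
  set r : ℕ → ℝ := fun i => R / 2 * (1 + (1 / 2) ^ (i + 1)) with hr
  set l : ℕ → ℝ := fun i => m + k * (1 - (1 / 2) ^ i) with hl
  set Y : ℕ → ℝ≥0∞ := fun i =>
    ∫⁻ x in Metric.ball x₀ (r i), ENNReal.ofReal (Ψ x (max (u x - l i) 0 / R)) with hY
  have hp0 : ∀ i : ℕ, (0 : ℝ) < (1 / 2) ^ i := fun i => by positivity
  have hp1 : ∀ i : ℕ, ((1 : ℝ) / 2) ^ i ≤ 1 := fun i => pow_le_one₀ (by norm_num) (by norm_num)
  have hrR : ∀ i, r i ≤ R := fun i => by simp only [hr]; nlinarith [hp1 (i + 1)]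
  have hr2 : ∀ i, R / 2 < r i := fun i => by simp only [hr]; nlinarith [hp0 (i + 1)]
  have hrsub : ∀ i, r i - r (i + 1) = R * (1 / 2) ^ (i + 3) := fun i => by
    simp only [hr]; ring
  have hlsub : ∀ i, l (i + 1) - l i = k * (1 / 2) ^ (i + 1) := fun i => by
    simp only [hl]; ring
  have hlm : ∀ i, m ≤ l i := fun i => by simp only [hl]; nlinarith [hp1 i]
  have hlk : ∀ i, l i ≤ m + k := fun i => by simp only [hl]; nlinarith [hp0 i]
  have hr0 : r 0 = 3 * R / 4 := by simp only [hr]; ring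
  have hl0 : l 0 = m := by simp [hl]
  have hY0 : Y 0 = ∫⁻ x in Metric.ball x₀ (3 * R / 4),
      ENNReal.ofReal (Ψ x (max (u x - m) 0 / R)) := by simp only [hY, hr0, hl0]
  have hYle : ∀ i, Y i ≤ M := by
    intro i
    refine le_trans ?_ hYM
    rw [← hr0]
    have hri : r i ≤ r 0 := by
      simp only [hr]
      have : ((1 : ℝ) / 2) ^ (i + 1) ≤ (1 / 2) ^ (0 + 1) :=
        pow_le_pow_of_le_one (by norm_num) (by norm_num) (by omega)
      nlinarith
    calc Y i ≤ ∫⁻ x in Metric.ball x₀ (r 0), ENNReal.ofReal (Ψ x (max (u x - l i) 0 / R)) :=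
          lintegral_mono_set (Metric.ball_subset_ball hri)
      _ ≤ _ := by
          refine setLIntegral_mono' measurableSet_ball fun x hx => ENNReal.ofReal_le_ofReal ?_
          refine (hM.growth x (hball (Metric.ball_subset_ball (hrR 0) hx))).le_of_le
            (div_nonneg (le_max_right _ _) hR.le) (div_le_div_of_nonneg_right ?_ hR.le)
          exact max_le_max (by linarith [hlm i]) le_rfl
  have hrec : ∀ i, Y i / T ≤ 1 → Y (i + 1) / T ≤ C' * B ^ i * (Y i / T) *
      (Y i / T) ^ (1 / (N : ℝ)) := by
    intro i hZ1
    -- `L = 2^(i+4)` makes `2R = L (r_i - r_{i+1})` an equality, and `L (l_{i+1} - l_i) = 8k` is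
    -- more than enough.
    have hpp : (2 : ℝ) ^ (i + 4) * (1 / 2) ^ (i + 3) = 2 := by
      rw [one_div, inv_pow]; field_simp; ring
    have hpp' : (2 : ℝ) ^ (i + 4) * (1 / 2) ^ (i + 1) = 8 := by
      rw [one_div, inv_pow]; field_simp; ring
    obtain ⟨S, X, h1, h2, h3⟩ := hstep hmin hM hΩ x₀ R (r (i + 1)) (r i) (l i) (l (i + 1)) k
      (2 ^ (i + 4)) hR hR1 hball ((by positivity : 0 < R / 2).trans (hr2 _))
      (by have := hrsub i; have := mul_pos hR (hp0 (i + 3)); linarith) (hrR i)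
      (one_le_pow₀ one_le_two)
      (by rw [hrsub i, mul_left_comm, hpp, mul_comm])
      (by have := hlsub i; have := mul_pos hk (hp0 (i + 1)); linarith) hk.le
      (by rw [hlsub i, mul_left_comm, hpp']; linarith)
      (ne_top_of_le_ne_top (by simp) (hYle i))
    set b : ℝ≥0∞ := ENNReal.ofReal (2 ^ (i + 4)) ^ q with hb
    have hb1 : 1 ≤ b := one_le_pow₀ (by
      rw [← ENNReal.ofReal_one]; exact ENNReal.ofReal_le_ofReal (one_le_pow₀ one_le_two))
    have key := superlinear_step hn hC1 hb1 hT hT0 hTt rfl (hYle i) hZ1 h1 h2 h3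
    refine key.trans ?_
    have hb3 : b ^ 3 ≤ (2 ^ (4 * q)) ^ 3 * B ^ i := by
      have e : b ^ 3 = (2 ^ (4 * q)) ^ 3 * (2 ^ (3 * q)) ^ i := by
        rw [hb, ENNReal.ofReal_pow (by norm_num), ENNReal.ofReal_ofNat]
        simp only [← pow_mul, ← pow_add]
        congr 1; ring
      rw [e, hB]
      gcongr
      · exact one_le_two
      · omega
    calc ENNReal.ofReal K * (C : ℝ≥0∞) ^ 2 * (2 + M) * b ^ 3 * (Y i / T) *
          (Y i / T) ^ (1 / ((n ^ 2 : ℕ) : ℝ))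
        ≤ (ENNReal.ofReal K + 1) * (C : ℝ≥0∞) ^ 2 * (2 + M) * ((2 ^ (4 * q)) ^ 3 * B ^ i) *
          (Y i / T) * (Y i / T) ^ (1 / (N : ℝ)) := by
          gcongr
          exact le_self_add
      _ = _ := by rw [hC']; ring
  have hZ0 : Y 0 / T ≤ δ := by
    refine ENNReal.div_le_of_le_mul ?_
    rw [hY0]
    refine hYδ.trans (le_of_eq ?_)
    rw [mul_assoc, ENNReal.ofReal_mul ENNReal.toReal_nonneg, ENNReal.ofReal_toReal hδt,
      ENNReal.ofReal_mul (by positivity), ENNReal.ofReal_pow hR.le]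
  have hlim := tendsto_zero_of_superlinear (Z := fun i => Y i / T) hN0 hC'1 hC't hB1 hBt hrec hZ0
  set J := ∫⁻ x in Metric.ball x₀ (R / 2), ENNReal.ofReal (Ψ x (max (u x - (m + k)) 0 / R)) with hJ
  have hBΩ : Metric.ball x₀ (R / 2) ⊆ Ω :=
    (Metric.ball_subset_ball (by linarith)).trans hball
  -- The limiting ball and level give an excess below every `Y i`, so it must vanish, and positivity
  -- of `Ψ x` off `0` then forces `u ≤ m + k`.
  have hJY : ∀ i, J / T ≤ Y i / T := by
    intro i
    gcongr
    calc J ≤ ∫⁻ x in Metric.ball x₀ (R / 2), ENNReal.ofReal (Ψ x (max (u x - l i) 0 / R)) := by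
          refine setLIntegral_mono' measurableSet_ball fun x hx => ENNReal.ofReal_le_ofReal ?_
          refine (hM.growth x (hBΩ hx)).le_of_le
            (div_nonneg (le_max_right _ _) hR.le) (div_le_div_of_nonneg_right ?_ hR.le)
          exact max_le_max (by linarith [hlk i]) le_rfl
      _ ≤ Y i := lintegral_mono_set (Metric.ball_subset_ball (hr2 i).le)
  have hJ0 : J = 0 := by
    have h1 : J / T ≤ 0 := ge_of_tendsto' hlim hJY
    rcases ENNReal.div_eq_zero_iff.1 (le_antisymm h1 zero_le) with h | h
    · exact h
    · exact absurd h hTt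
  have hum : AEStronglyMeasurable u (volume.restrict Ω) :=
    hmin.hasWeakGradient.locInt.aestronglyMeasurable
  have hmeas : AEMeasurable (fun x => ENNReal.ofReal (Ψ x (max (u x - (m + k)) 0 / R)))
      (volume.restrict (Metric.ball x₀ (R / 2))) := by
    refine AEMeasurable.mono_set hBΩ ?_
    refine (hM.aemeasurable (fun x => max (u x - (m + k)) 0 / R) ?_ fun x =>
      div_nonneg (le_max_right _ _) hR.le).ennreal_ofReal
    exact ((hum.aemeasurable.sub_const _).max aemeasurable_const).div_const R
  filter_upwards [(lintegral_eq_zero_iff' hmeas).1 hJ0, ae_restrict_mem measurableSet_ball]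
    with x hx hxB
  by_contra hlt
  rw [not_le] at hlt
  have h1 : 0 < max (u x - (m + k)) 0 / R := div_pos (lt_max_of_lt_left (by linarith)) hR
  have h2 := (hM.growth x (hBΩ hxB)).pos _ h1
  have h3 : ENNReal.ofReal (Ψ x (max (u x - (m + k)) 0 / R)) = 0 := hx
  rw [ENNReal.ofReal_eq_zero] at h3
  linarith

end MultiPhase

/-! ### The local maximum principle and its consequences. -/

namespace MultiPhase

section

variable {n : ℕ} {Ω : Set (EuclideanSpace ℝ (Fin n))} {Q : ℝ}
  {Ψ : EuclideanSpace ℝ (Fin n) → ℝ → ℝ}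
  {u : EuclideanSpace ℝ (Fin n) → ℝ} {Du : EuclideanSpace ℝ (Fin n) → EuclideanSpace ℝ (Fin n)}

lemma essSupport_neg (w : EuclideanSpace ℝ (Fin n) → ℝ) :
    essSupport Ω (fun x => -w x) = essSupport Ω w := by
  simp only [essSupport, neg_eq_zero]

/-- The density depends on the gradient only through its norm, so lower bounds for `u` follow from
upper bounds for `-u`. -/
lemma IsLocalQMinimizer.neg (h : IsLocalQMinimizer Ω Ψ Q u Du) :
    IsLocalQMinimizer Ω Ψ Q (fun x => -u x) (fun x => -Du x) where
  hasWeakGradient := h.hasWeakGradient.neg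
  energy_lt_top := by simpa [energy] using h.energy_lt_top
  minimal v Dv hv hc := by
    have e : essSupport Ω ((fun x => -u x) - v) = essSupport Ω (u - fun x => -v x) := by
      rw [← essSupport_neg]
      congr 1
      funext x
      simp only [Pi.sub_apply]
      ring
    rw [e] at hc ⊢
    simpa [energy] using h.minimal _ _ hv.neg hc

end

/-- The local maximum principle for the positive part. -/
theorem exists_sup_const {n : ℕ} (hn : 2 ≤ n) (q : ℕ) {Q : ℝ} (hQ : 1 ≤ Q) (K : ℝ) (M : ℝ≥0) :
    ∃ c : ℝ, 0 < c ∧ ∀ {Ω : Set (EuclideanSpace ℝ (Fin n))}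
      {Ψ : EuclideanSpace ℝ (Fin n) → ℝ → ℝ} {Ψm : EuclideanSpace ℝ (Fin n) → ℝ → ℝ → ℝ}
      {u : EuclideanSpace ℝ (Fin n) → ℝ}
      {Du : EuclideanSpace ℝ (Fin n) → EuclideanSpace ℝ (Fin n)},
      IsLocalQMinimizer Ω Ψ Q u Du → IsMultiPhase Ω q K Ψ Ψm → IsOpen Ω →
      ∀ (x₀ : EuclideanSpace ℝ (Fin n)) (R m : ℝ), 0 < R → R ≤ 1 → Metric.ball x₀ R ⊆ Ω →
      ∫⁻ x in Metric.ball x₀ (3 * R / 4), ENNReal.ofReal (Ψ x (max (u x - m) 0 / R)) ≤ M →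
      (∃ k, ∀ᵐ x ∂(volume.restrict (Metric.ball x₀ (R / 2))), u x ≤ k) ∧
      ∀ᵐ x ∂(volume.restrict (Metric.ball x₀ (R / 2))),
        ENNReal.ofReal (Ψm x₀ R (max (u x - m) 0 / R)) ≤ ENNReal.ofReal (c / R ^ n) *
          ∫⁻ x in Metric.ball x₀ (3 * R / 4), ENNReal.ofReal (Ψ x (max (u x - m) 0 / R)) := by
  obtain ⟨δ, hδ, hdg⟩ := exists_degiorgi_const hn q hQ K M
  refine ⟨1 / δ, by positivity, ?_⟩
  intro Ω Ψ Ψm u Du hmin hM hΩ x₀ R m hR hR1 hball hYM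
  have hφ := hM.growth_minus x₀ R hR hball
  set Y := ∫⁻ x in Metric.ball x₀ (3 * R / 4), ENNReal.ofReal (Ψ x (max (u x - m) 0 / R)) with hY
  have hYt : Y ≠ ∞ := ne_top_of_le_ne_top (by simp) hYM
  set a : ℝ := 1 / δ / R ^ n * Y.toReal with ha
  have ha0 : 0 ≤ a := by positivity
  have haY : ENNReal.ofReal (1 / δ / R ^ n) * Y = ENNReal.ofReal a := by
    rw [ha, ENNReal.ofReal_mul (by positivity), ENNReal.ofReal_toReal hYt]
  -- The level `k = R t` is chosen so that the smallness condition of the iteration holds. The shift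
  -- `ε` keeps `t` positive when the excess `a` is zero, and is removed along `1 / (j + 1)`.
  have hj : ∀ ε : ℝ, 0 < ε → ∃ t, 0 < t ∧ Ψm x₀ R t = a + ε ∧
      ∀ᵐ x ∂(volume.restrict (Metric.ball x₀ (R / 2))), u x ≤ m + R * t := by
    intro ε hε
    obtain ⟨t, ht, hte⟩ := hφ.exists_eq (show 0 < a + ε by linarith)
    refine ⟨t, ht, hte, hdg hmin hM hΩ x₀ R m (R * t) hR hR1 hball (by positivity) hYM ?_⟩
    rw [mul_div_cancel_left₀ t hR.ne', hte]
    change Y ≤ _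
    rw [← ENNReal.ofReal_toReal hYt]
    refine ENNReal.ofReal_le_ofReal ?_
    calc Y.toReal = δ * R ^ n * a := by rw [ha]; field_simp
      _ ≤ δ * R ^ n * (a + ε) := by gcongr; linarith
  refine ⟨?_, ?_⟩
  · obtain ⟨t, -, -, h⟩ := hj 1 one_pos
    exact ⟨_, h⟩
  · have hall : ∀ᵐ x ∂(volume.restrict (Metric.ball x₀ (R / 2))), ∀ j : ℕ,
        Ψm x₀ R (max (u x - m) 0 / R) ≤ a + 1 / ((j : ℝ) + 1) := by
      rw [ae_all_iff]
      intro j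
      obtain ⟨t, ht, hte, h⟩ := hj (1 / ((j : ℝ) + 1)) (by positivity)
      filter_upwards [h] with x hx
      rw [← hte]
      refine hφ.le_of_le (div_nonneg (le_max_right _ _) hR.le) ?_
      rw [div_le_iff₀ hR, mul_comm]
      exact max_le (by linarith) (by positivity)
    filter_upwards [hall] with x hx
    rw [haY]
    refine ENNReal.ofReal_le_ofReal ?_
    have hlim : Tendsto (fun j : ℕ => a + 1 / ((j : ℝ) + 1)) atTop (𝓝 (a + 0)) :=
      tendsto_const_nhds.add tendsto_one_div_add_atTop_nhds_zero_nat
    rw [add_zero] at hlim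
    exact ge_of_tendsto' hlim hx

/-- Scaling of the volume of balls, which turns the factor `R^(-n)` into an average. -/
lemma ofReal_div_mul_setLIntegral_eq {n : ℕ} (x₀ : EuclideanSpace ℝ (Fin n)) {R : ℝ} (hR : 0 < R)
    {c : ℝ} (hc : 0 ≤ c) (f : EuclideanSpace ℝ (Fin n) → ℝ≥0∞) :
    ENNReal.ofReal (c / R ^ n) * ∫⁻ x in Metric.ball x₀ R, f x =
      ENNReal.ofReal (c * volume.real (Metric.ball (0 : EuclideanSpace ℝ (Fin n)) 1)) *
        ⨍⁻ x in Metric.ball x₀ R, f x ∂volume := by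
  have hv0 : volume (Metric.ball (0 : EuclideanSpace ℝ (Fin n)) 1) ≠ 0 :=
    (Metric.measure_ball_pos _ _ one_pos).ne'
  have hvt : volume (Metric.ball (0 : EuclideanSpace ℝ (Fin n)) 1) ≠ ∞ :=
    measure_ball_lt_top.ne
  have hR0 : ENNReal.ofReal (R ^ n) ≠ 0 := by simp; positivity
  rw [setLAverage_eq, Measure.addHaar_ball_of_pos _ _ hR, finrank_euclideanSpace, Fintype.card_fin,
    ENNReal.ofReal_div_of_pos (by positivity), ENNReal.ofReal_mul hc, ofReal_measureReal hvt]
  rw [div_eq_mul_inv, div_eq_mul_inv, ENNReal.mul_inv (Or.inr hvt) (Or.inr hv0)]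
  set V := volume (Metric.ball (0 : EuclideanSpace ℝ (Fin n)) 1)
  set I := ∫⁻ x in Metric.ball x₀ R, f x
  calc _ = (V * V⁻¹) * (ENNReal.ofReal c * (ENNReal.ofReal (R ^ n))⁻¹ * I) := by
        rw [ENNReal.mul_inv_cancel hv0 hvt, one_mul]
    _ = _ := by ring

/-- The local estimates for local quasiminimizers of a multi-phase functional, together with their
local boundedness. -/
theorem exists_local_bound_const {n : ℕ} (hn : 2 ≤ n) (q : ℕ) {Q : ℝ} (hQ : 1 ≤ Q) (K : ℝ)
    (en : ℝ≥0) :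
    ∃ c : ℝ, 1 ≤ c ∧ ∀ {Ω : Set (EuclideanSpace ℝ (Fin n))}
      {Ψ : EuclideanSpace ℝ (Fin n) → ℝ → ℝ} {Ψm : EuclideanSpace ℝ (Fin n) → ℝ → ℝ → ℝ}
      {u : EuclideanSpace ℝ (Fin n) → ℝ}
      {Du : EuclideanSpace ℝ (Fin n) → EuclideanSpace ℝ (Fin n)},
      IsLocalQMinimizer Ω Ψ Q u Du → IsMultiPhase Ω q K Ψ Ψm → IsOpen Ω →
      energy Ψ Du Ω ≤ en → IntegrableOn u Ω →
      (∀ (x₀ : EuclideanSpace ℝ (Fin n)) (R : ℝ), 0 < R → R ≤ 1 → Metric.ball x₀ R ⊆ Ω →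
        (eLpNorm (fun x => Ψm x₀ R (|max (u x - ⨍ y in Metric.ball x₀ R, u y) 0 / R|)) ∞
            (volume.restrict (Metric.ball x₀ (R / 2))) ≤
          ENNReal.ofReal c * ⨍⁻ x in Metric.ball x₀ R, ENNReal.ofReal
            (Ψ x (|max (u x - ⨍ y in Metric.ball x₀ R, u y) 0 / R|)) ∂volume) ∧
        (eLpNorm (fun x => Ψm x₀ R (|max (-(u x - ⨍ y in Metric.ball x₀ R, u y)) 0 / R|)) ∞
            (volume.restrict (Metric.ball x₀ (R / 2))) ≤
          ENNReal.ofReal c * ⨍⁻ x in Metric.ball x₀ R, ENNReal.ofReal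
            (Ψ x (|max (-(u x - ⨍ y in Metric.ball x₀ R, u y)) 0 / R|)) ∂volume) ∧
        (∃ N : Set (EuclideanSpace ℝ (Fin n)), volume N = 0 ∧
          ∀ x₁ ∈ Metric.ball x₀ (R / 2) \ N, ∀ x₂ ∈ Metric.ball x₀ (R / 2) \ N,
            ENNReal.ofReal (Ψm x₀ R (|(u x₁ - u x₂) / R|)) ≤
              ENNReal.ofReal c * ⨍⁻ x in Metric.ball x₀ R,
                ENNReal.ofReal (Ψ x ‖Du x‖) ∂volume)) ∧
      (∀ S : Set (EuclideanSpace ℝ (Fin n)), S ⊆ Ω → IsCompact S →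
        MemLp u ∞ (volume.restrict S)) := by
  obtain ⟨CP, hCP⟩ := exists_sobolev_poincare_const hn q
  set P : ℝ≥0 := CP * K.toNNReal * (1 + en ^ (1 / (n : ℝ))) with hP
  have hPe : (P : ℝ≥0∞) = CP * ENNReal.ofReal K * (1 + (en : ℝ≥0∞) ^ (1 / (n : ℝ))) := by
    rw [hP]
    push_cast
    rw [ENNReal.coe_rpow_of_nonneg _ (by positivity)]
    rfl
  -- By the Sobolev–Poincaré inequality the excess over the mean is at most `P` times the energy on
  -- every admissible ball, so a single threshold `M = P * en` serves all of them.
  obtain ⟨c, hc, hsup⟩ := exists_sup_const hn q hQ K (P * en)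
  set v := volume.real (Metric.ball (0 : EuclideanSpace ℝ (Fin n)) 1) with hv
  have hv0 : 0 ≤ v := measureReal_nonneg
  set c' : ℝ := max 1 (max (c * v) (2 ^ q * (2 * (c * P)) * v)) with hc'
  refine ⟨c', le_max_left _ _, ?_⟩
  intro Ω Ψ Ψm u Du hmin hM hΩ hen hui
  have hball_est : ∀ (x₀ : EuclideanSpace ℝ (Fin n)) (R : ℝ), 0 < R → R ≤ 1 →
      Metric.ball x₀ R ⊆ Ω →
      ∫⁻ x in Metric.ball x₀ (3 * R / 4),
        ENNReal.ofReal (Ψ x (|u x - ⨍ y in Metric.ball x₀ R, u y| / R)) ≤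
        P * ∫⁻ x in Metric.ball x₀ R, ENNReal.ofReal (Ψ x ‖Du x‖) := by
    intro x₀ R hR hR1 hball
    refine (hCP hmin.hasWeakGradient hM x₀ R hR hR1 hball (hui.mono_set hball)).trans ?_
    rw [hPe]
    gcongr
    exact (lintegral_mono_set hball).trans hen
  have hboth : ∀ (x₀ : EuclideanSpace ℝ (Fin n)) (R : ℝ), 0 < R → R ≤ 1 →
      Metric.ball x₀ R ⊆ Ω → ∀ u' : EuclideanSpace ℝ (Fin n) → ℝ, ∀ m' : ℝ,
      (∀ x, |u' x - m'| = |u x - ⨍ y in Metric.ball x₀ R, u y|) →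
      ∫⁻ x in Metric.ball x₀ (3 * R / 4), ENNReal.ofReal (Ψ x (max (u' x - m') 0 / R)) ≤
        P * ∫⁻ x in Metric.ball x₀ R, ENNReal.ofReal (Ψ x ‖Du x‖) := by
    intro x₀ R hR hR1 hball u' m' he
    refine le_trans ?_ (hball_est x₀ R hR hR1 hball)
    refine setLIntegral_mono' measurableSet_ball fun x hx => ENNReal.ofReal_le_ofReal ?_
    have hxB : x ∈ Metric.ball x₀ R := Metric.ball_subset_ball (by linarith) hx
    refine (hM.growth x (hball hxB)).le_of_le (div_nonneg (le_max_right _ _) hR.le)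
      (div_le_div_of_nonneg_right ?_ hR.le)
    rw [← he]
    exact max_le (le_abs_self _) (abs_nonneg _)
  have hM' : ∀ (x₀ : EuclideanSpace ℝ (Fin n)) (R : ℝ), Metric.ball x₀ R ⊆ Ω →
      P * ∫⁻ x in Metric.ball x₀ R, ENNReal.ofReal (Ψ x ‖Du x‖) ≤ ((P * en : ℝ≥0) : ℝ≥0∞) := by
    intro x₀ R hball
    push_cast
    gcongr
    exact (lintegral_mono_set hball).trans hen
  have hnorm : ∀ (x₀ : EuclideanSpace ℝ (Fin n)) (R : ℝ), 0 < R → Metric.ball x₀ R ⊆ Ω →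
      ∀ f : EuclideanSpace ℝ (Fin n) → ℝ, (∀ x, 0 ≤ f x) →
      (∀ᵐ x ∂(volume.restrict (Metric.ball x₀ (R / 2))),
        ENNReal.ofReal (Ψm x₀ R (f x / R)) ≤ ENNReal.ofReal (c / R ^ n) *
          ∫⁻ x in Metric.ball x₀ (3 * R / 4), ENNReal.ofReal (Ψ x (f x / R))) →
      eLpNorm (fun x => Ψm x₀ R (|f x / R|)) ∞ (volume.restrict (Metric.ball x₀ (R / 2))) ≤
          ENNReal.ofReal c' * ⨍⁻ x in Metric.ball x₀ R, ENNReal.ofReal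
            (Ψ x (|f x / R|)) ∂volume := by
    intro x₀ R hR hball f hf h
    have hab : ∀ x, |f x / R| = f x / R := fun x => abs_of_nonneg (div_nonneg (hf x) hR.le)
    simp only [hab]
    rw [eLpNorm_exponent_top]
    refine essSup_le_of_ae_le _ ?_
    filter_upwards [h] with x hx
    rw [Real.enorm_eq_ofReal ((hM.growth_minus x₀ R hR hball).nonneg (div_nonneg (hf x) hR.le))]
    calc _ ≤ ENNReal.ofReal (c / R ^ n) *
          ∫⁻ x in Metric.ball x₀ R, ENNReal.ofReal (Ψ x (f x / R)) := by
          refine hx.trans ?_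
          gcongr
          linarith
      _ = ENNReal.ofReal (c * v) * _ := ofReal_div_mul_setLIntegral_eq x₀ hR hc.le _
      _ ≤ _ := by
          gcongr
          exact (le_max_left _ _).trans (le_max_right _ _)
  have hneg : ∀ (m : ℝ) x, -u x - -m = -(u x - m) := fun m x => by ring
  refine ⟨fun x₀ R hR hR1 hball => ?_, fun S hSΩ hS => ?_⟩
  · set m := ⨍ y in Metric.ball x₀ R, u y with hm
    have hpY := hboth x₀ R hR hR1 hball u m fun x => rfl
    have hnY := hboth x₀ R hR hR1 hball (fun x => -u x) (-m) fun x => by rw [hneg, abs_neg]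
    obtain ⟨-, hp⟩ := hsup hmin hM hΩ x₀ R m hR hR1 hball (hpY.trans (hM' x₀ R hball))
    obtain ⟨-, hn'⟩ := hsup hmin.neg hM hΩ x₀ R (-m) hR hR1 hball (hnY.trans (hM' x₀ R hball))
    refine ⟨hnorm x₀ R hR hball (fun x => max (u x - m) 0) (fun x => le_max_right _ _) hp, ?_, ?_⟩
    · refine hnorm x₀ R hR hball (fun x => max (-(u x - m)) 0) (fun x => le_max_right _ _) ?_
      simpa only [hneg] using hn'
    · have hφ := hM.growth_minus x₀ R hR hball
      set φ := Ψm x₀ R with hφd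
      set I := ∫⁻ x in Metric.ball x₀ R, ENNReal.ofReal (Ψ x ‖Du x‖) with hI
      -- At each point `|u - m|` is the positive part of `u - m` or of `-u - (-m)`, and both
      -- excesses are bounded by `P I`. The triangle inequality through `m` and doubling finish the
      -- oscillation estimate.
      have hae : ∀ᵐ x, x ∈ Metric.ball x₀ (R / 2) →
          ENNReal.ofReal (φ (|u x - m| / R)) ≤ ENNReal.ofReal (c / R ^ n) * (P * I) := by
        rw [← ae_restrict_iff' measurableSet_ball]
        filter_upwards [hp, hn'] with x h1 h2
        rcases abs_cases (u x - m) with h3 | h3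
        · have h4 : max (u x - m) 0 = |u x - m| := by rw [h3.1]; exact max_eq_left h3.2
          rw [h4] at h1
          exact h1.trans (by gcongr)
        · have h4 : max (-u x - -m) 0 = |u x - m| := by
            rw [hneg, h3.1]; exact max_eq_left (by linarith [h3.2])
          rw [h4] at h2
          exact h2.trans (by gcongr)
      refine ⟨{x | ¬ (x ∈ Metric.ball x₀ (R / 2) →
          ENNReal.ofReal (φ (|u x - m| / R)) ≤ ENNReal.ofReal (c / R ^ n) * (P * I))},
        ae_iff.1 hae, fun x₁ hx₁ x₂ hx₂ => ?_⟩
      have b1 := not_not.1 hx₁.2 hx₁.1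
      have b2 := not_not.1 hx₂.2 hx₂.1
      have htri : |(u x₁ - u x₂) / R| ≤ |u x₁ - m| / R + |u x₂ - m| / R := by
        rw [abs_div, abs_of_pos hR, ← add_div]
        refine div_le_div_of_nonneg_right ?_ hR.le
        rw [abs_sub_comm (u x₂) m]
        exact abs_sub_le _ _ _
      calc ENNReal.ofReal (φ (|(u x₁ - u x₂) / R|))
          ≤ 2 ^ q * (ENNReal.ofReal (φ (|u x₁ - m| / R)) + ENNReal.ofReal (φ (|u x₂ - m| / R))) :=
            ofReal_map_le_of_le_add hφ (abs_nonneg _) (by positivity) (by positivity) htri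
        _ ≤ 2 ^ q * (ENNReal.ofReal (c / R ^ n) * (P * I) +
              ENNReal.ofReal (c / R ^ n) * (P * I)) := by gcongr
        _ = ENNReal.ofReal ((2 ^ q * (2 * (c * P))) / R ^ n) * I := by
            have e : (2 ^ q * (2 * (c * P))) / R ^ n = 2 ^ q * (2 * ((c / R ^ n) * P)) := by ring
            rw [e, ENNReal.ofReal_mul (by positivity), ENNReal.ofReal_mul (by positivity),
              ENNReal.ofReal_mul (by positivity), ENNReal.ofReal_pow (by norm_num),
              ENNReal.ofReal_ofNat, ENNReal.ofReal_coe_nnreal]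
            ring
        _ = ENNReal.ofReal ((2 ^ q * (2 * (c * P))) * v) * _ :=
            ofReal_div_mul_setLIntegral_eq x₀ hR (by positivity) _
        _ ≤ _ := by
            gcongr
            exact (le_max_right _ _).trans (le_max_right _ _)
  · have hum : AEStronglyMeasurable u (volume.restrict Ω) := hui.1
    obtain ⟨C, hC⟩ : ∃ C, ∀ᵐ x ∂(volume.restrict S), ‖u x‖ ≤ C := by
      -- Bounds on half balls around the points of `S` are patched together by compactness.
      refine hS.induction_on (p := fun s => ∃ C, ∀ᵐ x ∂(volume.restrict s), ‖u x‖ ≤ C)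
        ⟨0, by simp⟩ ?_ ?_ ?_
      · rintro s t hst ⟨C, hC⟩
        exact ⟨C, ae_restrict_of_ae_restrict_of_subset hst hC⟩
      · rintro s t ⟨C, hC⟩ ⟨D, hD⟩
        refine ⟨max C D, (ae_restrict_union_iff _ _ _).2 ⟨?_, ?_⟩⟩
        · filter_upwards [hC] with x hx using hx.trans (le_max_left _ _)
        · filter_upwards [hD] with x hx using hx.trans (le_max_right _ _)
      · intro x hx
        obtain ⟨ε, hε, hεΩ⟩ := Metric.isOpen_iff.1 hΩ x (hSΩ hx)
        set R := min ε 1 with hR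
        have hR0 : 0 < R := lt_min hε one_pos
        have hR1 : R ≤ 1 := min_le_right _ _
        have hball : Metric.ball x R ⊆ Ω := (Metric.ball_subset_ball (min_le_left _ _)).trans hεΩ
        refine ⟨Metric.ball x (R / 2), mem_nhdsWithin_of_mem_nhds
          (Metric.ball_mem_nhds x (by positivity)), ?_⟩
        set m := ⨍ y in Metric.ball x R, u y with hm
        have hpY := hboth x R hR0 hR1 hball u m fun x => rfl
        have hnY := hboth x R hR0 hR1 hball (fun x => -u x) (-m) fun x => by rw [hneg, abs_neg]
        obtain ⟨⟨k, hk⟩, -⟩ := hsup hmin hM hΩ x R m hR0 hR1 hball (hpY.trans (hM' x R hball))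
        obtain ⟨⟨k', hk'⟩, -⟩ := hsup hmin.neg hM hΩ x R (-m) hR0 hR1 hball
          (hnY.trans (hM' x R hball))
        refine ⟨max k k', ?_⟩
        filter_upwards [hk, hk'] with y h1 h2
        exact abs_le'.2 ⟨h1.trans (le_max_left _ _), h2.trans (le_max_right _ _)⟩
    exact memLp_top_of_bound (hum.mono_set hSΩ) C hC

end MultiPhase

theorem theorem5p2 (n : ℕ) (hn : 2 ≤ n) (sG sHa sHb Q : ℝ) (hQ : 1 ≤ Q)
    (lam normA normB en normU wa1 wb1 : ℝ≥0) :
    -- the constant depends on the data only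
    ∃ c : ℝ, 1 ≤ c ∧
      ∀ (Ω : Set (EuclideanSpace ℝ (Fin n))) (G Ha Hb ωa ωb : ℝ → ℝ)
        (a b u : EuclideanSpace ℝ (Fin n) → ℝ)
        (Du : EuclideanSpace ℝ (Fin n) → EuclideanSpace ℝ (Fin n)),
        IsOpen Ω → Bornology.IsBounded Ω →
        IsN G sG → IsN Ha sHa → IsN Hb sHb →
        IsModulus ωa → IsModulus ωb → ωa 1 ≤ wa1 → ωb 1 ≤ wb1 →
        (∀ x ∈ Ω, 0 ≤ a x) → (∀ x ∈ Ω, 0 ≤ b x) →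
        MemModSpace Ω ωa a → modNorm Ω ωa a ≤ normA →
        MemModSpace Ω ωb b → modNorm Ω ωb b ≤ normB →
        lambdaOne n ωa ωb G Ha Hb ≤ lam →
        MemMOSobolev Ω (Psi G Ha Hb a b) u Du →
        IsLocalQMinimizer Ω (Psi G Ha Hb a b) Q u Du →
        energy (Psi G Ha Hb a b) Du Ω ≤ en →
        eLpNorm u 1 (volume.restrict Ω) ≤ normU →
        (∀ (x₀ : EuclideanSpace ℝ (Fin n)) (R : ℝ), 0 < R → R ≤ 1 → Metric.ball x₀ R ⊆ Ω →
          -- the estimate for the positive part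
          (eLpNorm (fun x => PsiMinus G Ha Hb a b (Metric.ball x₀ R)
                (|max (u x - ⨍ y in Metric.ball x₀ R, u y) 0 / R|)) ∞
              (volume.restrict (Metric.ball x₀ (R / 2))) ≤
            ENNReal.ofReal c * ⨍⁻ x in Metric.ball x₀ R, ENNReal.ofReal
              (Psi G Ha Hb a b x (|max (u x - ⨍ y in Metric.ball x₀ R, u y) 0 / R|)) ∂volume) ∧
          -- the estimate for the negative part
          (eLpNorm (fun x => PsiMinus G Ha Hb a b (Metric.ball x₀ R)
                (|max (-(u x - ⨍ y in Metric.ball x₀ R, u y)) 0 / R|)) ∞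
              (volume.restrict (Metric.ball x₀ (R / 2))) ≤
            ENNReal.ofReal c * ⨍⁻ x in Metric.ball x₀ R, ENNReal.ofReal
              (Psi G Ha Hb a b x (|max (-(u x - ⨍ y in Metric.ball x₀ R, u y)) 0 / R|)) ∂volume) ∧
          -- the oscillation estimate
          (∃ N : Set (EuclideanSpace ℝ (Fin n)), volume N = 0 ∧
            ∀ x₁ ∈ Metric.ball x₀ (R / 2) \ N, ∀ x₂ ∈ Metric.ball x₀ (R / 2) \ N,
              ENNReal.ofReal (PsiMinus G Ha Hb a b (Metric.ball x₀ R) (|(u x₁ - u x₂) / R|)) ≤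
                ENNReal.ofReal c * ⨍⁻ x in Metric.ball x₀ R,
                  ENNReal.ofReal (Psi G Ha Hb a b x ‖Du x‖) ∂volume)) ∧
        -- local boundedness
        (∀ K : Set (EuclideanSpace ℝ (Fin n)), K ⊆ Ω → IsCompact K →
          MemLp u ∞ (volume.restrict K)) := by
  -- One integer doubling exponent serves `G`, `H_a` and `H_b`; it is fixed from the indices before
  -- any function is given.
  obtain ⟨q, hq⟩ : ∃ q : ℕ, max sG (max sHa sHb) + 1 ≤ (q : ℝ) := exists_nat_ge _
  have hqG : sG + 1 ≤ q := le_trans (by gcongr; exact le_max_left _ _) hq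
  have hqa : sHa + 1 ≤ q :=
    le_trans (by gcongr; exact (le_max_left _ _).trans (le_max_right _ _)) hq
  have hqb : sHb + 1 ≤ q :=
    le_trans (by gcongr; exact (le_max_right _ _).trans (le_max_right _ _)) hq
  obtain ⟨c, hc, hmain⟩ := exists_local_bound_const hn q hQ
    (1 + 2 * normA * ((1 + wa1) * lam) + 2 * normB * ((1 + wb1) * lam)) en
  refine ⟨c, hc, ?_⟩
  intro Ω G Ha Hb ωa ωb a b u Du hΩ _ hG hHa hHb hωa hωb hwa hwb ha0 hb0 ha hna hb hnb hlam _ hmin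
    hen hu
  have hM := isMultiPhase (by omega) hΩ (hG.isGrowth hqG) (hHa.isGrowth hqa) (hHb.isGrowth hqb)
    hωa hωb hwa hwb ha0 hb0 ha hna hb hnb hlam
  have hui : IntegrableOn u Ω :=
    memLp_one_iff_integrable.1 ⟨hmin.hasWeakGradient.locInt.aestronglyMeasurable,
      hu.trans_lt ENNReal.coe_lt_top⟩
  exact hmain hmin hM hΩ hen hui
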